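/- **Setting.** Let $0<\varepsilon<1$ and let $\mathcal C$ be an insertion-deletion code of block length $N\ge 1$ with $M\ge 1$ (distinct) codewords $c_0,\dots,c_{M-1}$ over an alphabet $\Sigma_{\mathcal C}$. Suppose $\mathcal C$ is $L$-list decodable from any $N(1-\varepsilon)$ deletions and $N(1-\varepsilon)$ insertions: for every string $y$ at most $L$ codewords can be turned into $y$ by at most $N(1-\varepsilon)$ deletions and at most $N(1-\varepsilon)$ insertions. Let $\mathrm{Dec}_{\mathcal C}$ be a list decoder which, given a string $y$ of length at most $N$, lists without repetition the indices of all these codewords in time at most $T_{\mathrm{Dec}_{\mathcal C}}(N)$. Let $I=c_0c_1\cdots c_{M-1}$, let $m$ be any string of length $NM$ over an alphabet $\Sigma$, let $S=m\times I$ be the string with $S_p=(m_p,I_p)$, and let $S'$ be any string over $\Sigma\times\Sigma_{\mathcal C}$. Split $S$ and $S'$ into consecutive blocks $S(0),S(1),\dots$ and $S'(0),S'(1),\dots$ of length $N$ (the last block of $S'$ may be shorter), and let $C'_i$ be the $\Sigma_{\mathcal C}$-component of $S'(i)$. **Algorithm 1** (input $S$, $S'$, $N$, $w=1/\varepsilon$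 and $\mathrm{Dec}_{\mathcal C}$ as a subroutine). 1. Build the bipartite graph $G$ whose two parts are the positions of $S$ and of $S'$: for each block $S'(i)$, each $j\in\mathrm{Dec}_{\mathcal C}(C'_i)$ and each block index $k$ of $S$ with $|k-j|\le w$, join each position in $S(k)$ to each position in $S'(i)$ that carries the same symbol. 2. Return a largest non-crossing matching of $G$, i.e. a longest list of edges $(p_1,p'_1),\dots,(p_\ell,p'_\ell)$ of $G$ with $p_1<\dots<p_\ell$ and $p'_1<\dots<p'_\ell$. The machine is a unit-cost word RAM with word length at least $c\log_2 n$, where $n=\max(|S|,|S'|)$ and $c$ is an absolute constant. Each symbol of $\Sigma$ and of $\Sigma_{\mathcal C}$, and the number $\lfloor 1/\varepsilon\rfloor$, fits into a word, and a call of $\mathrm{Dec}_{\mathcal C}$ costs its running time plus one step. **Theorem.** For $n\ge 3$, the graph $G$ has $O\!\left(\frac{nNL}{\varepsilon}\right)$ edges, and Algorithm 1 can be implemented to run in time $$O\!\left(\frac nN\cdot T_{\mathrm{Dec}_{\mathcal C}}(N)+\frac{NL}{\varepsilon}\cdot n\log\log n\right).$$ More precisely, there are a fixed program for step 1, which stores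 the edges of $G$ in memory as a list of pairs, and a fixed program for step 2, run after it, which outputs a largest non-crossing matching of $G$, such that the total number of steps is within this bound. The two programs and the constants hidden in the $O(\cdot)$'s are absolute: they do not depend on the code, its decoder, $N$, $M$, $L$, $\varepsilon$, the alphabets, the word length or the strings. -/

import Mathlib

/-! ### Word RAM with an oracle

Memory cells and registers hold words, that is, natural numbers below `2 ^ W`. Programs are
finite and structured; every elementary instruction and every test costs one step. -/

/-- Arithmetic operations and comparisons on words (results are reduced modulo `2 ^ W`;
subtraction is truncated at zero, comparisons return `1` or `0`). -/
inductive WordOp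
  | plus | minus | times | quot | rem | less | equal

/-- The value of an operation on two `W`-bit words. -/
def WordOp.eval (W : ℕ) : WordOp → ℕ → ℕ → ℕ
  | .plus, x, y => (x + y) % 2 ^ W
  | .minus, x, y => (x - y) % 2 ^ W
  | .times, x, y => (x * y) % 2 ^ W
  | .quot, x, y => (x / y) % 2 ^ W
  | .rem, x, y => (x % y) % 2 ^ W
  | .less, x, y => (if x < y then 1 else 0) % 2 ^ W
  | .equal, x, y => (if x = y then 1 else 0) % 2 ^ W

/-- Programs. Registers are named by natural numbers. -/
inductive Cmd
  /-- do nothing -/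
  | skip
  /-- register `d` receives the constant `k` -/
  | const (d k : ℕ)
  /-- register `d` receives the result of `op` on registers `a` and `b` -/
  | op (op : WordOp) (d a b : ℕ)
  /-- register `d` receives the memory cell whose address is in register `a` -/
  | load (d a : ℕ)
  /-- the memory cell whose address is in register `a` receives register `b` -/
  | store (a b : ℕ)
  /-- append register `a` to the pending query -/
  | ask (a : ℕ)
  /-- submit the pending query to the oracle; register `d` receives the length of the answer -/
  | call (d : ℕ)
  /-- register `d` receives the next word of the answer -/
  | read (d : ℕ)
  /-- sequential composition -/
  | seq (c₁ c₂ : Cmd)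
  /-- run `c₁` if register `a` is nonzero, else `c₂` -/
  | ite (a : ℕ) (c₁ c₂ : Cmd)
  /-- run `c` as long as register `a` is nonzero -/
  | loop (a : ℕ) (c : Cmd)

/-- A subroutine: its answer to each input string of words and its running time on it. -/
structure Oracle where
  answer : List ℕ → List ℕ
  time : List ℕ → ℕ

/-- A machine configuration: registers, memory, the pending query and the unread part of the
last answer. -/
structure Config where
  reg : ℕ → ℕ
  mem : ℕ → ℕ
  query : List ℕ
  reply : List ℕ

/-- The configuration with register `d` set to `v`. -/
def Config.setReg (s : Config) (d v : ℕ) : Config :=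
  { s with reg := Function.update s.reg d v }

/-- `Exec W D c s s' t`: on the machine with word length `W` and subroutine `D`, the program `c`
started in `s` halts in `s'` after exactly `t` steps. A call of the subroutine costs its
running time, plus one step. -/
inductive Exec (W : ℕ) (D : Oracle) : Cmd → Config → Config → ℕ → Prop
  | skip (s : Config) : Exec W D .skip s s 1
  | const (s : Config) (d k : ℕ) : Exec W D (.const d k) s (s.setReg d (k % 2 ^ W)) 1
  | op (s : Config) (o : WordOp) (d a b : ℕ) :
      Exec W D (.op o d a b) s (s.setReg d (o.eval W (s.reg a) (s.reg b))) 1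
  | load (s : Config) (d a : ℕ) : Exec W D (.load d a) s (s.setReg d (s.mem (s.reg a))) 1
  | store (s : Config) (a b : ℕ) :
      Exec W D (.store a b) s
        { s with mem := Function.update s.mem (s.reg a) (s.reg b) } 1
  | ask (s : Config) (a : ℕ) :
      Exec W D (.ask a) s { s with query := s.query ++ [s.reg a] } 1
  | call (s : Config) (d : ℕ) :
      Exec W D (.call d) s
        ({ s with query := [], reply := D.answer s.query }.setReg d
          ((D.answer s.query).length % 2 ^ W))
        (1 + D.time s.query)
  | read (s : Config) (d : ℕ) :
      Exec W D (.read d) s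
        ({ s with reply := s.reply.tail }.setReg d (s.reply.headD 0 % 2 ^ W)) 1
  | seq {s s₁ s₂ : Config} {c₁ c₂ : Cmd} {t₁ t₂ : ℕ} :
      Exec W D c₁ s s₁ t₁ → Exec W D c₂ s₁ s₂ t₂ → Exec W D (.seq c₁ c₂) s s₂ (t₁ + t₂)
  | ite_true {s s' : Config} {a : ℕ} {c₁ c₂ : Cmd} {t : ℕ} :
      s.reg a ≠ 0 → Exec W D c₁ s s' t → Exec W D (.ite a c₁ c₂) s s' (1 + t)
  | ite_false {s s' : Config} {a : ℕ} {c₁ c₂ : Cmd} {t : ℕ} :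
      s.reg a = 0 → Exec W D c₂ s s' t → Exec W D (.ite a c₁ c₂) s s' (1 + t)
  | loop_true {s s₁ s₂ : Config} {a : ℕ} {c : Cmd} {t₁ t₂ : ℕ} :
      s.reg a ≠ 0 → Exec W D c s s₁ t₁ → Exec W D (.loop a c) s₁ s₂ t₂ →
        Exec W D (.loop a c) s s₂ (1 + t₁ + t₂)
  | loop_false {s : Config} {a : ℕ} {c : Cmd} :
      s.reg a = 0 → Exec W D (.loop a c) s s 1

/-- The list of pairs of words held by a configuration: register `1` holds its length and
register `0` the address of its first entry; pairs are stored in consecutive cells. -/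
def Config.pairs (s : Config) : List (ℕ × ℕ) :=
  (List.range (s.reg 1)).map fun e => (s.mem (s.reg 0 + 2 * e), s.mem (s.reg 0 + 2 * e + 1))

/-! ### Insertion-deletion codes and their list decoders -/

/-- `x` can be turned into `y` by at most `d` deletions and at most `e` insertions: deleting
symbols of `x` leaves `z`, and inserting symbols into `z` gives `y`. -/
def TurnsInto {α : Type*} (x y : List α) (d e : ℝ) : Prop :=
  ∃ z : List α, z.Sublist x ∧ z.Sublist y ∧
    (x.length : ℝ) - z.length ≤ d ∧ (y.length : ℝ) - z.length ≤ e

/-- A code with `M` codewords and block length `N` over the alphabet `{0, …, q - 1}`. -/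
structure InsdelCode (q N M : ℕ) where
  word : Fin M → List (Fin q)
  length_word : ∀ j, (word j).length = N
  word_injective : Function.Injective word

/-- The codewords (named by their positions in the code) that can be turned into `y` by at most
`N (1 - ε)` deletions and at most `N (1 - ε)` insertions. -/
def InsdelCode.candidates {q N M : ℕ} (C : InsdelCode q N M) (ε : ℝ) (y : List (Fin q)) :
    Set (Fin M) :=
  {j | TurnsInto (C.word j) y (N * (1 - ε)) (N * (1 - ε))}

/-- `C` is `L`-list decodable from any `N (1 - ε)` deletions and `N (1 - ε)` insertions. -/
def InsdelCode.ListDecodable {q N M : ℕ} (C : InsdelCode q N M) (ε : ℝ) (L : ℕ) : Prop :=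
  ∀ y : List (Fin q), (C.candidates ε y).ncard ≤ L

/-- A string over `{0, …, q - 1}` as a string of words. -/
def toWords {q : ℕ} (y : List (Fin q)) : List ℕ := y.map Fin.val

/-- `D` is a list decoder of `C` with running time at most `T`: on each received string of
length at most `N` it lists, without repetition, the positions of all candidates. -/
def IsListDecoder {q N M : ℕ} (C : InsdelCode q N M) (ε : ℝ) (T : ℝ) (D : Oracle) : Prop :=
  ∀ y : List (Fin q), y.length ≤ N →
    (D.answer (toWords y)).Nodup ∧
    (∀ k : ℕ, k ∈ D.answer (toWords y) ↔ ∃ j ∈ C.candidates ε y, (j : ℕ) = k) ∧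
    (D.time (toWords y) : ℝ) ≤ T

/-- The indexing string: the concatenation of all codewords. -/
def InsdelCode.indexString {q N M : ℕ} (C : InsdelCode q N M) : List (Fin q) :=
  (List.ofFn C.word).flatten

/-! ### The graph and its non-crossing matchings

Positions and blocks are numbered from `0`: position `p` of a string lies in block `p / N`. -/

/-- The second components of the `i`-th block (of length `N`; the last block may be shorter). -/
def indexBlock {σ q : ℕ} (N : ℕ) (S' : List (Fin σ × Fin q)) (i : ℕ) : List (Fin q) :=
  ((S'.drop (i * N)).take N).map Prod.snd

/-- The edges of the bipartite graph `G` on the positions of `S` and of `S'`: positions `p` of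
`S` and `p'` of `S'` are joined if they carry identical symbols and the block of `p` is at
distance at most `1 / ε` from a block listed by the decoder on the block of `p'`. -/
def graphEdges {σ q : ℕ} (N : ℕ) (ε : ℝ) (D : Oracle) (S S' : List (Fin σ × Fin q)) :
    Set (ℕ × ℕ) :=
  {e | ∃ (hp : e.1 < S.length) (hp' : e.2 < S'.length), S[e.1] = S'[e.2] ∧
    ∃ j ∈ D.answer (toWords (indexBlock N S' (e.2 / N))),
      |((e.1 / N : ℕ) : ℝ) - (j : ℝ)| ≤ 1 / ε}

/-- `l` lists the edges `(u_{i₁}, v_{j₁}), (u_{i₂}, v_{j₂}), …` of a non-crossing matching in the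
bipartite graph with edge set `E`: `i₁ < i₂ < ⋯` and `j₁ < j₂ < ⋯`. -/
def IsNonCrossingMatching (E : Set (ℕ × ℕ)) (l : List (ℕ × ℕ)) : Prop :=
  l.Pairwise (fun e f => e.1 < f.1 ∧ e.2 < f.2) ∧ ∀ e ∈ l, e ∈ E

/-- `l` lists the edges of a largest non-crossing matching. -/
def IsLargestNonCrossingMatching (E : Set (ℕ × ℕ)) (l : List (ℕ × ℕ)) : Prop :=
  IsNonCrossingMatching E l ∧ ∀ l', IsNonCrossingMatching E l' → l'.length ≤ l.length

/-- The memory at the start: the symbols of `S` and then those of `S'`, two words for each,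
followed by zeros. -/
def inputWords {σ q : ℕ} (S S' : List (Fin σ × Fin q)) : List ℕ :=
  (S ++ S').flatMap fun x => [x.1.val, x.2.val]

/-- The starting configuration: the registers `0, 1, 2, 3` hold `|S|`, `|S'|`, `N` and `w`. -/
def startConfig {σ q : ℕ} (S S' : List (Fin σ × Fin q)) (N w : ℕ) : Config where
  reg := fun r => [S.length, S'.length, N, w].getD r 0
  mem := fun a => (inputWords S S').getD a 0
  query := []
  reply := []

/-!
The graph has few edges, and they come in a convenient order. A received block has at most
`min L M` candidates, each candidate is near at most `2 / ε + 1` blocks of `N` positions, so at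
most `3 N L / ε` edges meet a position of `S'`. The first program runs through the positions of
`S'` in increasing order and writes these edges down (`Listing.program_spec`,
`Listing.mem_edges_iff`); an edge may be written several times, which does no harm.

It remains to find a longest chain in a list of `r` pairs, sorted by the second components, with
`O(log log n)` steps for each pair. This is the method of Hunt and Szymanski. The depth of an edge
is the length of a longest chain that ends with it. For each depth `k` that has occurred one keeps
the threshold: the least first component of an edge of depth `k`. Thresholds increase with `k`, so
the depth of the next edge is found from the greatest threshold below its first component
(`Chain.Thresholds.depth_eq`), and afterwards this edge replaces one threshold or adds one
(`Chain.Thresholds.update`). As members of a chain have different second components, all edges with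
the same second component are searched for before any of them changes the thresholds; hence the two
counters `b ≤ a` of `Matching.sweep`. Pointers to predecessors give back a longest chain
(`Matching.output_spec`), and no matching is longer by `Chain.length_le`.

The thresholds are kept in a van Emde Boas tree, whose universe `2 ^ 2 ^ K` is the least one that
exceeds `|S|`. Thus `K = O(log log n)`, and insertion, deletion and predecessor search take `O(K)`
steps (`VEB.ins_spec`, `VEB.del_spec`, `VEB.locate_spec`). The machine has no recursion, so these
operations are loops: neither extreme element of a node is stored below it, and therefore each
operation passes to only one of summary and cluster at each level. For a predecessor search the
levels visited are remembered in an array and then traversed upwards. The memory behind the input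
is zero at the start, and zero encodes empty nodes, so a tree of size polynomial in `n` needs no
initialization.

Programs are verified through `Runs`, which bounds the running time and describes the final
configuration up to the registers used for intermediate results; straight-line code is treated by
weakest preconditions (`Blk.runs`), loops by `Runs.while_count`.
-/

/-! ### Compiling expressions and verifying structured programs -/

/-- The configuration with memory cell `a` set to `v`. -/
def Config.setMem (s : Config) (a v : ℕ) : Config :=
  { s with mem := Function.update s.mem a v }

namespace Config

@[simp] theorem setReg_reg (s : Config) (d v r : ℕ) :
    (s.setReg d v).reg r = if r = d then v else s.reg r := by
  simp [setReg, Function.update_apply]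

@[simp] theorem setReg_mem (s : Config) (d v : ℕ) : (s.setReg d v).mem = s.mem := rfl
@[simp] theorem setReg_query (s : Config) (d v : ℕ) : (s.setReg d v).query = s.query := rfl
@[simp] theorem setReg_reply (s : Config) (d v : ℕ) : (s.setReg d v).reply = s.reply := rfl
@[simp] theorem setMem_reg (s : Config) (a v : ℕ) : (s.setMem a v).reg = s.reg := rfl
@[simp] theorem setMem_query (s : Config) (a v : ℕ) : (s.setMem a v).query = s.query := rfl
@[simp] theorem setMem_reply (s : Config) (a v : ℕ) : (s.setMem a v).reply = s.reply := rfl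

theorem setMem_mem (s : Config) (a v b : ℕ) :
    (s.setMem a v).mem b = if b = a then v else s.mem b := by
  simp [setMem, Function.update_apply]

/-- All registers and memory cells hold `W`-bit words, and the words `0` and `1` are distinct. -/
def WF (W : ℕ) (s : Config) : Prop :=
  1 < 2 ^ W ∧ (∀ r, s.reg r < 2 ^ W) ∧ ∀ a, s.mem a < 2 ^ W

/-- Two configurations agree up to the registers from `100` on, which are reserved for
intermediate results of expressions. -/
def Eqv (s s' : Config) : Prop :=
  (∀ r, r < 100 → s.reg r = s'.reg r) ∧ s.mem = s'.mem ∧ s.query = s'.query ∧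
    s.reply = s'.reply

theorem Eqv.refl (s : Config) : s.Eqv s := ⟨fun _ _ => rfl, rfl, rfl, rfl⟩

theorem Eqv.trans {s₁ s₂ s₃ : Config} (h : s₁.Eqv s₂) (h' : s₂.Eqv s₃) : s₁.Eqv s₃ :=
  ⟨fun r hr => (h.1 r hr).trans (h'.1 r hr), h.2.1.trans h'.2.1, h.2.2.1.trans h'.2.2.1,
    h.2.2.2.trans h'.2.2.2⟩

theorem Eqv.setReg {s s' : Config} (h : s.Eqv s') (d v : ℕ) :
    (s.setReg d v).Eqv (s'.setReg d v) := by
  refine ⟨fun r hr => ?_, h.2.1, h.2.2.1, h.2.2.2⟩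
  simp only [setReg_reg]
  split
  · rfl
  · exact h.1 r hr

end Config

theorem WordOp.eval_lt {W x y : ℕ} (hW : 1 < 2 ^ W) (o : WordOp) : o.eval W x y < 2 ^ W := by
  cases o <;> exact Nat.mod_lt _ (by omega)

theorem Exec.wf {W : ℕ} {D : Oracle} {c : Cmd} {s s' : Config} {t : ℕ}
    (h : Exec W D c s s' t) (hs : s.WF W) : s'.WF W := by
  have key : ∀ (u : Config) (d v : ℕ), u.WF W → v < 2 ^ W → (u.setReg d v).WF W := by
    intro u d v hu hv
    refine ⟨hu.1, fun r => ?_, hu.2.2⟩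
    rw [Config.setReg_reg]
    split
    · exact hv
    · exact hu.2.1 r
  induction h with
  | skip => exact hs
  | const s d k => exact key _ _ _ hs (Nat.mod_lt _ (by have := hs.1; omega))
  | op s o d a b => exact key _ _ _ hs (o.eval_lt hs.1)
  | load s d a => exact key _ _ _ hs (hs.2.2 _)
  | store s a b =>
    refine ⟨hs.1, hs.2.1, fun r => ?_⟩
    simp only [Function.update_apply]
    split
    · exact hs.2.1 _
    · exact hs.2.2 _
  | ask s a => exact hs
  | call s d => exact key _ _ _ hs (Nat.mod_lt _ (by have := hs.1; omega))
  | read s d => exact key _ _ _ hs (Nat.mod_lt _ (by have := hs.1; omega))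
  | seq _ _ ih₁ ih₂ => exact ih₂ (ih₁ hs)
  | ite_true _ _ ih => exact ih hs
  | ite_false _ _ ih => exact ih hs
  | loop_true _ _ _ ih₁ ih₂ => exact ih₂ (ih₁ hs)
  | loop_false => exact hs

/-- Arithmetic expressions over registers, literals and memory cells. -/
inductive Expr
  | var (r : ℕ)
  | lit (k : ℕ)
  | bin (o : WordOp) (a b : Expr)
  | get (a : Expr)

/-- The value of an operation on natural numbers, without reduction modulo the word size. -/
def WordOp.ideal : WordOp → ℕ → ℕ → ℕ
  | .plus, x, y => x + y
  | .minus, x, y => x - y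
  | .times, x, y => x * y
  | .quot, x, y => x / y
  | .rem, x, y => x % y
  | .less, x, y => if x < y then 1 else 0
  | .equal, x, y => if x = y then 1 else 0

namespace Expr

instance : Add Expr := ⟨.bin .plus⟩
instance : Sub Expr := ⟨.bin .minus⟩
instance : Mul Expr := ⟨.bin .times⟩
instance : Div Expr := ⟨.bin .quot⟩
instance : Mod Expr := ⟨.bin .rem⟩
instance (n : ℕ) : OfNat Expr n := ⟨.lit n⟩

/-- The comparison `a < b` as an expression with value `1` or `0`. -/
def lt (a b : Expr) : Expr := .bin .less a b

/-- The comparison `a = b` as an expression with value `1` or `0`. -/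
def eq (a b : Expr) : Expr := .bin .equal a b

/-- Code that evaluates an expression into register `d`; the registers below `d` are kept. -/
def code : Expr → ℕ → Cmd
  | .var r, d => .seq (.const d 0) (.op .plus d r d)
  | .lit k, d => .const d k
  | .bin o a b, d => .seq (a.code d) (.seq (b.code (d + 1)) (.op o d d (d + 1)))
  | .get a, d => .seq (a.code d) (.load d d)

/-- The running time of the code of an expression. -/
def cost : Expr → ℕ
  | .var _ => 2
  | .lit _ => 1
  | .bin _ a b => a.cost + (b.cost + 1)
  | .get a => a.cost + 1

/-- The value of an expression, computed in the natural numbers. -/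
def val (s : Config) : Expr → ℕ
  | .var r => s.reg r
  | .lit k => k
  | .bin o a b => o.ideal (a.val s) (b.val s)
  | .get a => s.mem (a.val s)

/-- No overflow occurs in the evaluation of the expression. -/
def ok (W : ℕ) (s : Config) : Expr → Prop
  | .var r => r < 100
  | .lit k => k < 2 ^ W
  | .bin .plus a b => a.ok W s ∧ b.ok W s ∧ a.val s + b.val s < 2 ^ W
  | .bin .times a b => a.ok W s ∧ b.ok W s ∧ a.val s * b.val s < 2 ^ W
  | .bin _ a b => a.ok W s ∧ b.ok W s
  | .get a => a.ok W s

section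
variable (W : ℕ) (s : Config) (a b : Expr)

@[simp] theorem val_var (r : ℕ) : (var r).val s = s.reg r := rfl
@[simp] theorem val_lit (k : ℕ) : (no_index (OfNat.ofNat k) : Expr).val s = k := rfl
@[simp] theorem val_get : (get a).val s = s.mem (a.val s) := rfl
@[simp] theorem val_add : (a + b).val s = a.val s + b.val s := rfl
@[simp] theorem val_sub : (a - b).val s = a.val s - b.val s := rfl
@[simp] theorem val_mul : (a * b).val s = a.val s * b.val s := rfl
@[simp] theorem val_div : (a / b).val s = a.val s / b.val s := rfl
@[simp] theorem val_mod : (a % b).val s = a.val s % b.val s := rfl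
@[simp] theorem val_lt : (a.lt b).val s = if a.val s < b.val s then 1 else 0 := rfl
@[simp] theorem val_eq : (a.eq b).val s = if a.val s = b.val s then 1 else 0 := rfl

@[simp] theorem ok_var (r : ℕ) : (var r).ok W s ↔ r < 100 := Iff.rfl
@[simp] theorem ok_lit (k : ℕ) : (no_index (OfNat.ofNat k) : Expr).ok W s ↔ k < 2 ^ W := Iff.rfl
@[simp] theorem ok_get : (get a).ok W s ↔ a.ok W s := Iff.rfl
@[simp] theorem ok_add :
    (a + b).ok W s ↔ a.ok W s ∧ b.ok W s ∧ a.val s + b.val s < 2 ^ W := Iff.rfl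
@[simp] theorem ok_sub : (a - b).ok W s ↔ a.ok W s ∧ b.ok W s := Iff.rfl
@[simp] theorem ok_mul :
    (a * b).ok W s ↔ a.ok W s ∧ b.ok W s ∧ a.val s * b.val s < 2 ^ W := Iff.rfl
@[simp] theorem ok_div : (a / b).ok W s ↔ a.ok W s ∧ b.ok W s := Iff.rfl
@[simp] theorem ok_mod : (a % b).ok W s ↔ a.ok W s ∧ b.ok W s := Iff.rfl
@[simp] theorem ok_lt : (a.lt b).ok W s ↔ a.ok W s ∧ b.ok W s := Iff.rfl
@[simp] theorem ok_eq : (a.eq b).ok W s ↔ a.ok W s ∧ b.ok W s := Iff.rfl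

end

/-- The code of an expression computes its value, provided that no overflow occurs. -/
theorem exec_code {W : ℕ} {D : Oracle} (e : Expr) {s : Config} (d : ℕ) (hs : s.WF W)
    {s₀ : Config} (h₀ : s.Eqv s₀) (he : e.ok W s₀) (hd : 100 ≤ d) :
    ∃ s', Exec W D (e.code d) s s' e.cost ∧ s'.reg d = e.val s₀ ∧
      (∀ r, r < d → s'.reg r = s.reg r) ∧ s'.mem = s.mem ∧ s'.query = s.query ∧
      s'.reply = s.reply := by
  induction e generalizing d s with
  | var r =>
    have hr : r < 100 := he
    refine ⟨_, .seq (.const _ _ _) (.op _ _ _ _ _), ?_, ?_, rfl, rfl, rfl⟩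
    · have := h₀.1 r hr ▸ hs.2.1 r
      simp [WordOp.eval, show r ≠ d by omega, val, Nat.mod_eq_of_lt this, h₀.1 r hr]
    · intro r' hr'
      simp [show r' ≠ d by omega]
  | lit k =>
    refine ⟨_, .const _ _ _, ?_, ?_, rfl, rfl, rfl⟩
    · simpa [val] using Nat.mod_eq_of_lt he
    · intro r' hr'
      simp [show r' ≠ d by omega]
  | bin o a b iha ihb =>
    have hab : a.ok W s₀ ∧ b.ok W s₀ := by
      cases o <;> first | exact he | exact ⟨he.1, he.2.1⟩
    obtain ⟨s₁, e₁, v₁, k₁, m₁, q₁, p₁⟩ := iha d hs h₀ hab.1 hd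
    have h₁ : s₁.Eqv s₀ :=
      Config.Eqv.trans ⟨fun r hr => k₁ r (by omega), m₁, q₁, p₁⟩ h₀
    have w₁ := e₁.wf hs
    obtain ⟨s₂, e₂, v₂, k₂, m₂, q₂, p₂⟩ := ihb (d + 1) w₁ h₁ hab.2 (by omega)
    have w₂ := e₂.wf w₁
    refine ⟨_, .seq e₁ (.seq e₂ (.op _ _ _ _ _)), ?_, ?_, ?_, ?_, ?_⟩
    · have hx : s₂.reg d = a.val s₀ := (k₂ d (by omega)).trans v₁
      have hxl := w₂.2.1 d
      have hyl := w₂.2.1 (d + 1)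
      rw [hx] at hxl
      rw [v₂] at hyl
      have h1 := hs.1
      simp only [Config.setReg_reg, if_true, hx, v₂, val]
      cases o
      · exact Nat.mod_eq_of_lt he.2.2
      · exact Nat.mod_eq_of_lt (by omega)
      · exact Nat.mod_eq_of_lt he.2.2
      · exact Nat.mod_eq_of_lt ((Nat.div_le_self _ _).trans_lt hxl)
      · exact Nat.mod_eq_of_lt ((Nat.mod_le _ _).trans_lt hxl)
      · exact Nat.mod_eq_of_lt (by split <;> omega)
      · exact Nat.mod_eq_of_lt (by split <;> omega)
    · intro r hr
      simp only [Config.setReg_reg, show r ≠ d by omega, if_false]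
      exact (k₂ r (by omega)).trans (k₁ r hr)
    · exact m₂.trans m₁
    · exact q₂.trans q₁
    · exact p₂.trans p₁
  | get a ih =>
    obtain ⟨s₁, e₁, v₁, k₁, m₁, q₁, p₁⟩ := ih d hs h₀ he hd
    refine ⟨_, .seq e₁ (.load _ _ _), ?_, ?_, m₁, q₁, p₁⟩
    · simp [val, v₁, m₁, h₀.2.1]
    · intro r hr
      simp only [Config.setReg_reg, show r ≠ d by omega, if_false]
      exact k₁ r hr

end Expr

/-- `Runs W D c t s Q`: started in any configuration of words that agrees with `s` up to
temporaries, the program `c` halts within `t` steps in a configuration that agrees up to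
temporaries with one that satisfies `Q`. -/
def Runs (W : ℕ) (D : Oracle) (c : Cmd) (t : ℕ) (s : Config) (Q : Config → Prop) : Prop :=
  ∀ s₀, s₀.Eqv s → s₀.WF W → ∃ s₁ t₁, Exec W D c s₀ s₁ t₁ ∧ t₁ ≤ t ∧ ∃ s', s₁.Eqv s' ∧ Q s'

namespace Runs

variable {W : ℕ} {D : Oracle} {c c₁ c₂ : Cmd} {t t₁ t₂ : ℕ} {s : Config} {Q R : Config → Prop}

theorem mono (h : Runs W D c t₁ s Q) (ht : t₁ ≤ t₂) (hQ : ∀ s', Q s' → R s') :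
    Runs W D c t₂ s R := by
  intro s₀ h₀ w₀
  obtain ⟨s₁, t, e, ht', s', h', q⟩ := h s₀ h₀ w₀
  exact ⟨s₁, t, e, ht'.trans ht, s', h', hQ _ q⟩

theorem seq (h : Runs W D c₁ t₁ s fun s' => Runs W D c₂ t₂ s' Q) :
    Runs W D (.seq c₁ c₂) (t₁ + t₂) s Q := by
  intro s₀ h₀ w₀
  obtain ⟨s₁, u₁, e₁, hu₁, s', h', q⟩ := h s₀ h₀ w₀
  obtain ⟨s₂, u₂, e₂, hu₂, q⟩ := q s₁ h' (e₁.wf w₀)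
  exact ⟨s₂, _, .seq e₁ e₂, by omega, q⟩

end Runs

/-- Straight-line code with tests: programs without loops and without calls. -/
inductive Blk
  | skip
  | set (x : ℕ) (e : Expr)
  | put (a e : Expr)
  | ask (e : Expr)
  | read (x : ℕ)
  | seq (b₁ b₂ : Blk)
  | ite (e : Expr) (b₁ b₂ : Blk)

namespace Blk

/-- The program of a block. -/
def cmd : Blk → Cmd
  | .skip => .skip
  | .set x e => .seq (e.code 100) (.seq (.const 101 0) (.op .plus x 100 101))
  | .put a e => .seq (a.code 100) (.seq (e.code 101) (.store 100 101))
  | .ask e => .seq (e.code 100) (.ask 100)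
  | .read x => .read x
  | .seq b₁ b₂ => .seq b₁.cmd b₂.cmd
  | .ite e b₁ b₂ => .seq (e.code 100) (.ite 100 b₁.cmd b₂.cmd)

/-- A bound for the running time of a block. -/
def cost : Blk → ℕ
  | .skip => 1
  | .set _ e => e.cost + 2
  | .put a e => a.cost + (e.cost + 1)
  | .ask e => e.cost + 1
  | .read _ => 1
  | .seq b₁ b₂ => b₁.cost + b₂.cost
  | .ite e b₁ b₂ => e.cost + (1 + (b₁.cost + b₂.cost))

/-- The weakest precondition of a block. -/
def wp (W : ℕ) : Blk → Config → (Config → Prop) → Prop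
  | .skip, s, Q => Q s
  | .set x e, s, Q => e.ok W s ∧ Q (s.setReg x (e.val s))
  | .put a e, s, Q => a.ok W s ∧ e.ok W s ∧ Q (s.setMem (a.val s) (e.val s))
  | .ask e, s, Q => e.ok W s ∧ Q { s with query := s.query ++ [e.val s] }
  | .read x, s, Q =>
      Q ({ s with reply := s.reply.tail }.setReg x (s.reply.headD 0 % 2 ^ W))
  | .seq b₁ b₂, s, Q => b₁.wp W s fun s' => b₂.wp W s' Q
  | .ite e b₁ b₂, s, Q =>
      e.ok W s ∧ (e.val s ≠ 0 → b₁.wp W s Q) ∧ (e.val s = 0 → b₂.wp W s Q)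

theorem wp.mono {W : ℕ} {b : Blk} {s : Config} {Q R : Config → Prop} (h : b.wp W s Q)
    (hQ : ∀ s', Q s' → R s') : b.wp W s R := by
  induction b generalizing s Q R with
  | skip => exact hQ _ h
  | set x e => exact ⟨h.1, hQ _ h.2⟩
  | put a e => exact ⟨h.1, h.2.1, hQ _ h.2.2⟩
  | ask e => exact ⟨h.1, hQ _ h.2⟩
  | read x => exact hQ _ h
  | seq b₁ b₂ ih₁ ih₂ => exact ih₁ h fun s' h' => ih₂ h' hQ
  | ite e b₁ b₂ ih₁ ih₂ =>
    exact ⟨h.1, fun hv => ih₁ (h.2.1 hv) hQ, fun hv => ih₂ (h.2.2 hv) hQ⟩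

theorem runs {W : ℕ} {D : Oracle} (b : Blk) {s : Config} {Q : Config → Prop}
    (h : b.wp W s Q) : Runs W D b.cmd b.cost s Q := by
  induction b generalizing s Q with
  | skip => exact fun s₀ h₀ w₀ => ⟨s₀, 1, .skip _, le_rfl, s, h₀, h⟩
  | set x e =>
    intro s₀ h₀ w₀
    obtain ⟨s₁, e₁, v₁, k₁, m₁, q₁, p₁⟩ := e.exec_code 100 w₀ h₀ h.1 le_rfl (D := D)
    refine ⟨_, _, .seq e₁ (.seq (.const _ _ _) (.op _ _ _ _ _)), le_rfl, _, ?_, h.2⟩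
    have hv := (e₁.wf w₀).2.1 100
    refine ⟨fun r hr => ?_, m₁.trans h₀.2.1, q₁.trans h₀.2.2.1, p₁.trans h₀.2.2.2⟩
    have hr' : r ≠ 101 := by omega
    rw [v₁] at hv
    by_cases hx : r = x
    · simp [hx, WordOp.eval, v₁, Nat.mod_eq_of_lt hv]
    · simp [hx, hr', k₁ r hr, h₀.1 r hr]
  | put a e =>
    intro s₀ h₀ w₀
    obtain ⟨s₁, e₁, v₁, k₁, m₁, q₁, p₁⟩ := a.exec_code 100 w₀ h₀ h.1 le_rfl (D := D)
    have h₁ : s₁.Eqv s := Config.Eqv.trans ⟨fun r hr => k₁ r hr, m₁, q₁, p₁⟩ h₀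
    obtain ⟨s₂, e₂, v₂, k₂, m₂, q₂, p₂⟩ :=
      e.exec_code 101 (e₁.wf w₀) h₁ h.2.1 (by omega) (D := D)
    refine ⟨_, _, .seq e₁ (.seq e₂ (.store _ _ _)), le_rfl, _, ?_, h.2.2⟩
    refine ⟨fun r hr => (k₂ r (by omega)).trans (h₁.1 r hr), ?_, q₂.trans h₁.2.2.1,
      p₂.trans h₁.2.2.2⟩
    simp only [Config.setMem, k₂ 100 (by omega), v₁, v₂, m₂, h₁.2.1]
  | ask e =>
    intro s₀ h₀ w₀
    obtain ⟨s₁, e₁, v₁, k₁, m₁, q₁, p₁⟩ := e.exec_code 100 w₀ h₀ h.1 le_rfl (D := D)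
    refine ⟨_, _, .seq e₁ (.ask _ _), le_rfl, _, ?_, h.2⟩
    refine ⟨fun r hr => (k₁ r hr).trans (h₀.1 r hr), m₁.trans h₀.2.1, ?_, p₁.trans h₀.2.2.2⟩
    simp only [v₁, q₁, h₀.2.2.1]
  | read x =>
    intro s₀ h₀ w₀
    refine ⟨_, _, .read _ _, le_rfl, _, ?_, h⟩
    have : s₀.reply = s.reply := h₀.2.2.2
    rw [this]
    exact Config.Eqv.setReg (s := { s₀ with reply := s.reply.tail })
      (s' := { s with reply := s.reply.tail }) ⟨h₀.1, h₀.2.1, h₀.2.2.1, rfl⟩ _ _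
  | seq b₁ b₂ ih₁ ih₂ =>
    exact Runs.seq ((ih₁ h).mono le_rfl fun s' hs' => ih₂ hs')
  | ite e b₁ b₂ ih₁ ih₂ =>
    intro s₀ h₀ w₀
    obtain ⟨s₁, e₁, v₁, k₁, m₁, q₁, p₁⟩ := e.exec_code 100 w₀ h₀ h.1 le_rfl (D := D)
    have h₁ : s₁.Eqv s := Config.Eqv.trans ⟨fun r hr => k₁ r hr, m₁, q₁, p₁⟩ h₀
    by_cases hv : e.val s = 0
    · obtain ⟨s₂, t, e₂, ht, q⟩ := ih₂ (h.2.2 hv) s₁ h₁ (e₁.wf w₀)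
      exact ⟨s₂, _, .seq e₁ (.ite_false (v₁.trans hv) e₂), by simp only [cost]; omega, q⟩
    · obtain ⟨s₂, t, e₂, ht, q⟩ := ih₁ (h.2.1 hv) s₁ h₁ (e₁.wf w₀)
      exact ⟨s₂, _, .seq e₁ (.ite_true (by rwa [v₁]) e₂), by simp only [cost]; omega, q⟩

end Blk

/-- Run `c₁` if `e` is nonzero, else `c₂`. -/
def Cmd.test (e : Expr) (c₁ c₂ : Cmd) : Cmd := .seq (e.code 100) (.ite 100 c₁ c₂)

/-- Run `c` as long as `e` is nonzero. -/
def Cmd.while (e : Expr) (c : Cmd) : Cmd := .seq (e.code 100) (.loop 100 (.seq c (e.code 100)))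

namespace Runs

variable {W : ℕ} {D : Oracle} {c c₁ c₂ : Cmd} {t t₁ t₂ : ℕ} {s : Config} {Q R : Config → Prop}

theorem test {e : Expr} (he : e.ok W s) (h₁ : e.val s ≠ 0 → Runs W D c₁ t s Q)
    (h₂ : e.val s = 0 → Runs W D c₂ t s Q) :
    Runs W D (.test e c₁ c₂) (e.cost + 1 + t) s Q := by
  intro s₀ h₀ w₀
  obtain ⟨s₁, e₁, v₁, k₁, m₁, q₁, p₁⟩ := e.exec_code 100 w₀ h₀ he le_rfl (D := D)
  have h' : s₁.Eqv s := Config.Eqv.trans ⟨fun r hr => k₁ r hr, m₁, q₁, p₁⟩ h₀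
  by_cases hv : e.val s = 0
  · obtain ⟨s₂, t, e₂, ht, q⟩ := h₂ hv s₁ h' (e₁.wf w₀)
    exact ⟨s₂, _, .seq e₁ (.ite_false (v₁.trans hv) e₂), by omega, q⟩
  · obtain ⟨s₂, t, e₂, ht, q⟩ := h₁ hv s₁ h' (e₁.wf w₀)
    exact ⟨s₂, _, .seq e₁ (.ite_true (by rwa [v₁]) e₂), by omega, q⟩

theorem while_done {e : Expr} (he : e.ok W s) (hv : e.val s = 0) (hQ : Q s) :
    Runs W D (.while e c) (e.cost + 1) s Q := by
  intro s₀ h₀ w₀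
  obtain ⟨s₁, e₁, v₁, k₁, m₁, q₁, p₁⟩ := e.exec_code 100 w₀ h₀ he le_rfl (D := D)
  have h' : s₁.Eqv s := Config.Eqv.trans ⟨fun r hr => k₁ r hr, m₁, q₁, p₁⟩ h₀
  exact ⟨s₁, _, .seq e₁ (.loop_false (v₁.trans hv)), le_rfl, s, h', hQ⟩

theorem while_step {e : Expr} (he : e.ok W s) (hv : e.val s ≠ 0)
    (h : Runs W D c t₁ s fun s' => Runs W D (.while e c) t₂ s' Q) :
    Runs W D (.while e c) (e.cost + 1 + t₁ + t₂) s Q := by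
  intro s₀ h₀ w₀
  obtain ⟨s₁, e₁, v₁, k₁, m₁, q₁, p₁⟩ := e.exec_code 100 w₀ h₀ he le_rfl (D := D)
  have h' : s₁.Eqv s := Config.Eqv.trans ⟨fun r hr => k₁ r hr, m₁, q₁, p₁⟩ h₀
  have w₁ := e₁.wf w₀
  obtain ⟨s₂, u₂, e₂, hu₂, s₂', h₂', r₂⟩ := h s₁ h' w₁
  obtain ⟨s₃, u₃, e₃, hu₃, q⟩ := r₂ s₂ h₂' (e₂.wf w₁)
  cases e₃ with
  | seq f₁ f₂ =>
    exact ⟨s₃, _, .seq e₁ (.loop_true (by rwa [v₁]) (.seq e₂ f₁) f₂), by omega, q⟩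

/-- A loop with `n` iterations, each taking time at most `t`. -/
theorem while_count {e : Expr} (n : ℕ) (I : ℕ → Config → Prop) (h₀ : I 0 s)
    (h : ∀ i s, i < n → I i s → e.ok W s ∧ e.val s ≠ 0 ∧ Runs W D c t s (I (i + 1)))
    (hn : ∀ s, I n s → e.ok W s ∧ e.val s = 0) :
    Runs W D (.while e c) (n * (t + e.cost + 1) + (e.cost + 1)) s (I n) := by
  have key : ∀ k i s, i + k = n → I i s →
      Runs W D (.while e c) (k * (t + e.cost + 1) + (e.cost + 1)) s (I n) := by
    intro k
    induction k with
    | zero =>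
      rintro i s rfl hi
      exact (while_done (hn s hi).1 (hn s hi).2 hi).mono (by omega) fun _ h => h
    | succ k ih =>
      intro i s hik hi
      obtain ⟨h1, h2, h3⟩ := h i s (by omega) hi
      refine (while_step h1 h2 (h3.mono le_rfl fun s' hs' => ih (i + 1) s' (by omega) hs')).mono
        ?_ fun _ h => h
      rw [Nat.succ_mul]
      omega
  exact key n 0 s (by omega) h₀

end Runs

/-! ### Van Emde Boas trees: sets and their representation in memory -/

namespace VEB

/-- The elements of `A` that are neither least nor greatest. -/
def inner (A : Set ℕ) : Set ℕ := {x | x ∈ A ∧ (∃ y ∈ A, y < x) ∧ ∃ z ∈ A, x < z}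

/-- The quotients by `b` of the elements of `I`. -/
def heads (b : ℕ) (I : Set ℕ) : Set ℕ := {h | ∃ l < b, h * b + l ∈ I}

/-- The remainders modulo `b` of the elements of `I` with quotient `h`. -/
def tails (b h : ℕ) (I : Set ℕ) : Set ℕ := {l | l < b ∧ h * b + l ∈ I}

/-- The words `m` and `M` encode the least and the greatest element of `A`: they are one larger
than these elements, or zero if `A` is empty. -/
def Ends (A : Set ℕ) (m M : ℕ) : Prop :=
  (A = ∅ ∧ m = 0 ∧ M = 0) ∨ ∃ x y, IsLeast A x ∧ IsGreatest A y ∧ m = x + 1 ∧ M = y + 1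

/-- The size `2 ^ 2 ^ i` of the universe of a node of level `i`. -/
def U (i : ℕ) : ℕ := 2 ^ 2 ^ i

theorem U_succ (i : ℕ) : U (i + 1) = U i * U i := by
  rw [U, U, pow_succ, pow_mul, sq]

theorem two_le_U (i : ℕ) : 2 ≤ U i := by
  have : 2 ^ 1 ≤ 2 ^ 2 ^ i := Nat.pow_le_pow_right (by norm_num) Nat.one_le_two_pow
  simpa [U] using this

/-- The address of the cluster number `h` of a node at address `o`, where `b` is the size of the
universe of the cluster. The summary of the node has the address `o + 2`. -/
def child (o b h : ℕ) : ℕ := o + 2 + (h + 1) * b * b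

/-- The memory `v` holds a representation of the set `A` by a node of level `i` at address `o`.
The node stores the least and the greatest element of `A`; the other elements are distributed to
its clusters by their quotients, and the set of these quotients is held by the summary. A node of
level `0` has neither; the cell where its summary would start is zero. -/
def Rep : ℕ → ℕ → Set ℕ → (ℕ → ℕ) → Prop
  | 0, o, A, v => Ends A (v o) (v (o + 1)) ∧ v (o + 2) = 0
  | i + 1, o, A, v => Ends A (v o) (v (o + 1)) ∧ Rep i (o + 2) (heads (U i) (inner A)) v ∧
      ∀ h < U i, Rep i (child o (U i) h) (tails (U i) h (inner A)) v

/-- The summary and the clusters of a node at address `o` hold the set `I`. -/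
def RepIn (i o : ℕ) (I : Set ℕ) (v : ℕ → ℕ) : Prop :=
  Rep i (o + 2) (heads (U i) I) v ∧ ∀ h < U i, Rep i (child o (U i) h) (tails (U i) h I) v

theorem Rep.ends {i o : ℕ} {A : Set ℕ} {v : ℕ → ℕ} (h : Rep i o A v) :
    Ends A (v o) (v (o + 1)) := by
  cases i with
  | zero => exact h.1
  | succ i => exact h.1

theorem four_le_sq (i : ℕ) : 4 ≤ U i * U i := Nat.mul_le_mul (two_le_U i) (two_le_U i)

theorem child_lt {i o h : ℕ} (hh : h < U i) :
    child o (U i) h + U i * U i ≤ o + U (i + 1) * U (i + 1) := by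
  have h2 := two_le_U i
  have h4 := four_le_sq i
  rw [U_succ, child]
  generalize U i = b at *
  have h1 : (h + 1 + 1) * (b * b) ≤ (b + 1) * (b * b) := Nat.mul_le_mul_right _ (by omega)
  have h3 : (b + 2) * (b * b) ≤ (b * b) * (b * b) := Nat.mul_le_mul_right _ (by nlinarith)
  nlinarith

theorem summary_lt (i o : ℕ) : o + 2 + U i * U i ≤ o + U (i + 1) * U (i + 1) := by
  have h1 := child_lt (i := i) (o := o) (h := 0) (by have := two_le_U i; omega)
  rw [child] at h1
  omega

theorem le_child (o b h : ℕ) : o + 2 + b * b ≤ child o b h := by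
  rw [child]
  nlinarith [Nat.zero_le (h * (b * b))]

theorem child_disjoint (o b : ℕ) {h h' : ℕ} (hh : h < h') :
    child o b h + b * b ≤ child o b h' := by
  rw [child, child]
  have := Nat.mul_le_mul_right (b * b) (show h + 1 + 1 ≤ h' + 1 by omega)
  nlinarith

theorem Rep.congr {i o : ℕ} {A : Set ℕ} {v v' : ℕ → ℕ} (h : Rep i o A v)
    (hv : ∀ a, o ≤ a → a < o + U i * U i → v' a = v a) : Rep i o A v' := by
  induction i generalizing o A with
  | zero =>
    have := four_le_sq 0
    rw [Rep, hv o le_rfl (by omega), hv (o + 1) (by omega) (by omega),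
      hv (o + 2) (by omega) (by omega)]
    exact h
  | succ i ih =>
    have h4 := four_le_sq (i + 1)
    obtain ⟨h1, h2, h3⟩ := h
    refine ⟨?_, ih h2 fun a ha ha' => ?_, fun k hk => ih (h3 k hk) fun a ha ha' => ?_⟩
    · rwa [hv o le_rfl (by omega), hv (o + 1) (by omega) (by omega)]
    · have := summary_lt i o
      exact hv a (by omega) (by omega)
    · have := child_lt (o := o) hk
      have := le_child o (U i) k
      exact hv a (by omega) (by omega)

/-- Changing only the extreme elements of a set requires only changes of the first two cells. -/
theorem Rep.of_inner_eq {i o : ℕ} {A A' : Set ℕ} {v v' : ℕ → ℕ} (h : Rep i o A v)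
    (hA : inner A' = inner A) (hE : Ends A' (v' o) (v' (o + 1)))
    (hv : ∀ a, o + 2 ≤ a → v' a = v a) : Rep i o A' v' := by
  cases i with
  | zero => exact ⟨hE, (hv _ le_rfl).trans h.2⟩
  | succ i =>
    refine ⟨hE, ?_, fun k hk => ?_⟩
    · rw [hA]
      exact h.2.1.congr fun a ha _ => hv a ha
    · rw [hA]
      refine (h.2.2 k hk).congr fun a ha _ => hv a ?_
      have := le_child o (U i) k
      omega

theorem inner_empty : inner ∅ = ∅ := by simp [inner]

theorem inner_singleton (x : ℕ) : inner {x} = ∅ := by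
  ext a; simp [inner]; omega

theorem inner_pair (x y : ℕ) : inner {x, y} = ∅ := by
  ext a; simp [inner]; omega

theorem heads_empty (b : ℕ) : heads b ∅ = ∅ := by simp [heads]

theorem tails_empty (b h : ℕ) : tails b h ∅ = ∅ := by simp [tails]

theorem ends_empty : Ends ∅ 0 0 := Or.inl ⟨rfl, rfl, rfl⟩

theorem ends_singleton (x : ℕ) : Ends {x} (x + 1) (x + 1) :=
  Or.inr ⟨x, x, isLeast_singleton, isGreatest_singleton, rfl, rfl⟩

theorem rep_empty {i o : ℕ} {v : ℕ → ℕ} (hv : ∀ a, o ≤ a → v a = 0) : Rep i o ∅ v := by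
  induction i generalizing o with
  | zero =>
    rw [Rep, hv o le_rfl, hv (o + 1) (by omega)]
    exact ⟨ends_empty, hv _ (by omega)⟩
  | succ i ih =>
    refine ⟨?_, ?_, fun k hk => ?_⟩
    · rw [hv o le_rfl, hv (o + 1) (by omega)]
      exact ends_empty
    · rw [inner_empty, heads_empty]
      exact ih fun a ha => hv a (by omega)
    · rw [inner_empty, tails_empty]
      refine ih fun a ha => hv a ?_
      have := le_child o (U i) k
      omega

/-- Replacing the representation after a change in the cluster number `h` and possibly in the
summary. -/
theorem RepIn.update {i o h : ℕ} {I I' : Set ℕ} {v v' : ℕ → ℕ} (hI : RepIn i o I v)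
    (h₁ : Rep i (o + 2) (heads (U i) I') v')
    (h₂ : Rep i (child o (U i) h) (tails (U i) h I') v')
    (h₃ : ∀ k < U i, k ≠ h → tails (U i) k I' = tails (U i) k I)
    (h₄ : ∀ a, o + 2 + U i * U i ≤ a →
      a < child o (U i) h ∨ child o (U i) h + U i * U i ≤ a → v' a = v a) :
    RepIn i o I' v' := by
  refine ⟨h₁, fun k hk => ?_⟩
  by_cases hkh : k = h
  · exact hkh ▸ h₂
  · rw [h₃ k hk hkh]
    refine (hI.2 k hk).congr fun a ha ha' => h₄ a ?_ ?_
    · have := le_child o (U i) k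
      omega
    · rcases lt_or_gt_of_ne hkh with hlt | hlt
      · have := child_disjoint o (U i) hlt
        omega
      · have := child_disjoint o (U i) hlt
        omega

section sets
variable {b h l : ℕ} {I : Set ℕ}

theorem mul_add_inj {k l' : ℕ} (hl : l < b) (hl' : l' < b) (e : k * b + l' = h * b + l) :
    k = h ∧ l' = l := by
  have h1 : (k * b + l') / b = k := by
    rw [mul_comm, Nat.mul_add_div (by omega), Nat.div_eq_of_lt hl']; rfl
  have h2 : (h * b + l) / b = h := by
    rw [mul_comm, Nat.mul_add_div (by omega), Nat.div_eq_of_lt hl]; rfl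
  have : k = h := by rw [← h1, e, h2]
  subst this
  exact ⟨rfl, by omega⟩

theorem tails_insert (hl : l < b) : tails b h (insert (h * b + l) I) = insert l (tails b h I) := by
  ext a
  simp only [tails, Set.mem_ofPred_eq, Set.mem_insert_iff]
  constructor
  · rintro ⟨h1, h2 | h2⟩
    · exact Or.inl (mul_add_inj hl h1 h2).2
    · exact Or.inr ⟨h1, h2⟩
  · rintro (rfl | ⟨h1, h2⟩)
    · exact ⟨hl, Or.inl rfl⟩
    · exact ⟨h1, Or.inr h2⟩

theorem tails_insert_ne (hl : l < b) {k : ℕ} (hk : k ≠ h) :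
    tails b k (insert (h * b + l) I) = tails b k I := by
  ext a
  simp only [tails, Set.mem_ofPred_eq, Set.mem_insert_iff]
  refine and_congr_right fun ha => or_iff_right fun e => hk (mul_add_inj hl ha e).1

theorem heads_insert (hl : l < b) : heads b (insert (h * b + l) I) = insert h (heads b I) := by
  ext k
  simp only [heads, Set.mem_ofPred_eq, Set.mem_insert_iff]
  constructor
  · rintro ⟨l', h1, h2 | h2⟩
    · exact Or.inl (mul_add_inj hl h1 h2).1
    · exact Or.inr ⟨l', h1, h2⟩
  · rintro (rfl | ⟨l', h1, h2⟩)
    · exact ⟨l, hl, Or.inl rfl⟩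
    · exact ⟨l', h1, Or.inr h2⟩

theorem tails_diff (hl : l < b) : tails b h (I \ {h * b + l}) = tails b h I \ {l} := by
  ext a
  simp only [tails, Set.mem_ofPred_eq, Set.mem_sdiff, Set.mem_singleton_iff]
  constructor
  · rintro ⟨h1, h2, h3⟩
    exact ⟨⟨h1, h2⟩, fun e => h3 (by rw [e])⟩
  · rintro ⟨⟨h1, h2⟩, h3⟩
    exact ⟨h1, h2, fun e => h3 (mul_add_inj hl h1 e).2⟩

theorem tails_diff_ne (hl : l < b) {k : ℕ} (hk : k ≠ h) :
    tails b k (I \ {h * b + l}) = tails b k I := by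
  ext a
  simp only [tails, Set.mem_ofPred_eq, Set.mem_sdiff, Set.mem_singleton_iff]
  exact and_congr_right fun ha => and_iff_left fun e => hk (mul_add_inj hl ha e).1

theorem mem_heads_iff {k : ℕ} : k ∈ heads b I ↔ (tails b k I).Nonempty := Iff.rfl

theorem heads_diff (hl : l < b) (ht : tails b h I = {l}) :
    heads b (I \ {h * b + l}) = heads b I \ {h} := by
  ext k
  rw [Set.mem_sdiff, mem_heads_iff, mem_heads_iff]
  by_cases hk : k = h
  · subst hk
    simp [tails_diff hl, ht]
  · simp [tails_diff_ne hl hk, hk]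

theorem heads_diff_of_ne (hl : l < b) {l' : ℕ} (ht : l' ∈ tails b h I) (hne : l' ≠ l) :
    heads b (I \ {h * b + l}) = heads b I := by
  ext k
  rw [mem_heads_iff, mem_heads_iff]
  by_cases hk : k = h
  · subst hk
    exact iff_of_true ⟨l', by rw [tails_diff hl]; exact ⟨ht, hne⟩⟩ ⟨l', ht⟩
  · rw [tails_diff_ne hl hk]

/-- The least element of a set is found in the cluster of least quotient. -/
theorem isLeast_of_heads {f : ℕ} (hf : IsLeast (heads b I) f) (hl : IsLeast (tails b f I) l) :
    IsLeast I (f * b + l) := by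
  refine ⟨hl.1.2, fun x hx => ?_⟩
  have hb : 0 < b := by have := hl.1.1; omega
  have hx' : x / b * b + x % b = x := Nat.div_add_mod' x b
  have h1 : x / b ∈ heads b I := ⟨x % b, Nat.mod_lt _ hb, hx'.symm ▸ hx⟩
  rcases (hf.2 h1).eq_or_lt with e | e
  · have := hl.2 (show x % b ∈ tails b f I from ⟨Nat.mod_lt _ hb, by rw [e, hx']; exact hx⟩)
    rw [← hx', ← e]; omega
  · have := Nat.mul_le_mul_right b (show f + 1 ≤ x / b from e)
    have := hl.1.1
    rw [Nat.succ_mul] at *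
    omega

/-- The greatest element of a set is found in the cluster of greatest quotient. -/
theorem isGreatest_of_heads {f : ℕ} (hf : IsGreatest (heads b I) f)
    (hl : IsGreatest (tails b f I) l) : IsGreatest I (f * b + l) := by
  refine ⟨hl.1.2, fun x hx => ?_⟩
  have hb : 0 < b := by have := hl.1.1; omega
  have hx' : x / b * b + x % b = x := Nat.div_add_mod' x b
  have h1 : x / b ∈ heads b I := ⟨x % b, Nat.mod_lt _ hb, hx'.symm ▸ hx⟩
  have h2 := Nat.mod_lt x hb
  rcases (hf.2 h1).eq_or_lt with e | e
  · have := hl.2 (show x % b ∈ tails b f I from ⟨Nat.mod_lt _ hb, by rw [← e, hx']; exact hx⟩)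
    rw [← hx', ← e]; omega
  · have := Nat.mul_le_mul_right b (show x / b + 1 ≤ f from e)
    rw [Nat.succ_mul] at *
    omega

end sets

section ends
variable {A : Set ℕ} {m M x : ℕ}

theorem inner_insert_lt (hm : IsLeast A m) (hM : IsGreatest A M) (hmM : m < M) (hx : x < m) :
    inner (insert x A) = insert m (inner A) ∧ m ∉ inner A ∧ IsLeast (insert x A) x ∧
      IsGreatest (insert x A) M := by
  obtain ⟨hm, hm'⟩ := hm
  obtain ⟨hM, hM'⟩ := hM
  simp only [mem_lowerBounds, mem_upperBounds] at hm' hM'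
  refine ⟨?_, fun h => ?_, ⟨by simp, ?_⟩, by simp [hM], ?_⟩
  · ext a
    simp only [inner, Set.mem_insert_iff, Set.mem_ofPred_eq]
    constructor
    · grind
    · rintro (rfl | ⟨ha, ⟨y, hy, hy'⟩, z, hz, hz'⟩)
      · exact ⟨Or.inr hm, ⟨x, Or.inl rfl, hx⟩, M, Or.inr hM, hmM⟩
      · exact ⟨Or.inr ha, ⟨y, Or.inr hy, hy'⟩, z, Or.inr hz, hz'⟩
  · obtain ⟨_, ⟨y, hy, hy'⟩, _⟩ := h
    exact absurd (hm' y hy) (by omega)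
  · simp only [mem_lowerBounds, Set.mem_insert_iff]; grind
  · simp only [mem_upperBounds, Set.mem_insert_iff]; grind

theorem inner_insert_gt (hm : IsLeast A m) (hM : IsGreatest A M) (hmM : m < M) (hx : M < x) :
    inner (insert x A) = insert M (inner A) ∧ M ∉ inner A ∧ IsLeast (insert x A) m ∧
      IsGreatest (insert x A) x := by
  obtain ⟨hm, hm'⟩ := hm
  obtain ⟨hM, hM'⟩ := hM
  simp only [mem_lowerBounds, mem_upperBounds] at hm' hM'
  refine ⟨?_, fun h => ?_, ⟨by simp [hm], ?_⟩, by simp, ?_⟩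
  · ext a
    simp only [inner, Set.mem_insert_iff, Set.mem_ofPred_eq]
    constructor
    · grind
    · rintro (rfl | ⟨ha, ⟨y, hy, hy'⟩, z, hz, hz'⟩)
      · exact ⟨Or.inr hM, ⟨m, Or.inr hm, hmM⟩, x, Or.inl rfl, hx⟩
      · exact ⟨Or.inr ha, ⟨y, Or.inr hy, hy'⟩, z, Or.inr hz, hz'⟩
  · obtain ⟨_, _, y, hy, hy'⟩ := h
    exact absurd (hM' y hy) (by omega)
  · simp only [mem_lowerBounds, Set.mem_insert_iff]; grind
  · simp only [mem_upperBounds, Set.mem_insert_iff]; grind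

theorem inner_insert_mid (hm : IsLeast A m) (hM : IsGreatest A M) (hx : m < x) (hx' : x < M) :
    inner (insert x A) = insert x (inner A) ∧ IsLeast (insert x A) m ∧
      IsGreatest (insert x A) M := by
  obtain ⟨hm, hm'⟩ := hm
  obtain ⟨hM, hM'⟩ := hM
  simp only [mem_lowerBounds, mem_upperBounds] at hm' hM'
  refine ⟨?_, ⟨by simp [hm], ?_⟩, by simp [hM], ?_⟩
  · ext a
    simp only [inner, Set.mem_insert_iff, Set.mem_ofPred_eq]
    grind
  · simp only [mem_lowerBounds, Set.mem_insert_iff]; grind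
  · simp only [mem_upperBounds, Set.mem_insert_iff]; grind

theorem inner_diff_least {y : ℕ} (hm : IsLeast A m) (hM : IsGreatest A M)
    (hy : IsLeast (inner A) y) :
    inner (A \ {m}) = inner A \ {y} ∧ IsLeast (A \ {m}) y ∧ IsGreatest (A \ {m}) M := by
  obtain ⟨hm, hm'⟩ := hm
  obtain ⟨hM, hM'⟩ := hM
  obtain ⟨⟨hy, ⟨y₁, hy₁, hy₁'⟩, y₂, hy₂, hy₂'⟩, hy'⟩ := hy
  simp only [mem_lowerBounds, mem_upperBounds, inner, Set.mem_ofPred_eq] at hm' hM' hy'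
  have e1 := hm' y₁ hy₁
  have e2 := hM' y₂ hy₂
  have key : ∀ a ∈ A, a ≠ m → y ≤ a := fun a ha ham => by
    by_cases haM : a < M
    · exact hy' a ⟨ha, ⟨m, hm, lt_of_le_of_ne (hm' a ha) (Ne.symm ham)⟩, M, hM, haM⟩
    · omega
  refine ⟨?_, ⟨⟨hy, by simp; omega⟩, ?_⟩, ⟨hM, by simp; omega⟩, ?_⟩
  · ext a
    simp only [inner, Set.mem_ofPred_eq, Set.mem_sdiff, Set.mem_singleton_iff]
    grind
  · rintro a ⟨h1, h2⟩
    exact key a h1 h2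
  · rintro a ⟨h1, h2⟩
    exact hM' a h1

theorem inner_diff_greatest {y : ℕ} (hm : IsLeast A m) (hM : IsGreatest A M)
    (hy : IsGreatest (inner A) y) :
    inner (A \ {M}) = inner A \ {y} ∧ IsLeast (A \ {M}) m ∧ IsGreatest (A \ {M}) y := by
  obtain ⟨hm, hm'⟩ := hm
  obtain ⟨hM, hM'⟩ := hM
  obtain ⟨⟨hy, ⟨y₁, hy₁, hy₁'⟩, y₂, hy₂, hy₂'⟩, hy'⟩ := hy
  simp only [mem_lowerBounds, mem_upperBounds, inner, Set.mem_ofPred_eq] at hm' hM' hy'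
  have e1 := hm' y₁ hy₁
  have e2 := hM' y₂ hy₂
  have key : ∀ a ∈ A, a ≠ M → a ≤ y := fun a ha haM => by
    by_cases ham : m < a
    · exact hy' a ⟨ha, ⟨m, hm, ham⟩, M, hM, lt_of_le_of_ne (hM' a ha) haM⟩
    · omega
  refine ⟨?_, ⟨⟨hm, by simp; omega⟩, ?_⟩, ⟨hy, by simp; omega⟩, ?_⟩
  · ext a
    simp only [inner, Set.mem_ofPred_eq, Set.mem_sdiff, Set.mem_singleton_iff]
    grind
  · rintro a ⟨h1, h2⟩
    exact hm' a h1
  · rintro a ⟨h1, h2⟩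
    exact key a h1 h2

theorem inner_diff_mid (hm : IsLeast A m) (hM : IsGreatest A M) (hx : x ∈ A) (hxm : x ≠ m)
    (hxM : x ≠ M) :
    x ∈ inner A ∧ inner (A \ {x}) = inner A \ {x} ∧ IsLeast (A \ {x}) m ∧
      IsGreatest (A \ {x}) M := by
  obtain ⟨hm, hm'⟩ := hm
  obtain ⟨hM, hM'⟩ := hM
  simp only [mem_lowerBounds, mem_upperBounds] at hm' hM'
  have e1 := hm' x hx
  have e2 := hM' x hx
  refine ⟨⟨hx, ⟨m, hm, by omega⟩, M, hM, by omega⟩, ?_, ⟨⟨hm, by simp; omega⟩, ?_⟩,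
    ⟨hM, by simp; omega⟩, ?_⟩
  · ext a
    simp only [inner, Set.mem_ofPred_eq, Set.mem_sdiff, Set.mem_singleton_iff]
    grind
  · rintro a ⟨h1, h2⟩
    exact hm' a h1
  · rintro a ⟨h1, h2⟩
    exact hM' a h1

/-- A set without inner elements consists of its extreme elements. -/
theorem eq_pair_of_inner (hm : IsLeast A m) (hM : IsGreatest A M) (hI : inner A = ∅) :
    A = {m, M} := by
  ext a
  constructor
  · intro ha
    by_contra hne
    simp only [Set.mem_insert_iff, Set.mem_singleton_iff, not_or] at hne
    have : a ∈ inner A := ⟨ha, ⟨m, hm.1, lt_of_le_of_ne (hm.2 ha) (Ne.symm hne.1)⟩, M, hM.1,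
      lt_of_le_of_ne (hM.2 ha) hne.2⟩
    rw [hI] at this
    exact this
  · rintro (rfl | rfl)
    · exact hm.1
    · exact hM.1

theorem eq_singleton_of_ends (hm : IsLeast A m) (hM : IsGreatest A m) : A = {m} := by
  ext a
  exact ⟨fun ha => le_antisymm (hM.2 ha) (hm.2 ha), fun ha => ha ▸ hm.1⟩

end ends

end VEB

/-! ### Arrays in memory -/

infixr:65 " ;; " => Blk.seq

/-- The memory from the address in register `20` on is divided into eight interleaved arrays;
this is the address of entry `e` of array `i`. -/
def cell (i : ℕ) (e : Expr) : Expr := .var 20 + 8 * e + .lit i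

/-- The entry `e` of array `i`. -/
def ld (i : ℕ) (e : Expr) : Expr := .get (cell i e)

/-- Entry `a` of array `i` receives the value of `e`. -/
def st (i : ℕ) (a e : Expr) : Blk := .put (cell i a) e

/-- The array `i` of a configuration. -/
def Config.arr (s : Config) (i : ℕ) : ℕ → ℕ := fun a => s.mem (s.reg 20 + 8 * a + i)

/-- The configuration with entry `a` of array `i` set to `v`. -/
def Config.setArr (s : Config) (i a v : ℕ) : Config := s.setMem (s.reg 20 + 8 * a + i) v

section arrays
variable (W : ℕ) (s : Config) (i a v : ℕ) (e e' : Expr)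

@[simp] theorem val_ld : (ld i e).val s = s.arr i (e.val s) := rfl

@[simp] theorem ok_ld : (ld i e).ok W s ↔
    e.ok W s ∧ 8 < 2 ^ W ∧ s.reg 20 + 8 * e.val s + i < 2 ^ W := by
  change ((_ ∧ (8 < 2 ^ W ∧ _ ∧ 8 * e.val s < 2 ^ W) ∧ s.reg 20 + 8 * e.val s < 2 ^ W) ∧
    i < 2 ^ W ∧ s.reg 20 + 8 * e.val s + i < 2 ^ W) ↔ _
  constructor
  · rintro ⟨⟨_, ⟨h1, h2, _⟩, _⟩, _, h3⟩
    exact ⟨h2, h1, h3⟩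
  · rintro ⟨h1, h2, h3⟩
    exact ⟨⟨show (20 : ℕ) < 100 by norm_num, ⟨h2, h1, by omega⟩, by omega⟩, by omega, h3⟩

@[simp] theorem wp_st (Q : Config → Prop) : (st i e e').wp W s Q ↔
    (e.ok W s ∧ 8 < 2 ^ W ∧ s.reg 20 + 8 * e.val s + i < 2 ^ W) ∧ e'.ok W s ∧
      Q (s.setArr i (e.val s) (e'.val s)) := by
  rw [← ok_ld]
  exact Iff.rfl

@[simp] theorem setArr_reg : (s.setArr i a v).reg = s.reg := rfl

@[simp] theorem setReg_arr {d : ℕ} (hd : d ≠ 20) : (s.setReg d v).arr i = s.arr i := by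
  funext b
  simp [Config.arr, hd.symm]

@[simp] theorem setArr_arr {i : ℕ} (hi : i < 8) {j : ℕ} (hj : j < 8) :
    (s.setArr i a v).arr j = if j = i then Function.update (s.arr i) a v else s.arr j := by
  funext b
  simp only [Config.arr, Config.setArr, Config.setMem_mem, Config.setMem_reg]
  by_cases hij : j = i
  · subst hij
    simp only [if_true, Function.update_apply]
    congr 1
    simp
  · rw [if_neg (by omega), if_neg hij]
    rfl

@[simp] theorem setArr_mem {b : ℕ} (hb : b < s.reg 20) : (s.setArr i a v).mem b = s.mem b := by
  rw [Config.setArr, Config.setMem_mem, if_neg (by omega)]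

end arrays

/-- Registers below `30`, the arrays other than `j` and the memory below the arrays agree. -/
def Keeps (j : ℕ) (s s' : Config) : Prop :=
  (∀ r < 30, s'.reg r = s.reg r) ∧ (∀ i < 8, i ≠ j → s'.arr i = s.arr i) ∧
    ∀ a < s.reg 20, s'.mem a = s.mem a

namespace Keeps

theorem refl (j : ℕ) (s : Config) : Keeps j s s :=
  ⟨fun _ _ => rfl, fun _ _ _ => rfl, fun _ _ => rfl⟩

theorem trans {j : ℕ} {s₁ s₂ s₃ : Config} (h : Keeps j s₁ s₂) (h' : Keeps j s₂ s₃) :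
    Keeps j s₁ s₃ :=
  ⟨fun r hr => (h'.1 r hr).trans (h.1 r hr),
    fun i hi hij => (h'.2.1 i hi hij).trans (h.2.1 i hi hij),
    fun a ha => (h'.2.2 a (by rw [h.1 20 (by norm_num)]; exact ha)).trans (h.2.2 a ha)⟩

theorem setReg {j : ℕ} {s s' : Config} (h : Keeps j s s') {d : ℕ} (hd : 30 ≤ d) (v : ℕ) :
    Keeps j s (s'.setReg d v) := by
  refine h.trans ⟨fun r hr => ?_, fun i _ _ => ?_, fun _ _ => rfl⟩
  · simp [show r ≠ d by omega]
  · rw [setReg_arr _ _ _ (by omega)]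

theorem setArr {j : ℕ} (hj : j < 8) {s s' : Config} (h : Keeps j s s') (a v : ℕ) :
    Keeps j s (s'.setArr j a v) := by
  refine h.trans ⟨fun r hr => rfl, fun i hi hij => ?_, fun a ha => ?_⟩
  · rw [setArr_arr _ _ _ hj hi, if_neg hij]
  · rw [setArr_mem _ _ _ _ ha]

end Keeps

/-! ### Van Emde Boas trees: insertion -/

namespace VEB

/-- The arrays fit into the address space as far as entry `Z`, and array `6` is the table of the
sizes of the universes of levels up to `K`. -/
structure Env (W Z K : ℕ) (s : Config) : Prop where
  fits : s.reg 20 + 8 * Z + 100 ≤ 2 ^ W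
  table : ∀ i ≤ K, s.arr 6 i = U i
  level : K ≤ Z

theorem Env.ne_zero {W Z K : ℕ} {s : Config} (h : Env W Z K s) : W ≠ 0 := by
  rintro rfl
  have := h.fits
  omega

theorem Env.keeps {W Z K j : ℕ} {s s' : Config} (h : Env W Z K s) (hs : Keeps j s s')
    (hj : j ≠ 6) : Env W Z K s' := by
  refine ⟨?_, ?_, h.level⟩
  · rw [hs.1 20 (by norm_num)]
    exact h.fits
  · rw [hs.2.1 6 (by norm_num) hj.symm]
    exact h.table

/-- Passing from a node to a cluster. Registers: `30` level, `31` address of the node, `32` the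
element; on return `36` holds the size of the universe of the cluster, `37` and `32` the quotient
and the remainder of the element, `38` the address of the cluster. -/
def descend : Blk :=
  .set 30 (.var 30 - 1) ;; .set 36 (ld 6 (.var 30)) ;; .set 37 (.var 32 / .var 36) ;;
  .set 32 (.var 32 % .var 36) ;;
  .set 38 (.var 31 + 2 + (.var 37 + 1) * .var 36 * .var 36)

/-- The configuration reached by `descend`. -/
def descended (s : Config) (i : ℕ) : Config :=
  ((((s.setReg 30 i).setReg 36 (U i)).setReg 37 (s.reg 32 / U i)).setReg 32
    (s.reg 32 % U i)).setReg 38 (child (s.reg 31) (U i) (s.reg 32 / U i))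

theorem descend_wp {W Z K i : ℕ} {s : Config} {Q : Config → Prop} (hE : Env W Z K s)
    (hi : i + 1 ≤ K) (h30 : s.reg 30 = i + 1) (h31 : s.reg 31 + U (i + 1) * U (i + 1) ≤ Z)
    (h32 : s.reg 32 < U (i + 1)) (hQ : Q (descended s i)) : descend.wp W s Q := by
  have h1 := hE.fits
  have h2 := hE.table i (by omega)
  have h3 := hE.level
  have h4 := two_le_U i
  have h5 : s.reg 32 / U i < U i := Nat.div_lt_of_lt_mul (U_succ i ▸ h32)
  have h6 := child_lt (o := s.reg 31) h5
  have h7 : (s.reg 32 / U i + 1) * U i ≤ (s.reg 32 / U i + 1) * U i * U i :=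
    Nat.le_mul_of_pos_right _ (by omega)
  have h8 : s.reg 32 / U i + 1 ≤ (s.reg 32 / U i + 1) * U i :=
    Nat.le_mul_of_pos_right _ (by omega)
  have hW := hE.ne_zero
  rw [descended] at hQ
  rw [child] at *
  simp only [descend, Blk.wp, Expr.ok_sub, Expr.ok_var, Expr.val_sub, Expr.val_var, h30]
  simp [h2]
  refine ⟨hW, ?_, ?_, hQ⟩ <;> omega

/-- `s'` arises from `s` by replacing the content of the node of level `i` at address `o` by `A`. -/
def Upd (i o : ℕ) (A : Set ℕ) (s s' : Config) : Prop :=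
  Keeps 0 s s' ∧ Rep i o A (s'.arr 0) ∧
    ∀ a, a < o ∨ o + U i * U i ≤ a → s'.arr 0 a = s.arr 0 a

/-- `s'` arises from `s` by replacing the content of the summary and the clusters of the node of
level `i + 1` at address `o` by `I`. -/
def UpdIn (i o : ℕ) (I : Set ℕ) (s s' : Config) : Prop :=
  Keeps 0 s s' ∧ RepIn i o I (s'.arr 0) ∧
    ∀ a, a < o + 2 ∨ o + U (i + 1) * U (i + 1) ≤ a → s'.arr 0 a = s.arr 0 a

theorem keeps_descended (s : Config) (i : ℕ) : Keeps 0 s (descended s i) :=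
  ((((((Keeps.refl 0 s).setReg (by norm_num) _).setReg (by norm_num) _).setReg (by norm_num)
    _).setReg (by norm_num) _).setReg (by norm_num) _)

@[simp] theorem descended_arr (s : Config) (i j : ℕ) : (descended s i).arr j = s.arr j := by
  simp [VEB.descended]

/-- The second half of an insertion into a node with at least two elements: pass to the cluster,
or, if this is empty, store the remainder there and pass to the summary. -/
def insTail : Blk :=
  descend ;; .ite (ld 0 (.var 38)) (.set 31 (.var 38))
    (st 0 (.var 38) (.var 32 + 1) ;; st 0 (.var 38 + 1) (.var 32 + 1) ;;
      .set 31 (.var 31 + 2) ;; .set 32 (.var 37))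

/-- One level of an insertion. Registers: `30` level, `31` address of the node, `32` the element,
`33` is nonzero as long as work remains, `34` and `35` the words that encode the extreme elements
of the node. A new extreme element takes the place of the old one, which moves down. -/
def insBody : Blk :=
  .set 34 (ld 0 (.var 31)) ;; .set 35 (ld 0 (.var 31 + 1)) ;;
  .ite (.eq (.var 34) 0)
    (st 0 (.var 31) (.var 32 + 1) ;; st 0 (.var 31 + 1) (.var 32 + 1) ;; .set 33 0)
    (.ite (.eq (.var 34) (.var 35))
      (.ite (.lt (.var 32 + 1) (.var 34)) (st 0 (.var 31) (.var 32 + 1))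
          (st 0 (.var 31 + 1) (.var 32 + 1)) ;;
        .set 33 0)
      (.ite (.lt (.var 32 + 1) (.var 34))
          (st 0 (.var 31) (.var 32 + 1) ;; .set 32 (.var 34 - 1))
          (.ite (.lt (.var 35) (.var 32 + 1))
            (st 0 (.var 31 + 1) (.var 32 + 1) ;; .set 32 (.var 35 - 1)) .skip) ;;
        insTail))

/-- Insertion of an element. -/
def insLoop : Cmd := .while (.var 33) insBody.cmd

/-- The specification of a program that replaces the content `A` of a node of level `i` by
`F A x`, for sets and elements with `P A x`. -/
def Spec (W : ℕ) (D : Oracle) (Z K i : ℕ) (c : Cmd) (t : ℕ) (P : Set ℕ → ℕ → Prop)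
    (F : Set ℕ → ℕ → Set ℕ) : Prop :=
  ∀ (s : Config) (A : Set ℕ), Env W Z K s → i ≤ K → s.reg 30 = i → s.reg 33 = 1 →
    s.reg 31 + U i * U i ≤ Z → (∀ a ∈ A, a < U i) → s.reg 32 < U i → P A (s.reg 32) →
    Rep i (s.reg 31) A (s.arr 0) →
    Runs W D c t s (Upd i (s.reg 31) (F A (s.reg 32)) s)

theorem mem_of_div_mod {b x : ℕ} {I : Set ℕ} (hb : 0 < b) :
    x % b ∈ tails b (x / b) I ↔ x ∈ I := by
  rw [tails, Set.mem_ofPred_eq, Nat.div_add_mod']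
  exact and_iff_right (Nat.mod_lt _ hb)

theorem lt_of_mem_heads {i : ℕ} {I : Set ℕ} (hI : ∀ a ∈ I, a < U (i + 1)) :
    ∀ a ∈ heads (U i) I, a < U i := by
  rintro a ⟨l, hl, ha⟩
  have := hI _ ha
  rw [U_succ] at this
  exact lt_of_mul_lt_mul_right (by omega) (Nat.zero_le (U i))

/-- A change of the cluster number `h` that leaves it nonempty. -/
theorem UpdIn.of_cluster {i o h : ℕ} {I I' : Set ℕ} {s s' : Config} (hh : h < U i)
    (hR : RepIn i o I (s.arr 0)) (hK : Keeps 0 s s')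
    (h₁ : Rep i (child o (U i) h) (tails (U i) h I') (s'.arr 0))
    (h₂ : ∀ a, a < child o (U i) h ∨ child o (U i) h + U i * U i ≤ a →
      s'.arr 0 a = s.arr 0 a)
    (h₃ : heads (U i) I' = heads (U i) I)
    (h₄ : ∀ k, k ≠ h → tails (U i) k I' = tails (U i) k I) : UpdIn i o I' s s' := by
  have h5 := child_lt (o := o) hh
  have h6 := le_child o (U i) h
  refine ⟨hK, hR.update ?_ h₁ (fun k _ hk => h₄ k hk) fun a _ ha => h₂ a ha, fun a ha => ?_⟩
  · rw [h₃]
    exact hR.1.congr fun a _ ha => h₂ a (by omega)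
  · exact h₂ a (by omega)

/-- A change of the summary, and of the extreme elements of the cluster number `h`. -/
theorem UpdIn.of_summary {i o h : ℕ} {I I' : Set ℕ} {s s₁ s' : Config} (hh : h < U i)
    (hR : RepIn i o I (s.arr 0)) (hK : Keeps 0 s s')
    (h₁ : Rep i (o + 2) (heads (U i) I') (s'.arr 0))
    (h₂ : ∀ a, a < o + 2 ∨ o + 2 + U i * U i ≤ a → s'.arr 0 a = s₁.arr 0 a)
    (h₃ : ∀ a, a ≠ child o (U i) h → a ≠ child o (U i) h + 1 → s₁.arr 0 a = s.arr 0 a)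
    (h₄ : ∀ k, k ≠ h → tails (U i) k I' = tails (U i) k I)
    (h₅ : inner (tails (U i) h I') = inner (tails (U i) h I))
    (h₆ : Ends (tails (U i) h I') (s₁.arr 0 (child o (U i) h))
      (s₁.arr 0 (child o (U i) h + 1))) : UpdIn i o I' s s' := by
  have h7 := child_lt (o := o) hh
  have h8 := le_child o (U i) h
  have h9 := four_le_sq i
  refine ⟨hK, hR.update h₁ ?_ (fun k _ hk => h₄ k hk) fun a ha ha' => ?_, fun a ha => ?_⟩
  · refine Rep.congr ((hR.2 h hh).of_inner_eq h₅ h₆ fun a ha => h₃ a ?_ ?_) fun a ha ha' =>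
      h₂ a ?_ <;> omega
  · rw [h₂ a (by omega), h₃ a (by omega) (by omega)]
  · rw [h₂ a (by omega), h₃ a (by omega) (by omega)]

/-- What is known after the passage from a node to its cluster number `h`. -/
structure Descended (W Z K i h l : ℕ) (s s₂ : Config) : Prop where
  env : Env W Z K s₂
  keeps : Keeps 0 s s₂
  r30 : s₂.reg 30 = i
  r31 : s₂.reg 31 = s.reg 31
  r32 : s₂.reg 32 = l
  r33 : s₂.reg 33 = s.reg 33
  r37 : s₂.reg 37 = h
  r38 : s₂.reg 38 = child (s.reg 31) (U i) h
  arr : s₂.arr 0 = s.arr 0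

theorem Env.descended {W Z K : ℕ} {s : Config} (hE : Env W Z K s) (i : ℕ) :
    Descended W Z K i (s.reg 32 / U i) (s.reg 32 % U i) s (descended s i) := by
  have hK := keeps_descended s i
  constructor <;> first | exact hE.keeps hK (by norm_num) | exact hK | simp [VEB.descended]

theorem insTail_wp {W Z K i t : ℕ} {D : Oracle}
    (ih : Spec W D Z K i insLoop t (fun A x => x ∉ A) fun A x => insert x A)
    {s : Config} {I : Set ℕ} (hE : Env W Z K s)
    (hi : i + 1 ≤ K) (h30 : s.reg 30 = i + 1) (h33 : s.reg 33 = 1)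
    (h31 : s.reg 31 + U (i + 1) * U (i + 1) ≤ Z) (hI : ∀ a ∈ I, a < U (i + 1))
    (h32 : s.reg 32 < U (i + 1)) (hx : s.reg 32 ∉ I) (hR : RepIn i (s.reg 31) I (s.arr 0)) :
    insTail.wp W s fun s₁ =>
      Runs W D insLoop t s₁ (UpdIn i (s.reg 31) (insert (s.reg 32) I) s) := by
  rw [insTail, Blk.wp]
  refine descend_wp hE hi h30 h31 h32 ?_
  have hd := hE.descended i
  have hb := two_le_U i
  have hh : s.reg 32 / U i < U i := Nat.div_lt_of_lt_mul (U_succ i ▸ h32)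
  have h6 := child_lt (o := s.reg 31) hh
  have h7 := le_child (s.reg 31) (U i) (s.reg 32 / U i)
  have h8 := hd.env.fits
  have h9 := four_le_sq i
  have h10 := Nat.le_mul_self (U i)
  have hl : s.reg 32 % U i < U i := Nat.mod_lt _ (by omega)
  have hxe := Nat.div_add_mod' (s.reg 32) (U i)
  have hW := hE.ne_zero
  have hHI := lt_of_mem_heads hI
  have hlt : s.reg 32 % U i ∉ tails (U i) (s.reg 32 / U i) I := by
    rwa [mem_of_div_mod (by omega)]
  generalize descended s i = s₂ at *
  generalize s.reg 32 / U i = h at *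
  generalize s.reg 32 % U i = l at *
  rw [← hxe]
  have hc := hR.2 h hh
  have hR1 := hR.1
  rw [← hd.arr] at hc hR1
  simp only [Blk.wp, ok_ld, val_ld, Expr.ok_var, Expr.val_var, hd.r38]
  refine ⟨⟨by norm_num, by omega, by omega⟩, fun h0 => ⟨by norm_num, ?_⟩, fun h0 => ?_⟩
  · -- the cluster is nonempty
    have hne : (tails (U i) h I).Nonempty := by
      rcases hc.ends with ⟨_, h1, _⟩ | ⟨x, _, hx, _⟩
      · exact absurd h1 h0
      · exact ⟨x, hx.1⟩
    have hK : Keeps 0 s (s₂.setReg 31 (child (s.reg 31) (U i) h)) :=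
      hd.keeps.setReg (by norm_num) _
    have := ih (s₂.setReg 31 (child (s.reg 31) (U i) h)) (tails (U i) h I)
      (hE.keeps hK (by norm_num)) (by omega) (by simp [hd.r30]) (by simp [hd.r33, h33])
      (by simp; omega) (fun a ha => ha.1) (by simp [hd.r32, hl]) (by simp [hd.r32, hlt])
      (by simpa using hc)
    simp only [Config.setReg_reg, hd.r32] at this
    refine this.mono le_rfl ?_
    rintro s' ⟨k, r, u⟩
    refine UpdIn.of_cluster hh hR (hK.trans k) ?_ (fun a ha => (u a ha).trans ?_) ?_ ?_
    · rw [tails_insert hl]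
      simpa using r
    · simp [hd.arr]
    · rw [heads_insert hl, Set.insert_eq_of_mem (mem_heads_iff.2 hne)]
    · exact fun k hk => tails_insert_ne hl hk
  · -- the cluster is empty
    have hemp : tails (U i) h I = ∅ := by
      rcases hc.ends with ⟨h1, _, _⟩ | ⟨x, _, _, _, h1, _⟩
      · exact h1
      · omega
    simp [hd.r38, hd.r31, hd.r32, hd.r37]
    refine ⟨⟨by omega, by omega⟩, ⟨hW, by omega⟩, ⟨⟨hW, by omega⟩, by omega, by omega⟩,
      ⟨hW, by omega⟩, ⟨by omega, by omega⟩, ?_⟩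
    have hK : Keeps 0 s ((((s₂.setArr 0 (child (s.reg 31) (U i) h) (l + 1)).setArr 0
        (child (s.reg 31) (U i) h + 1) (l + 1)).setReg 31 (s.reg 31 + 2)).setReg 32 h) :=
      (((hd.keeps.setArr (by norm_num) _ _).setArr (by norm_num) _ _).setReg (by norm_num)
        _).setReg (by norm_num) _
    have := ih _ (heads (U i) I)
      (hE.keeps hK (by norm_num)) (by omega) (by simp [hd.r30]) (by simp [hd.r33, h33])
      (by simp; omega) hHI (by simp [hh])
      (by simp [mem_heads_iff, hemp])
      (by
        simp
        refine hR1.congr fun a _ ha => ?_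
        rw [Function.update_of_ne (by omega), Function.update_of_ne (by omega)])
    refine this.mono le_rfl ?_
    rintro s' ⟨k, r, u⟩
    simp only [Config.setReg_reg] at r u
    refine UpdIn.of_summary hh hR (hK.trans k) ?_ u (fun a ha ha' => ?_)
      (fun k hk => tails_insert_ne hl hk) ?_ ?_
    · rw [heads_insert hl]
      simpa using r
    · simp [ha, ha', hd.arr]
    · rw [tails_insert hl, hemp, inner_empty, insert_empty_eq, inner_singleton]
    · rw [tails_insert hl, hemp, insert_empty_eq]
      simpa using ends_singleton l

theorem UpdIn.upd {i o : ℕ} {A I : Set ℕ} {s s₁ s' : Config} (h : UpdIn i o I s₁ s')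
    (hI : I = inner A) (hA : Ends A (s₁.arr 0 o) (s₁.arr 0 (o + 1))) (hK : Keeps 0 s s₁)
    (hs : ∀ a, a < o ∨ o + 2 ≤ a → s₁.arr 0 a = s.arr 0 a) : Upd (i + 1) o A s s' := by
  have h4 := four_le_sq (i + 1)
  obtain ⟨k, r, u⟩ := h
  refine ⟨hK.trans k, ⟨?_, ?_⟩, fun a ha => ?_⟩
  · rwa [u o (by omega), u (o + 1) (by omega)]
  · rw [← hI]
    exact r
  · rw [u a (by omega), hs a (by omega)]

theorem RepIn.congr {i o : ℕ} {I : Set ℕ} {v v' : ℕ → ℕ} (h : RepIn i o I v)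
    (hv : ∀ a, o + 2 ≤ a → v' a = v a) : RepIn i o I v' :=
  ⟨Rep.congr h.1 fun a ha _ => hv a ha, fun k hk => Rep.congr (h.2 k hk) fun a ha _ => hv a (by
    have := le_child o (U i) k
    omega)⟩

theorem upd_of_inner {i o : ℕ} {A A' : Set ℕ} {s s' : Config} (hR : Rep i o A (s.arr 0))
    (hA : inner A' = inner A) (hE : Ends A' (s'.arr 0 o) (s'.arr 0 (o + 1)))
    (hK : Keeps 0 s s') (hs : ∀ a, a < o ∨ o + 2 ≤ a → s'.arr 0 a = s.arr 0 a) :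
    Upd i o A' s s' := by
  have h4 := four_le_sq i
  exact ⟨hK, hR.of_inner_eq hA hE fun a ha => hs a (by omega), fun a ha => hs a (by omega)⟩

theorem insBody_wp {W Z K i : ℕ} {s : Config} {A : Set ℕ} {Q : Config → Prop} (hE : Env W Z K s)
    (h31 : s.reg 31 + U i * U i ≤ Z) (hA : ∀ a ∈ A, a < U i)
    (h32 : s.reg 32 < U i) (hx : s.reg 32 ∉ A) (hR : Rep i (s.reg 31) A (s.arr 0))
    (hdone : ∀ s₁, s₁.reg 33 = 0 → Upd i (s.reg 31) (insert (s.reg 32) A) s s₁ → Q s₁)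
    (htail : ∀ s₁, Keeps 0 s s₁ → s₁.reg 30 = s.reg 30 → s₁.reg 31 = s.reg 31 →
      s₁.reg 33 = s.reg 33 → s₁.reg 32 < U i → s₁.reg 32 ∉ inner A →
      inner (insert (s.reg 32) A) = insert (s₁.reg 32) (inner A) →
      Ends (insert (s.reg 32) A) (s₁.arr 0 (s.reg 31)) (s₁.arr 0 (s.reg 31 + 1)) →
      (∀ a, a < s.reg 31 ∨ s.reg 31 + 2 ≤ a → s₁.arr 0 a = s.arr 0 a) → insTail.wp W s₁ Q) :
    insBody.wp W s Q := by
  have h8 := hE.fits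
  have h9 := four_le_sq i
  have h10 := Nat.le_mul_self (U i)
  have hW := hE.ne_zero
  have hK₁ : Keeps 0 s ((s.setReg 34 (s.arr 0 (s.reg 31))).setReg 35 (s.arr 0 (s.reg 31 + 1))) :=
    ((Keeps.refl 0 s).setReg (by norm_num) _).setReg (by norm_num) _
  rw [insBody]
  simp only [Blk.wp, ok_ld, val_ld, wp_st, Expr.ok_var, Expr.val_var, Expr.ok_add, Expr.val_add,
    Expr.ok_lit, Expr.val_lit, Expr.ok_eq, Expr.val_eq, Config.setReg_reg, Expr.val_lt,
    Expr.ok_lt, Expr.ok_sub, Expr.val_sub]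
  rcases hR.ends with ⟨rfl, hm, hM⟩ | ⟨m, M, hm, hM, em, eM⟩
  · simp [hm, hM]
    refine ⟨by omega, by omega, by omega, by omega, by omega, by omega, ?_⟩
    rw [hm, hM] at hK₁
    refine hdone _ (by simp) (upd_of_inner hR ?_ ?_ (((hK₁.setArr (by norm_num) _ _).setArr
      (by norm_num) _ _).setReg (by norm_num) _) ?_)
    · rw [insert_empty_eq, inner_singleton, inner_empty]
    · simpa using ends_singleton _
    · intro a ha
      simp [show a ≠ s.reg 31 by omega, show a ≠ s.reg 31 + 1 by omega]
  have hmU := hA m hm.1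
  have hMU := hA M hM.1
  rw [em, eM] at hK₁
  rcases (hm.2 hM.1).eq_or_lt with rfl | hmM
  · have hAe := eq_singleton_of_ends hm hM
    have hne : s.reg 32 ≠ m := fun h => hx (h ▸ hm.1)
    simp [em, eM]
    refine ⟨by omega, by omega, ⟨hW, by omega⟩, fun hlt => ⟨by omega, by omega, ?_⟩,
      fun hle => ⟨by omega, by omega, ?_⟩⟩
    · refine hdone _ (by simp) (upd_of_inner hR ?_ ?_ ((hK₁.setArr (by norm_num) _ _).setReg
        (by norm_num) _) ?_)
      · rw [hAe, inner_pair, inner_singleton]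
      · rw [hAe]
        refine Or.inr ⟨s.reg 32, m, ⟨by simp, ?_⟩, ⟨by simp, ?_⟩, by simp, by simp [eM]⟩
        · simp only [mem_lowerBounds, Set.mem_insert_iff, Set.mem_singleton_iff]; omega
        · simp only [mem_upperBounds, Set.mem_insert_iff, Set.mem_singleton_iff]; omega
      · intro a ha
        simp [show a ≠ s.reg 31 by omega]
    · refine hdone _ (by simp) (upd_of_inner hR ?_ ?_ ((hK₁.setArr (by norm_num) _ _).setReg
        (by norm_num) _) ?_)
      · rw [hAe, inner_pair, inner_singleton]
      · rw [hAe]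
        refine Or.inr ⟨m, s.reg 32, ⟨by simp, ?_⟩, ⟨by simp, ?_⟩, by simp [em], by simp⟩
        · simp only [mem_lowerBounds, Set.mem_insert_iff, Set.mem_singleton_iff]; omega
        · simp only [mem_upperBounds, Set.mem_insert_iff, Set.mem_singleton_iff]; omega
      · intro a ha
        simp [show a ≠ s.reg 31 + 1 by omega]
  · simp [em, eM, show ¬ m = M by omega]
    refine ⟨by omega, by omega, by omega, fun hlt => ⟨by omega, by omega, ?_⟩,
      fun hle => ⟨by omega, fun hlt => ⟨by omega, by omega, ?_⟩, fun hle' => ?_⟩⟩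
    · obtain ⟨h1, h2, h3, h4⟩ := inner_insert_lt hm hM hmM hlt
      refine ⟨hW, htail _ ?_ ?_ ?_ ?_ ?_ ?_ ?_ ?_ ?_⟩
      · exact (hK₁.setArr (by norm_num) _ _).setReg (by norm_num) _
      · simp
      · simp
      · simp
      · simpa
      · simpa
      · simpa
      · exact Or.inr ⟨_, _, h3, h4, by simp, by simp [eM]⟩
      · intro a ha
        simp [show a ≠ s.reg 31 by omega]
    · obtain ⟨h1, h2, h3, h4⟩ := inner_insert_gt hm hM hmM hlt
      refine ⟨hW, htail _ ?_ ?_ ?_ ?_ ?_ ?_ ?_ ?_ ?_⟩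
      · exact (hK₁.setArr (by norm_num) _ _).setReg (by norm_num) _
      · simp
      · simp
      · simp
      · simpa
      · simpa
      · simpa
      · exact Or.inr ⟨_, _, h3, h4, by simp [em], by simp⟩
      · intro a ha
        simp [show a ≠ s.reg 31 + 1 by omega]
    · have hxm : s.reg 32 ≠ m := fun h => hx (h ▸ hm.1)
      have hxM : s.reg 32 ≠ M := fun h => hx (h ▸ hM.1)
      obtain ⟨h1, h2, h3⟩ := inner_insert_mid (x := s.reg 32) hm hM (by omega) (by omega)
      refine htail _ hK₁ ?_ ?_ ?_ ?_ ?_ ?_ ?_ ?_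
      · simp
      · simp
      · simp
      · simpa
      · simpa using fun h => hx h.1
      · simpa
      · exact Or.inr ⟨_, _, h2, h3, by simp [em], by simp [eM]⟩
      · intro a ha
        simp

theorem inner_eq_empty_of_lt {A : Set ℕ} (hA : ∀ a ∈ A, a < U 0) : inner A = ∅ := by
  rw [Set.eq_empty_iff_forall_notMem]
  rintro x ⟨h1, ⟨y, h2, h3⟩, z, h4, h5⟩
  have := hA z h4
  norm_num [U] at this
  omega

theorem ins_spec (W : ℕ) (D : Oracle) (Z K i : ℕ) :
    Spec W D Z K i insLoop ((i + 1) * (insBody.cost + 3) + 3) (fun A x => x ∉ A)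
      fun A x => insert x A := by
  induction i with
  | zero =>
    intro s A hE hi h30 h33 h31 hA h32 hx hR
    refine (Runs.while_step (t₂ := 3) (by simp) (by simp [h33]) (insBody.runs ?_)).mono
      (by simp only [Expr.cost]; omega) fun _ h => h
    refine insBody_wp hE h31 hA h32 hx hR (fun s₁ h1 h2 => Runs.while_done (by simp)
      (by simpa using h1) h2) ?_
    intro s₁ _ _ _ _ _ _ h7 _ _
    have : inner (insert (s.reg 32) A) = ∅ := by
      refine inner_eq_empty_of_lt fun a ha => ?_
      rcases ha with rfl | ha
      exacts [h32, hA a ha]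
    rw [this] at h7
    exact absurd h7.symm (Set.insert_nonempty _ _).ne_empty
  | succ i ih =>
    intro s A hE hi h30 h33 h31 hA h32 hx hR
    refine (Runs.while_step (t₂ := (i + 1) * (insBody.cost + 3) + 3) (by simp) (by simp [h33])
      (insBody.runs ?_)).mono (by simp only [Expr.cost]; rw [Nat.succ_mul (i + 1)]; omega)
      fun _ h => h
    refine insBody_wp hE h31 hA h32 hx hR (fun s₁ h1 h2 => (Runs.while_done (by simp)
      (by simpa using h1) h2).mono (by simp [Expr.cost]) fun _ h => h) ?_
    intro s₁ k1 k2 k3 k4 k5 k6 k7 k8 k9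
    have := insTail_wp ih (s := s₁) (I := inner A) (hE.keeps k1 (by norm_num)) hi (by omega)
      (by omega) (by omega) (fun a ha => hA a ha.1) k5 k6 ?_
    · refine this.mono fun s₂ h₂ => h₂.mono le_rfl fun s₃ h₃ => ?_
      rw [k3] at h₃
      exact h₃.upd k7.symm k8 k1 k9
    · rw [k3]
      exact RepIn.congr hR.2 fun a ha => k9 a (Or.inr ha)
end VEB

/-! ### Van Emde Boas trees: deletion -/

namespace VEB

/-- The second half of a deletion from a node with at least two elements: pass to the cluster,
or, if this has only one element, clear it and pass to the summary. -/
def delTail : Blk :=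
  descend ;; .ite (.eq (ld 0 (.var 38)) (ld 0 (.var 38 + 1)))
    (st 0 (.var 38) 0 ;; st 0 (.var 38 + 1) 0 ;; .set 31 (.var 31 + 2) ;; .set 32 (.var 37))
    (.set 31 (.var 38))

/-- One level of a deletion. Registers: as for an insertion, and `39` and `36` hold an entry of
the summary and the size of the universe of a cluster. If an extreme element is deleted from a
node with at least three elements, then it is replaced by the next element, which is found
from the extreme elements of the summary and of the cluster and is deleted below. -/
def delBody : Blk :=
  .set 34 (ld 0 (.var 31)) ;; .set 35 (ld 0 (.var 31 + 1)) ;;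
  .ite (.eq (.var 34) (.var 35))
    (st 0 (.var 31) 0 ;; st 0 (.var 31 + 1) 0 ;; .set 33 0)
    (.ite (.eq (.var 32 + 1) (.var 34))
      (.set 39 (ld 0 (.var 31 + 2)) ;;
        .ite (.eq (.var 39) 0) (st 0 (.var 31) (.var 35) ;; .set 33 0)
          (.set 36 (ld 6 (.var 30 - 1)) ;;
            .set 32 ((.var 39 - 1) * .var 36 +
              (ld 0 (.var 31 + 2 + .var 39 * .var 36 * .var 36) - 1)) ;;
            st 0 (.var 31) (.var 32 + 1) ;; delTail))
      (.ite (.eq (.var 32 + 1) (.var 35))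
        (.set 39 (ld 0 (.var 31 + 2)) ;;
          .ite (.eq (.var 39) 0) (st 0 (.var 31 + 1) (.var 34) ;; .set 33 0)
            (.set 36 (ld 6 (.var 30 - 1)) ;;
              .set 39 (ld 0 (.var 31 + 2 + 1)) ;;
              .set 32 ((.var 39 - 1) * .var 36 +
                (ld 0 (.var 31 + 2 + .var 39 * .var 36 * .var 36 + 1) - 1)) ;;
              st 0 (.var 31 + 1) (.var 32 + 1) ;; delTail))
        delTail))

/-- Deletion of an element. -/
def delLoop : Cmd := .while (.var 33) delBody.cmd

theorem delTail_wp {W Z K i t : ℕ} {D : Oracle}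
    (ih : Spec W D Z K i delLoop t (fun A x => x ∈ A) fun A x => A \ {x})
    {s : Config} {I : Set ℕ} (hE : Env W Z K s)
    (hi : i + 1 ≤ K) (h30 : s.reg 30 = i + 1) (h33 : s.reg 33 = 1)
    (h31 : s.reg 31 + U (i + 1) * U (i + 1) ≤ Z) (hI : ∀ a ∈ I, a < U (i + 1))
    (hx : s.reg 32 ∈ I) (hR : RepIn i (s.reg 31) I (s.arr 0)) :
    delTail.wp W s fun s₁ =>
      Runs W D delLoop t s₁ (UpdIn i (s.reg 31) (I \ {s.reg 32}) s) := by
  have h32 := hI _ hx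
  rw [delTail, Blk.wp]
  refine descend_wp hE hi h30 h31 h32 ?_
  have hd := hE.descended i
  have hb := two_le_U i
  have hh : s.reg 32 / U i < U i := Nat.div_lt_of_lt_mul (U_succ i ▸ h32)
  have h6 := child_lt (o := s.reg 31) hh
  have h7 := le_child (s.reg 31) (U i) (s.reg 32 / U i)
  have h8 := hd.env.fits
  have h9 := four_le_sq i
  have h10 := Nat.le_mul_self (U i)
  have hl : s.reg 32 % U i < U i := Nat.mod_lt _ (by omega)
  have hxe := Nat.div_add_mod' (s.reg 32) (U i)
  have hW := hE.ne_zero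
  have hHI := lt_of_mem_heads hI
  have hlt : s.reg 32 % U i ∈ tails (U i) (s.reg 32 / U i) I := by
    rwa [mem_of_div_mod (by omega)]
  generalize descended s i = s₂ at *
  generalize s.reg 32 / U i = h at *
  generalize s.reg 32 % U i = l at *
  rw [← hxe]
  have hc := hR.2 h hh
  have hR1 := hR.1
  rw [← hd.arr] at hc hR1
  obtain ⟨m, M, hm, hM, em, eM⟩ := hc.ends.resolve_left fun h => by simp [h.1] at hlt
  simp only [Blk.wp, ok_ld, val_ld, wp_st, Expr.ok_var, Expr.val_var, Expr.ok_add, Expr.val_add,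
    Expr.ok_lit, Expr.val_lit, Expr.ok_eq, Expr.val_eq, Config.setReg_reg, hd.r38, em, eM]
  by_cases hmM : m = M
  · -- the cluster has one element
    subst hmM
    have hsing := eq_singleton_of_ends hm hM
    have hlm : l = m := by rw [hsing] at hlt; exact hlt
    subst hlm
    simp [hd.r38, hd.r31, hd.r37]
    and_intros <;> try omega
    have hK : Keeps 0 s ((((s₂.setArr 0 (child (s.reg 31) (U i) h) 0).setArr 0
        (child (s.reg 31) (U i) h + 1) 0).setReg 31 (s.reg 31 + 2)).setReg 32 h) :=
      (((hd.keeps.setArr (by norm_num) _ _).setArr (by norm_num) _ _).setReg (by norm_num)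
        _).setReg (by norm_num) _
    have := ih _ (heads (U i) I)
      (hE.keeps hK (by norm_num)) (by omega) (by simp [hd.r30]) (by simp [hd.r33, h33])
      (by simp; omega) hHI (by simp [hh])
      (by simp [mem_heads_iff, hsing])
      (by
        simp
        refine hR1.congr fun a _ ha => ?_
        rw [Function.update_of_ne (by omega), Function.update_of_ne (by omega)])
    refine this.mono le_rfl ?_
    rintro s' ⟨k, r, u⟩
    simp only [Config.setReg_reg] at r u
    refine UpdIn.of_summary hh hR (hK.trans k) ?_ u (fun a ha ha' => ?_)
      (fun k hk => tails_diff_ne hl hk) ?_ ?_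
    · rw [heads_diff hl hsing]
      simpa using r
    · simp [ha, ha', hd.arr]
    · rw [tails_diff hl, hsing, Set.sdiff_self, inner_empty, inner_singleton]
    · rw [tails_diff hl, hsing, Set.sdiff_self]
      simpa using ends_empty
  · -- the cluster has further elements
    have hne : ∃ l' ∈ tails (U i) h I, l' ≠ l := by
      by_cases hml : m = l
      · exact ⟨M, hM.1, fun e => hmM (hml.trans e.symm)⟩
      · exact ⟨m, hm.1, hml⟩
    obtain ⟨l', hl', hne⟩ := hne
    simp [hmM]
    and_intros <;> try omega
    have hK : Keeps 0 s (s₂.setReg 31 (child (s.reg 31) (U i) h)) :=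
      hd.keeps.setReg (by norm_num) _
    have := ih (s₂.setReg 31 (child (s.reg 31) (U i) h)) (tails (U i) h I)
      (hE.keeps hK (by norm_num)) (by omega) (by simp [hd.r30]) (by simp [hd.r33, h33])
      (by simp; omega) (fun a ha => ha.1) (by simp [hd.r32, hl]) (by simp [hd.r32, hlt])
      (by simpa using hc)
    simp only [Config.setReg_reg, hd.r32] at this
    refine this.mono le_rfl ?_
    rintro s' ⟨k, r, u⟩
    refine UpdIn.of_cluster hh hR (hK.trans k) ?_ (fun a ha => (u a ha).trans ?_) ?_ ?_
    · rw [tails_diff hl]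
      simpa using r
    · simp [hd.arr]
    · rw [heads_diff_of_ne hl hl' hne]
    · exact fun k hk => tails_diff_ne hl hk

/-- The first cell of the summary of a node tells whether the node has inner elements. -/
theorem Rep.summary {i o : ℕ} {A : Set ℕ} {v : ℕ → ℕ} (h : Rep i o A v)
    (hA : ∀ a ∈ A, a < U i) :
    (v (o + 2) = 0 ∧ inner A = ∅) ∨ ∃ j f F l L, i = j + 1 ∧ IsLeast (inner A) (f * U j + l) ∧
      IsGreatest (inner A) (F * U j + L) ∧ f < U j ∧ F < U j ∧ v (o + 2) = f + 1 ∧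
      v (o + 2 + 1) = F + 1 ∧
      v (child o (U j) f) = l + 1 ∧ v (child o (U j) F + 1) = L + 1 := by
  cases i with
  | zero => exact Or.inl ⟨h.2, inner_eq_empty_of_lt hA⟩
  | succ i =>
    have hH := lt_of_mem_heads (i := i) (I := inner A) fun a ha => hA a ha.1
    have hb := two_le_U i
    rcases h.2.1.ends with ⟨h1, h2, _⟩ | ⟨f, F, hf, hF, ef, eF⟩
    · refine Or.inl ⟨h2, ?_⟩
      rw [Set.eq_empty_iff_forall_notMem] at h1 ⊢
      exact fun x hx => h1 (x / U i) ⟨x % U i, (mem_of_div_mod (by omega)).2 hx⟩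
    · right
      obtain ⟨l, l', hl, -, el, -⟩ := (h.2.2 f (hH f hf.1)).ends.resolve_left fun h =>
        (mem_heads_iff.1 hf.1).ne_empty h.1
      obtain ⟨L', L, -, hL, -, eL⟩ := (h.2.2 F (hH F hF.1)).ends.resolve_left fun h =>
        (mem_heads_iff.1 hF.1).ne_empty h.1
      exact ⟨i, f, F, l, L, rfl, isLeast_of_heads hf hl, isGreatest_of_heads hF hL, hH f hf.1,
        hH F hF.1, ef, eF, el, eL⟩

theorem delBody_wp {W Z K i : ℕ} {s : Config} {A : Set ℕ} {Q : Config → Prop} (hE : Env W Z K s)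
    (hiK : i ≤ K) (h30 : s.reg 30 = i)
    (h31 : s.reg 31 + U i * U i ≤ Z) (hA : ∀ a ∈ A, a < U i)
    (hx : s.reg 32 ∈ A) (hR : Rep i (s.reg 31) A (s.arr 0))
    (hdone : ∀ s₁, s₁.reg 33 = 0 → Upd i (s.reg 31) (A \ {s.reg 32}) s s₁ → Q s₁)
    (htail : ∀ s₁, Keeps 0 s s₁ → s₁.reg 30 = s.reg 30 → s₁.reg 31 = s.reg 31 →
      s₁.reg 33 = s.reg 33 → s₁.reg 32 ∈ inner A →
      inner (A \ {s.reg 32}) = inner A \ {s₁.reg 32} →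
      Ends (A \ {s.reg 32}) (s₁.arr 0 (s.reg 31)) (s₁.arr 0 (s.reg 31 + 1)) →
      (∀ a, a < s.reg 31 ∨ s.reg 31 + 2 ≤ a → s₁.arr 0 a = s.arr 0 a) → delTail.wp W s₁ Q) :
    delBody.wp W s Q := by
  have h8 := hE.fits
  have h9 := four_le_sq i
  have h10 := Nat.le_mul_self (U i)
  have hW := hE.ne_zero
  have h32 := hA _ hx
  have hK₁ : Keeps 0 s ((s.setReg 34 (s.arr 0 (s.reg 31))).setReg 35 (s.arr 0 (s.reg 31 + 1))) :=
    ((Keeps.refl 0 s).setReg (by norm_num) _).setReg (by norm_num) _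
  rw [delBody]
  generalize delTail = T at *
  simp only [Blk.wp, ok_ld, val_ld, wp_st, Expr.ok_var, Expr.val_var, Expr.ok_add, Expr.val_add,
    Expr.ok_lit, Expr.val_lit, Expr.ok_eq, Expr.val_eq, Config.setReg_reg, Expr.ok_sub,
    Expr.val_sub]
  obtain ⟨m, M, hm, hM, em, eM⟩ := hR.ends.resolve_left fun h => by simp [h.1] at hx
  have hmU := hA m hm.1
  have hMU := hA M hM.1
  have hxm := hm.2 hx
  have hxM := hM.2 hx
  rw [em, eM] at hK₁
  by_cases hmM : m = M
  · subst hmM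
    have hAe := eq_singleton_of_ends hm hM
    have hxe : s.reg 32 = m := le_antisymm hxM hxm
    simp [em, eM]
    and_intros <;> try omega
    refine hdone _ (by simp) (upd_of_inner hR ?_ ?_ (((hK₁.setArr (by norm_num) _ _).setArr
      (by norm_num) _ _).setReg (by norm_num) _) ?_)
    · rw [hAe, hxe, Set.sdiff_self, inner_singleton, inner_empty]
    · rw [hAe, hxe, Set.sdiff_self]
      simpa using ends_empty
    · intro a ha
      simp [show a ≠ s.reg 31 by omega, show a ≠ s.reg 31 + 1 by omega]
  simp [em, eM, hmM]
  have hpair := fun h => eq_pair_of_inner hm hM h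
  rcases hR.summary hA with ⟨hs0, hI⟩ |
    ⟨j, f, F, l, L, rfl, hf, hF, hfb, hFb, ef, eF, el, eL⟩
  · -- the node holds exactly its two extreme elements
    have hAe := hpair hI
    simp [hs0]
    and_intros <;> try omega
    · intro hxe
      and_intros <;> try omega
      have hAx : A \ {s.reg 32} = {M} := by
        rw [hAe, hxe]
        ext a
        simp only [Set.mem_sdiff, Set.mem_insert_iff, Set.mem_singleton_iff]
        omega
      refine hdone _ (by simp) (upd_of_inner hR ?_ ?_ (((hK₁.setReg (by norm_num) _).setArr
        (by norm_num) _ _).setReg (by norm_num) _) ?_)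
      · rw [hAx, hI, inner_singleton]
      · rw [hAx]
        simpa [eM] using ends_singleton M
      · intro a ha
        simp [show a ≠ s.reg 31 by omega]
    · intro hxne
      and_intros <;> try omega
      · intro hxe
        and_intros <;> try omega
        have hAx : A \ {s.reg 32} = {m} := by
          rw [hAe, hxe]
          ext a
          simp only [Set.mem_sdiff, Set.mem_insert_iff, Set.mem_singleton_iff]
          omega
        refine hdone _ (by simp) (upd_of_inner hR ?_ ?_ (((hK₁.setReg (by norm_num) _).setArr
          (by norm_num) _ _).setReg (by norm_num) _) ?_)
        · rw [hAx, hI, inner_singleton]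
        · rw [hAx]
          simpa [em] using ends_singleton m
        · intro a ha
          simp [show a ≠ s.reg 31 + 1 by omega]
      · intro hxe
        have := (inner_diff_mid hm hM hx hxne hxe).1
        rw [hI] at this
        exact this.elim
  · have e6 := hE.table j (by omega)
    have hb := two_le_U j
    have a1 := child_lt (o := s.reg 31) hfb
    have a2 := child_lt (o := s.reg 31) hFb
    have a3 := hA _ hf.1.1
    have a4 := hA _ hF.1.1
    have a5 : (f + 1) * U j ≤ (f + 1) * U j * U j := Nat.le_mul_of_pos_right _ (by omega)
    have a6 : (F + 1) * U j ≤ (F + 1) * U j * U j := Nat.le_mul_of_pos_right _ (by omega)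
    have a7 := hE.level
    have a8 := four_le_sq j
    rw [child] at *
    simp [ef, eF, h30, e6, el, eL]
    and_intros <;> try omega
    · intro hxe
      and_intros <;> try omega
      obtain ⟨h1, h2, h3⟩ := inner_diff_least hm hM hf
      refine htail _ ?_ ?_ ?_ ?_ ?_ ?_ ?_ ?_
      · exact (((hK₁.setReg (by norm_num) _).setReg (by norm_num) _).setReg (by norm_num)
          _).setArr (by norm_num) _ _
      · simp
      · simp
      · simp
      · simpa using hf.1
      · simpa [hxe] using h1
      · rw [hxe]
        exact Or.inr ⟨_, _, h2, h3, by simp, by simp [eM]⟩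
      · intro a ha
        simp [show a ≠ s.reg 31 by omega]
    · intro hxne
      and_intros <;> try omega
      · intro hxe
        and_intros <;> try omega
        obtain ⟨h1, h2, h3⟩ := inner_diff_greatest hm hM hF
        refine htail _ ?_ ?_ ?_ ?_ ?_ ?_ ?_ ?_
        · exact ((((hK₁.setReg (by norm_num) _).setReg (by norm_num) _).setReg (by norm_num)
            _).setReg (by norm_num) _).setArr (by norm_num) _ _
        · simp
        · simp
        · simp
        · simpa using hF.1
        · simpa [hxe] using h1
        · rw [hxe]
          exact Or.inr ⟨_, _, h2, h3, by simp [em], by simp⟩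
        · intro a ha
          simp [show a ≠ s.reg 31 + 1 by omega]
      · intro hxne'
        obtain ⟨h1, h2, h3, h4⟩ := inner_diff_mid hm hM hx hxne hxne'
        refine htail _ hK₁ ?_ ?_ ?_ ?_ ?_ ?_ ?_
        · simp
        · simp
        · simp
        · simpa using h1
        · simpa using h2
        · exact Or.inr ⟨_, _, h3, h4, by simp [em], by simp [eM]⟩
        · intro a ha
          simp

theorem del_spec (W : ℕ) (D : Oracle) (Z K i : ℕ) :
    Spec W D Z K i delLoop ((i + 1) * (delBody.cost + 3) + 3) (fun A x => x ∈ A)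
      fun A x => A \ {x} := by
  induction i with
  | zero =>
    intro s A hE hi h30 h33 h31 hA h32 hx hR
    refine (Runs.while_step (t₂ := 3) (by simp) (by simp [h33]) (delBody.runs ?_)).mono
      (by simp only [Expr.cost]; omega) fun _ h => h
    refine delBody_wp hE hi h30 h31 hA hx hR (fun s₁ h1 h2 => Runs.while_done (by simp)
      (by simpa using h1) h2) ?_
    intro s₁ _ _ _ _ h6 _ _ _
    rw [inner_eq_empty_of_lt hA] at h6
    exact h6.elim
  | succ i ih =>
    intro s A hE hi h30 h33 h31 hA h32 hx hR
    refine (Runs.while_step (t₂ := (i + 1) * (delBody.cost + 3) + 3) (by simp) (by simp [h33])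
      (delBody.runs ?_)).mono (by simp only [Expr.cost]; rw [Nat.succ_mul (i + 1)]; omega)
      fun _ h => h
    refine delBody_wp hE hi h30 h31 hA hx hR (fun s₁ h1 h2 => (Runs.while_done (by simp)
      (by simpa using h1) h2).mono (by simp [Expr.cost]) fun _ h => h) ?_
    intro s₁ k1 k2 k3 k4 k6 k7 k8 k9
    have := delTail_wp ih (s := s₁) (I := inner A) (hE.keeps k1 (by norm_num)) hi (by omega)
      (by omega) (by omega) (fun a ha => hA a ha.1) k6 ?_
    · refine this.mono fun s₂ h₂ => h₂.mono le_rfl fun s₃ h₃ => ?_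
      rw [k3] at h₃
      exact h₃.upd k7.symm k8 k1 k9
    · rw [k3]
      exact RepIn.congr hR.2 fun a ha => k9 a (Or.inr ha)

end VEB

/-! ### Van Emde Boas trees: predecessor search -/

namespace VEB

/-- The elements of `A` up to `x`. -/
def upTo (A : Set ℕ) (x : ℕ) : Set ℕ := {a | a ∈ A ∧ a ≤ x}

section sets
variable {A I : Set ℕ} {m M x b : ℕ}

theorem isGreatest_upTo_max (hM : IsGreatest A M) (h : M ≤ x) : IsGreatest (upTo A x) M :=
  ⟨⟨hM.1, h⟩, fun _ ha => hM.2 ha.1⟩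

theorem mem_inner_of_upTo {a : ℕ} (hm : IsLeast A m) (hM : IsGreatest A M) (hxM : x < M)
    (ha : a ∈ upTo A x) (ham : a ≠ m) : a ∈ inner A :=
  ⟨ha.1, ⟨m, hm.1, lt_of_le_of_ne (hm.2 ha.1) (Ne.symm ham)⟩, M, hM.1, ha.2.trans_lt hxM⟩

theorem isGreatest_upTo_inner {y : ℕ} (hm : IsLeast A m) (hM : IsGreatest A M)
    (hxM : x < M) (hy : IsGreatest (upTo (inner A) x) y) : IsGreatest (upTo A x) y := by
  refine ⟨⟨hy.1.1.1, hy.1.2⟩, fun a ha => ?_⟩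
  by_cases ham : a = m
  · exact ham ▸ hm.2 hy.1.1.1
  · exact hy.2 ⟨mem_inner_of_upTo hm hM hxM ha ham, ha.2⟩

theorem isGreatest_upTo_least (hm : IsLeast A m) (hM : IsGreatest A M)
    (hxM : x < M) (hmx : m ≤ x) (hy : ∀ a ∈ inner A, x < a) : IsGreatest (upTo A x) m := by
  refine ⟨⟨hm.1, hmx⟩, fun a ha => ?_⟩
  by_contra hlt
  have := hy a (mem_inner_of_upTo hm hM hxM ha (by omega))
  have := ha.2
  omega

theorem isGreatest_upTo_tails {a : ℕ} (hb : 0 < b)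
    (ha : IsGreatest (upTo (tails b (x / b) I) (x % b)) a) :
    IsGreatest (upTo I x) (x / b * b + a) := by
  have hx := Nat.div_add_mod' x b
  have h1 := ha.1.2
  refine ⟨⟨ha.1.1.2, by omega⟩, fun c hc => ?_⟩
  have hc' := Nat.div_add_mod' c b
  have h2 := Nat.mod_lt c hb
  rcases (Nat.div_le_div_right (c := b) hc.2).eq_or_lt with e | e
  · have hcx := hc.2
    have : c % b ≤ a := ha.2 ⟨⟨h2, by rw [← e, hc']; exact hc.1⟩, by rw [e] at hc'; omega⟩
    rw [e] at hc'
    omega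
  · have := Nat.mul_le_mul_right b (show c / b + 1 ≤ x / b from e)
    rw [Nat.succ_mul] at this
    omega

theorem isGreatest_upTo_heads {a l : ℕ} (hb : 0 < b) (hx : 0 < x / b)
    (ht : ∀ l ∈ tails b (x / b) I, x % b < l)
    (ha : IsGreatest (upTo (heads b I) (x / b - 1)) a) (hl : IsGreatest (tails b a I) l) :
    IsGreatest (upTo I x) (a * b + l) := by
  have hx' := Nat.div_add_mod' x b
  have h1 := ha.1.2
  have h3 := hl.1.1
  have h4 := Nat.mul_le_mul_right b (show a + 1 ≤ x / b by omega)
  rw [Nat.succ_mul] at h4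
  refine ⟨⟨hl.1.2, by omega⟩, fun c hc => ?_⟩
  have hc' := Nat.div_add_mod' c b
  have h2 := Nat.mod_lt c hb
  have hcx := hc.2
  rcases (Nat.div_le_div_right (c := b) hc.2).eq_or_lt with e | e
  · have := ht (c % b) ⟨h2, by rw [← e, hc']; exact hc.1⟩
    rw [e] at hc'
    omega
  · have h5 : c / b ≤ a := ha.2 ⟨⟨c % b, h2, by rw [hc']; exact hc.1⟩, by omega⟩
    rcases h5.eq_or_lt with e' | e'
    · have := hl.2 (show c % b ∈ tails b a I from ⟨h2, by rw [← e', hc']; exact hc.1⟩)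
      rw [e'] at hc'
      omega
    · have := Nat.mul_le_mul_right b (show c / b + 1 ≤ a from e')
      rw [Nat.succ_mul] at this
      omega

theorem lt_of_heads_tails (hb : 0 < b) (ht : ∀ l ∈ tails b (x / b) I, x % b < l)
    (hh : ∀ h ∈ heads b I, x / b ≤ h) : ∀ a ∈ I, x < a := by
  intro c hc
  have hx' := Nat.div_add_mod' x b
  have hc' := Nat.div_add_mod' c b
  have h2 := Nat.mod_lt c hb
  have h3 := Nat.mod_lt x hb
  rcases (hh (c / b) ⟨c % b, h2, by rw [hc']; exact hc⟩).eq_or_lt with e | e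
  · have := ht (c % b) ⟨h2, by rw [e, hc']; exact hc⟩
    rw [← e] at hc'
    omega
  · have := Nat.mul_le_mul_right b (show x / b + 1 ≤ c / b from e)
    rw [Nat.succ_mul] at this
    omega

end sets

/-- The passage to a cluster or to the summary in the search for the greatest element that is at
most `x`. The passage from level `k + 1` to level `k` is recorded in the entries `2 * k` and
`2 * k + 1` of array `7`: the number of the cluster plus one, or zero for the summary, and the
address of the node. -/
def locTail : Blk :=
  descend ;; st 7 (2 * .var 30 + 1) (.var 31) ;; .set 42 (ld 0 (.var 38)) ;;
  .ite (.eq (.var 42) 0 + .lt (.var 32 + 1) (.var 42))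
    (.ite (.lt (.var 40) (.var 37 + 1))
      (st 7 (2 * .var 30) 0 ;; .set 31 (.var 31 + 2) ;; .set 32 (.var 37 - 1))
      (.set 39 (.var 34 - 1) ;; .set 33 0 ;; .set 30 (.var 30 + 1)))
    (st 7 (2 * .var 30) (.var 37 + 1) ;; .set 31 (.var 38))

/-- One level of the search for the greatest element that is at most `x`, downwards. Registers:
`30` level, `31` address of the node, `32` the bound `x`, `33` is nonzero as long as work remains,
`39` the result. The search ends at an extreme element, continues in the cluster of `x`, or, if
this has no element up to the remainder of `x`, in the summary. -/
def locBody : Blk :=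
  .set 34 (ld 0 (.var 31)) ;; .set 35 (ld 0 (.var 31 + 1)) ;;
  .ite (.lt (.var 32 + 1) (.var 35))
    (.set 40 (ld 0 (.var 31 + 2)) ;;
      .ite (.eq (.var 40) 0) (.set 39 (.var 34 - 1) ;; .set 33 0) locTail)
    (.set 39 (.var 35 - 1) ;; .set 33 0)

/-- The downward part of the search. -/
def locLoop : Cmd := .while (.var 33) locBody.cmd

/-- The records of the search lead from the result `a` at level `k` to the result `y` at level
`k + 1`. -/
def Step (Z : ℕ) (s : Config) (k a y : ℕ) : Prop :=
  a < U k ∧ y < U (k + 1) ∧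
    ((∃ h < U k, s.arr 7 (2 * k) = h + 1 ∧ y = h * U k + a) ∨
      (s.arr 7 (2 * k) = 0 ∧ s.arr 7 (2 * k + 1) + U (k + 1) * U (k + 1) ≤ Z ∧ ∃ l,
        s.arr 0 (child (s.arr 7 (2 * k + 1)) (U k) a + 1) = l + 1 ∧ y = a * U k + l))

/-- The search has reached level `j`, and its records lead from the result there to the result
`y` at level `i`. -/
def Found (Z i y : ℕ) (s s' : Config) : Prop :=
  Keeps 7 s s' ∧ s'.reg 30 ≤ i ∧ (∃ z : ℕ → ℕ, z (s'.reg 30) = s'.reg 39 ∧ z i = y ∧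
    ∀ k, s'.reg 30 ≤ k → k < i → Step Z s' k (z k) (z (k + 1))) ∧
    ∀ a, 2 * i ≤ a → s'.arr 7 a = s.arr 7 a

theorem Found.here {Z i y : ℕ} {s s' : Config} (hK : Keeps 7 s s') (h30 : s'.reg 30 = i)
    (h39 : s'.reg 39 = y) (ha : ∀ a, 2 * i ≤ a → s'.arr 7 a = s.arr 7 a) : Found Z i y s s' :=
  ⟨hK, h30.le, ⟨fun _ => y, h39.symm, rfl, fun k h1 h2 => by omega⟩, ha⟩

theorem Found.step {Z i y y' : ℕ} {s s₁ s' : Config} (h : Found Z i y s₁ s')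
    (hK : Keeps 7 s s₁) (hs : ∀ a, 2 * (i + 1) ≤ a → s₁.arr 7 a = s.arr 7 a)
    (h₁ : Step Z s₁ i y y') : Found Z (i + 1) y' s s' := by
  obtain ⟨k, l, ⟨z, z1, z2, z3⟩, u⟩ := h
  refine ⟨hK.trans k, by omega, ⟨fun n => if n = i + 1 then y' else z n, ?_, by simp, ?_⟩,
    fun a ha => (u a (by omega)).trans (hs a ha)⟩
  · simpa [show s'.reg 30 ≠ i + 1 by omega] using z1
  · intro n h1 h2
    simp only [show n ≠ i + 1 by omega, if_false]
    by_cases hn : n = i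
    · subst hn
      simp only [if_true, z2]
      unfold Step at h₁ ⊢
      rwa [u _ le_rfl, u _ (by omega), k.2.1 0 (by norm_num) (by norm_num)]
    · simp only [show n + 1 ≠ i + 1 by omega, if_false]
      exact z3 n h1 (by omega)

theorem locTail_wp {W Z K j m f : ℕ} {s : Config} {I : Set ℕ} {Q : Config → Prop}
    (hE : Env W Z K s) (hjK : j + 1 ≤ K) (h30 : s.reg 30 = j + 1)
    (h31 : s.reg 31 + U (j + 1) * U (j + 1) ≤ Z) (hI : ∀ a ∈ I, a < U (j + 1))
    (h32 : s.reg 32 < U (j + 1)) (h34 : s.reg 34 = m + 1) (h40 : s.reg 40 = f + 1)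
    (hf : IsLeast (heads (U j) I) f)
    (hR : RepIn j (s.reg 31) I (s.arr 0)) (hKZ : 2 * K ≤ Z)
    (hleast : ∀ s₁, (∀ a ∈ I, s.reg 32 < a) → s₁.reg 33 = 0 → Found Z (j + 1) m s s₁ → Q s₁)
    (hgo : ∀ s₁ B, Keeps 7 s s₁ → s₁.reg 30 = j → s₁.reg 33 = s.reg 33 →
      s₁.reg 31 + U j * U j ≤ Z → (∀ a ∈ B, a < U j) → s₁.reg 32 < U j →
      (∃ a ∈ B, a ≤ s₁.reg 32) → Rep j (s₁.reg 31) B (s.arr 0) →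
      (∀ a, 2 * (j + 1) ≤ a → s₁.arr 7 a = s.arr 7 a) →
      (∀ a, IsGreatest (upTo B (s₁.reg 32)) a →
        ∃ y, IsGreatest (upTo I (s.reg 32)) y ∧ Step Z s₁ j a y) → Q s₁) :
    locTail.wp W s Q := by
  have hW := hE.ne_zero
  have hb := two_le_U j
  have hh : s.reg 32 / U j < U j := Nat.div_lt_of_lt_mul (U_succ j ▸ h32)
  have h6 := child_lt (o := s.reg 31) hh
  have h7 := le_child (s.reg 31) (U j) (s.reg 32 / U j)
  have h8 := hE.fits
  have h9 := four_le_sq j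
  have h10 := Nat.le_mul_self (U j)
  have h11 : s.reg 32 % U j < U j := Nat.mod_lt _ (by omega)
  have h12 := hE.level
  have hd := hE.descended j
  have d34 : (descended s j).reg 34 = m + 1 := by simp [descended, h34]
  have d40 : (descended s j).reg 40 = f + 1 := by simp [descended, h40]
  have hHI := lt_of_mem_heads hI
  rw [locTail, Blk.wp]
  refine descend_wp hE hjK h30 h31 h32 ?_
  have darr : (descended s j).arr 7 = s.arr 7 := descended_arr s j 7
  generalize descended s j = s₂ at *
  have d20 : s₂.reg 20 = s.reg 20 := hd.keeps.1 20 (by norm_num)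
  have hK7 : Keeps 7 s s₂ :=
    ⟨hd.keeps.1, fun i hi _ => if h0 : i = 0 then h0 ▸ hd.arr else hd.keeps.2.1 i hi h0,
      hd.keeps.2.2⟩
  simp [Blk.wp, hd.r30, hd.r31, hd.r32, hd.r37, hd.r38, hd.arr, d34, d40, hW]
  and_intros <;> try omega
  · split <;> split <;> omega
  · -- the cluster has no element up to the remainder
    intro hemp
    have ht : ∀ l ∈ tails (U j) (s.reg 32 / U j) I, s.reg 32 % U j < l := by
      intro l hl
      rcases (hR.2 _ hh).ends with ⟨h1, -⟩ | ⟨l₀, L, hl₀, hL, el, eL⟩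
      · simp [h1] at hl
      · have h1 := hemp (by omega)
        have h2 := hl₀.2 hl
        omega
    and_intros <;> try omega
    · intro hfx
      and_intros <;> try omega
      refine hgo _ (heads (U j) I) ?_ ?_ ?_ ?_ hHI ?_ ⟨f, hf.1, ?_⟩ ?_ ?_ ?_
      · exact (((((hK7.setArr (by norm_num) _ _).setReg (by norm_num) _).setArr (by norm_num) _
          _).setReg (by norm_num) _).setReg (by norm_num) _)
      · simp [hd.r30]
      · simp [hd.r33]
      · simp
        omega
      · simp
        omega
      · simp
        omega
      · simpa using hR.1
      · intro a ha
        simp [darr, show a ≠ 2 * j by omega, show a ≠ 2 * j + 1 by omega]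
      · intro a ha
        simp only [Config.setReg_reg, if_true] at ha
        obtain ⟨L', L, -, hL, -, eL⟩ := (hR.2 a (hHI a ha.1.1)).ends.resolve_left fun h =>
          (mem_heads_iff.1 ha.1.1).ne_empty h.1
        have hy := isGreatest_upTo_heads (by omega) (by omega) ht ha hL
        refine ⟨_, hy, hHI a ha.1.1, hI _ hy.1.1, Or.inr ⟨?_, ?_, L, ?_, rfl⟩⟩
        · simp
        · simp
          omega
        · simpa [hd.arr] using eL
    · intro hxf
      and_intros <;> try omega
      refine hleast _ (lt_of_heads_tails (by omega) ht fun h hh => hxf.trans (hf.2 hh)) ?_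
        (Found.here (((((hK7.setArr (by norm_num) _ _).setReg (by norm_num) _).setReg
        (by norm_num) _).setReg (by norm_num) _).setReg (by norm_num) _) ?_ ?_ ?_)
      · simp
      · simp
      · simp
      · intro a ha
        simp [darr, show a ≠ 2 * j + 1 by omega]
  · intro hne hle
    and_intros <;> try omega
    obtain ⟨l₀, L, hl₀, hL, el, eL⟩ := (hR.2 _ hh).ends.resolve_left fun h => hne h.2.1
    refine hgo _ (tails (U j) (s.reg 32 / U j) I) ?_ ?_ ?_ ?_ (fun a ha => ha.1) ?_
      ⟨l₀, hl₀.1, ?_⟩ ?_ ?_ ?_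
    · exact ((((hK7.setArr (by norm_num) _ _).setReg (by norm_num) _).setArr (by norm_num) _
        _).setReg (by norm_num) _)
    · simp [hd.r30]
    · simp [hd.r33]
    · simp
      omega
    · simpa [hd.r32] using h11
    · simp [hd.r32]
      omega
    · simpa using hR.2 _ hh
    · intro a ha
      simp [darr, show a ≠ 2 * j by omega, show a ≠ 2 * j + 1 by omega]
    · intro a ha
      simp [hd.r32] at ha
      have hy := isGreatest_upTo_tails (by omega) ha
      exact ⟨_, hy, ha.1.1.1, hI _ hy.1.1, Or.inl ⟨_, hh, by simp, rfl⟩⟩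

theorem locBody_wp {W Z K i : ℕ} {s : Config} {A : Set ℕ} {Q : Config → Prop} (hE : Env W Z K s)
    (hiK : i ≤ K) (h30 : s.reg 30 = i) (h31 : s.reg 31 + U i * U i ≤ Z) (hA : ∀ a ∈ A, a < U i)
    (h32 : s.reg 32 < U i) (hx : ∃ a ∈ A, a ≤ s.reg 32) (hR : Rep i (s.reg 31) A (s.arr 0))
    (hKZ : 2 * K ≤ Z)
    (hdone : ∀ s₁ y, s₁.reg 33 = 0 → IsGreatest (upTo A (s.reg 32)) y → Found Z i y s s₁ → Q s₁)
    (hgo : ∀ s₁ j B, i = j + 1 → Keeps 7 s s₁ → s₁.reg 30 = j → s₁.reg 33 = s.reg 33 →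
      s₁.reg 31 + U j * U j ≤ Z → (∀ a ∈ B, a < U j) → s₁.reg 32 < U j →
      (∃ a ∈ B, a ≤ s₁.reg 32) → Rep j (s₁.reg 31) B (s.arr 0) →
      (∀ a, 2 * i ≤ a → s₁.arr 7 a = s.arr 7 a) →
      (∀ a, IsGreatest (upTo B (s₁.reg 32)) a →
        ∃ y, IsGreatest (upTo A (s.reg 32)) y ∧ Step Z s₁ j a y) → Q s₁) :
    locBody.wp W s Q := by
  have h8 := hE.fits
  have h9 := four_le_sq i
  have h10 := Nat.le_mul_self (U i)
  have hW := hE.ne_zero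
  have hK₁ : Keeps 7 s ((s.setReg 34 (s.arr 0 (s.reg 31))).setReg 35 (s.arr 0 (s.reg 31 + 1))) :=
    ((Keeps.refl 7 s).setReg (by norm_num) _).setReg (by norm_num) _
  rw [locBody]
  obtain ⟨m, M, hm, hM, em, eM⟩ := hR.ends.resolve_left fun h => by
    obtain ⟨a, ha, -⟩ := hx
    simp [h.1] at ha
  have hmU := hA m hm.1
  have hMU := hA M hM.1
  have hmx : m ≤ s.reg 32 := by
    obtain ⟨a, ha, hax⟩ := hx
    exact (hm.2 ha).trans hax
  rw [em, eM] at hK₁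
  generalize hT : locTail = T
  simp [Blk.wp, em, eM, hW]
  and_intros <;> try omega
  · intro hxM
    and_intros <;> try omega
    · intro h0
      refine hdone _ m ?_ ?_ (Found.here (((hK₁.setReg (by norm_num) _).setReg
        (by norm_num) _).setReg (by norm_num) _) ?_ ?_ ?_)
      · simp
      · rcases hR.summary hA with ⟨-, hI⟩ | ⟨j, f, F, l, L, -, -, -, -, -, ef, -⟩
        · exact isGreatest_upTo_least hm hM hxM hmx (by simp [hI])
        · omega
      · simpa
      · simp
      · simp
    · intro h0
      rcases hR.summary hA with ⟨hs0, -⟩ | ⟨j, -, -, -, -, rfl, -⟩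
      · exact absurd hs0 h0
      have hK₂ := hK₁.setReg (d := 40) (by norm_num) (s.arr 0 (s.reg 31 + 2))
      obtain ⟨-, hRI⟩ := hR
      obtain ⟨f, F, hf, hF, ef, eF⟩ := hRI.1.ends.resolve_left fun h => h0 h.2.1
      rw [← hT]
      refine locTail_wp (m := m) (I := inner A) (hE.keeps hK₂ (by norm_num)) hiK (by simpa)
        (by simpa) (fun a ha => hA a ha.1) (by simpa) (by simp) (by simpa) hf (by simpa) hKZ ?_ ?_
      · rintro s₁ h1 h2 ⟨k1, k2, k3, k4⟩
        refine hdone s₁ m h2 (isGreatest_upTo_least hm hM hxM hmx (by simpa using h1))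
          ⟨hK₂.trans k1, k2, k3, fun a ha => (k4 a ha).trans (by simp)⟩
      · intro s₁ B k1 k2 k3 k4 k5 k6 k7 k8 k9 k10
        refine hgo s₁ j B rfl (hK₂.trans k1) k2 (k3.trans (by simp)) k4 k5 k6 k7 (by simpa using k8)
          (fun a ha => (k9 a ha).trans (by simp)) fun a ha => ?_
        obtain ⟨y, hy, hy'⟩ := k10 a ha
        exact ⟨y, isGreatest_upTo_inner hm hM hxM (by simpa using hy), hy'⟩
  · intro hMx
    refine hdone _ M ?_ (isGreatest_upTo_max hM hMx)
      (Found.here ((hK₁.setReg (by norm_num) _).setReg (by norm_num) _) ?_ ?_ ?_)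
    · simp
    · simpa
    · simp
    · simp

/-- The specification of the downward part of the search. -/
theorem loc_spec (W : ℕ) (D : Oracle) (Z K i : ℕ) (hKZ : 2 * K ≤ Z) :
    ∀ (s : Config) (A : Set ℕ), Env W Z K s → i ≤ K → s.reg 30 = i → s.reg 33 = 1 →
      s.reg 31 + U i * U i ≤ Z → (∀ a ∈ A, a < U i) → s.reg 32 < U i →
      (∃ a ∈ A, a ≤ s.reg 32) → Rep i (s.reg 31) A (s.arr 0) →
      Runs W D locLoop ((i + 1) * (locBody.cost + 3) + 3) s fun s' =>
        ∃ y, IsGreatest (upTo A (s.reg 32)) y ∧ Found Z i y s s' := by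
  induction i with
  | zero =>
    intro s A hE hi h30 h33 h31 hA h32 hx hR
    refine (Runs.while_step (t₂ := 3) (by simp) (by simp [h33]) (locBody.runs ?_)).mono
      (by simp only [Expr.cost]; omega) fun _ h => h
    exact locBody_wp hE hi h30 h31 hA h32 hx hR hKZ (fun s₁ y h1 h2 h3 => Runs.while_done
      (by simp) (by simpa using h1) ⟨y, h2, h3⟩) fun _ j _ h => by omega
  | succ i ih =>
    intro s A hE hi h30 h33 h31 hA h32 hx hR
    refine (Runs.while_step (t₂ := (i + 1) * (locBody.cost + 3) + 3) (by simp) (by simp [h33])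
      (locBody.runs ?_)).mono (by simp only [Expr.cost]; rw [Nat.succ_mul (i + 1)]; omega)
      fun _ h => h
    refine locBody_wp hE hi h30 h31 hA h32 hx hR hKZ (fun s₁ y h1 h2 h3 => (Runs.while_done
      (by simp) (by simpa using h1) ⟨y, h2, h3⟩).mono (by simp [Expr.cost]) fun _ h => h) ?_
    intro s₁ j B e k1 k2 k3 k4 k5 k6 k7 k8 k9 k10
    obtain rfl : i = j := by omega
    refine (ih s₁ B (hE.keeps k1 (by norm_num)) (by omega) k2 (k3.trans h33) k4 k5 k6 k7 ?_).mono
      le_rfl ?_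
    · rwa [k1.2.1 0 (by norm_num) (by norm_num)]
    · rintro s' ⟨a, ha, hf⟩
      obtain ⟨y, hy, hs⟩ := k10 a ha
      exact ⟨y, hy, hf.step k1 k9 hs⟩

/-- One level of the search, upwards. -/
def upBody : Blk :=
  .set 36 (ld 6 (.var 30)) ;; .set 40 (ld 7 (2 * .var 30)) ;;
  .ite (.var 40) (.set 39 ((.var 40 - 1) * .var 36 + .var 39))
    (.set 31 (ld 7 (2 * .var 30 + 1)) ;;
      .set 39 (.var 39 * .var 36 +
        (ld 0 (.var 31 + 2 + (.var 39 + 1) * .var 36 * .var 36 + 1) - 1))) ;;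
  .set 30 (.var 30 + 1)

/-- The search for the greatest element that is at most `x` in the set held by the node of level
`K` at address `0`, where register `7` holds `K`. -/
def locate : Cmd := .seq locLoop (.while (.lt (.var 30) (.var 7)) upBody.cmd)

theorem upBody_wp {W Z K k a y : ℕ} {s : Config} {Q : Config → Prop} (hE : Env W Z K s)
    (hk : k < K) (h30 : s.reg 30 = k) (h39 : s.reg 39 = a) (hS : Step Z s k a y)
    (hU : U K * U K ≤ Z) (hKZ : 2 * K ≤ Z)
    (hQ : ∀ s', Keeps 7 s s' → s'.arr 7 = s.arr 7 → s'.reg 30 = k + 1 → s'.reg 39 = y → Q s') :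
    upBody.wp W s Q := by
  have hW := hE.ne_zero
  have h1 := hE.fits
  have h2 := hE.table k (by omega)
  have h3 := two_le_U k
  have h9 := four_le_sq k
  have h4 := hE.level
  have hUK : U (k + 1) ≤ Z := by
    have : U (k + 1) ≤ U K :=
      Nat.pow_le_pow_right (by norm_num) (Nat.pow_le_pow_right (by norm_num) hk)
    exact (this.trans (Nat.le_mul_self _)).trans hU
  obtain ⟨ha, hy, hS⟩ := hS
  rcases hS with ⟨h, hh, e7, rfl⟩ | ⟨e7, hZ, l, el, rfl⟩
  · simp [upBody, Blk.wp, h30, h39, h2, e7, hW]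
    and_intros <;> try omega
    refine hQ _ ?_ ?_ ?_ ?_
    · exact ((((Keeps.refl 7 s).setReg (by norm_num) _).setReg (by norm_num) _).setReg
        (by norm_num) _).setReg (by norm_num) _
    · simp
    · simp
    · simp
  · have a2 := child_lt (o := s.arr 7 (2 * k + 1)) ha
    have a6 : (a + 1) * U k ≤ (a + 1) * U k * U k := Nat.le_mul_of_pos_right _ (by omega)
    have a7 : a + 1 ≤ (a + 1) * U k := Nat.le_mul_of_pos_right _ (by omega)
    rw [child] at *
    simp [upBody, Blk.wp, h30, h39, h2, e7, el, hW]
    and_intros <;> try omega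
    refine hQ _ ?_ ?_ ?_ ?_
    · exact (((((Keeps.refl 7 s).setReg (by norm_num) _).setReg (by norm_num) _).setReg
        (by norm_num) _).setReg (by norm_num) _).setReg (by norm_num) _
    · simp
    · simp
    · simp

/-- The time bound for the search in a tree with `K + 1` levels. -/
def locateTime (K : ℕ) : ℕ :=
  (K + 1) * (locBody.cost + 3) + 3 + (K * (upBody.cost + 5 + 1) + (5 + 1))

theorem locate_spec {W Z K : ℕ} (D : Oracle) {s : Config} {A : Set ℕ} (hE : Env W Z K s)
    (hU : U K * U K ≤ Z) (hKZ : 2 * K ≤ Z) (h7 : s.reg 7 = K) (h30 : s.reg 30 = K)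
    (h33 : s.reg 33 = 1) (h31 : s.reg 31 = 0) (hA : ∀ a ∈ A, a < U K)
    (h32 : s.reg 32 < U K) (hx : ∃ a ∈ A, a ≤ s.reg 32) (hR : Rep K 0 A (s.arr 0)) :
    Runs W D locate (locateTime K) s fun s' => Keeps 7 s s' ∧
      IsGreatest (upTo A (s.reg 32)) (s'.reg 39) := by
  refine Runs.seq ((loc_spec W D Z K K hKZ s A hE le_rfl h30 h33 (by omega) hA h32 hx
    (by rwa [h31])).mono le_rfl ?_)
  rintro s₁ ⟨y, hy, k, hj, ⟨z, hz, hzy, hstep⟩, -⟩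
  refine (Runs.while_count (t := upBody.cost) (K - s₁.reg 30) (fun t s' => Keeps 7 s s' ∧
    s'.arr 7 = s₁.arr 7 ∧ s'.reg 30 = s₁.reg 30 + t ∧ s'.reg 39 = z (s₁.reg 30 + t))
    ⟨k, rfl, rfl, hz.symm⟩ ?_ ?_).mono ?_ ?_
  · rintro t s' ht ⟨k', e7, e30, e39⟩
    refine ⟨by simp, ?_, ?_⟩
    · simp [k'.1 7 (by norm_num), h7, e30]
      omega
    · refine upBody.runs (upBody_wp (hE.keeps k' (by norm_num)) (k := s₁.reg 30 + t) (by omega)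
        e30 e39 (y := z (s₁.reg 30 + t + 1)) ?_ hU hKZ ?_)
      · have := hstep (s₁.reg 30 + t) (by omega) (by omega)
        unfold Step at this ⊢
        rwa [e7, k'.2.1 0 (by norm_num) (by norm_num), ← k.2.1 0 (by norm_num) (by norm_num)]
      · intro s'' k'' f7 f30 f39
        exact ⟨k'.trans k'', f7.trans e7, by omega, f39⟩
  · rintro s' ⟨k', e7, e30, e39⟩
    refine ⟨by simp, ?_⟩
    simp [k'.1 7 (by norm_num), h7, e30]
    omega
  · simp only [Expr.lt, Expr.cost]
    exact Nat.add_le_add_right (Nat.mul_le_mul_right _ (by omega)) _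
  · rintro s' ⟨k', e7, e30, e39⟩
    refine ⟨k', ?_⟩
    rwa [e39, Nat.add_sub_cancel' hj, hzy]

end VEB

/-! ### Chains in sequences of edges -/

namespace Chain

variable (col row : ℕ → ℕ)

/-- The length of a longest chain that ends with the edge number `e`, if the edges are the pairs
`(col e, row e)`, chains are strictly increasing in both components, and the members of a chain
have increasing numbers. -/
def depth (e : ℕ) : ℕ :=
  1 + (Finset.univ : Finset (Fin e)).sup fun f =>
    if col f < col e ∧ row f < row e then depth f else 0
termination_by e
decreasing_by exact f.2

variable {col row}

theorem depth_pos (e : ℕ) : 1 ≤ depth col row e := by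
  rw [depth]
  omega

theorem depth_lt {e f : ℕ} (h : f < e) (hc : col f < col e) (hr : row f < row e) :
    depth col row f < depth col row e := by
  rw [depth.eq_def col row e]
  have := Finset.le_sup (f := fun f : Fin e =>
    if col f < col e ∧ row f < row e then depth col row f else 0) (Finset.mem_univ ⟨f, h⟩)
  simp only [hc, hr, and_self, if_true] at this
  omega

theorem exists_pred {e : ℕ} (h : 2 ≤ depth col row e) :
    ∃ f < e, col f < col e ∧ row f < row e ∧ depth col row f + 1 = depth col row e := by
  have hd := depth.eq_def col row e
  rcases Nat.eq_zero_or_pos e with rfl | he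
  · simp at hd
    omega
  · have : Nonempty (Fin e) := ⟨⟨0, he⟩⟩
    obtain ⟨f, -, hf⟩ := Finset.exists_mem_eq_sup (Finset.univ : Finset (Fin e))
      Finset.univ_nonempty fun f =>
        if col f < col e ∧ row f < row e then depth col row f else 0
    rw [hf] at hd
    split at hd
    · exact ⟨f, f.2, by tauto, by tauto, by omega⟩
    · omega

theorem exists_of_lt {e k : ℕ} (hk : 1 ≤ k) (h : k < depth col row e) :
    ∃ f < e, col f < col e ∧ row f < row e ∧ depth col row f = k := by
  induction e using Nat.strong_induction_on with
  | _ e ih =>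
    obtain ⟨f, hf, hc, hr, hd⟩ := exists_pred (col := col) (row := row) (e := e) (by omega)
    by_cases hk' : k = depth col row f
    · exact ⟨f, hf, hc, hr, hk'.symm⟩
    · obtain ⟨g, hg, hc', hr', hd'⟩ := ih f hf (by omega)
      exact ⟨g, by omega, by omega, by omega, hd'⟩

theorem depth_le_col (e : ℕ) : depth col row e ≤ col e + 1 := by
  induction e using Nat.strong_induction_on with
  | _ e ih =>
    by_cases h : 2 ≤ depth col row e
    · obtain ⟨f, hf, hc, -, hd⟩ := exists_pred h
      have := ih f hf
      omega
    · omega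

theorem depth_le (e : ℕ) : depth col row e ≤ e + 1 := by
  induction e using Nat.strong_induction_on with
  | _ e ih =>
    by_cases h : 2 ≤ depth col row e
    · obtain ⟨f, hf, -, -, hd⟩ := exists_pred h
      have := ih f hf
      omega
    · omega

/-- If the edges are sorted by their second components, then a non-crossing matching that ends
with the edge number `e` is not longer than `depth e`. -/
theorem length_le_depth {r : ℕ} (hrow : ∀ e f, e ≤ f → f < r → row e ≤ row f)
    (l : List (ℕ × ℕ)) (x : ℕ × ℕ)
    (h : IsNonCrossingMatching {x | ∃ e < r, x = (col e, row e)} (l ++ [x])) :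
    ∃ e < r, x = (col e, row e) ∧ l.length + 1 ≤ depth col row e := by
  induction l using List.reverseRecOn generalizing x with
  | nil =>
    obtain ⟨e, he, hx⟩ := h.2 x (by simp)
    exact ⟨e, he, hx, by simpa using depth_pos e⟩
  | append_singleton l y ih =>
    obtain ⟨hp, hE⟩ := h
    obtain ⟨e, he, hx⟩ := hE x (by simp)
    rw [List.pairwise_append] at hp
    obtain ⟨f, hf, hy, hd⟩ := ih y ⟨hp.1, fun z hz => hE z (List.mem_append_left _ hz)⟩
    have hlt := hp.2.2 y (by simp) x (by simp)
    refine ⟨e, he, hx, ?_⟩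
    subst hx hy
    have hfe : f < e := by
      by_contra hle
      have := hrow e f (by omega) hf
      simp only at hlt
      omega
    have := depth_lt hfe hlt.1 hlt.2
    simp only [List.length_append, List.length_singleton]
    omega

theorem length_le {r m : ℕ} (hrow : ∀ e f, e ≤ f → f < r → row e ≤ row f)
    (hm : ∀ e < r, depth col row e ≤ m) (l : List (ℕ × ℕ))
    (h : IsNonCrossingMatching {x | ∃ e < r, x = (col e, row e)} l) : l.length ≤ m := by
  rcases List.eq_nil_or_concat l with rfl | ⟨l, x, rfl⟩
  · simp
  · rw [List.concat_eq_append] at h ⊢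
    obtain ⟨e, he, -, hd⟩ := length_le_depth hrow l x h
    have := hm e he
    simp only [List.length_append, List.length_singleton]
    omega

/-- What is known about the thresholds of the first `b` edges: `m` is the greatest depth, `top k`
is an edge of depth `k` with the least first component, and `thr k` is this component plus one,
while `thr 0 = 0`. -/
structure Thresholds (col row : ℕ → ℕ) (b m : ℕ) (thr top : ℕ → ℕ) : Prop where
  zero : thr 0 = 0
  le : ∀ e < b, depth col row e ≤ m ∧ thr (depth col row e) ≤ col e + 1
  top : ∀ k, 1 ≤ k → k ≤ m → top k < b ∧ depth col row (top k) = k ∧ thr k = col (top k) + 1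

namespace Thresholds

variable {b m : ℕ} {thr top : ℕ → ℕ}

theorem lt (h : Thresholds col row b m thr top) {j k : ℕ} (hjk : j < k) (hk : k ≤ m) :
    thr j < thr k := by
  obtain ⟨h1, h2, h3⟩ := h.top k (by omega) hk
  rcases Nat.eq_zero_or_pos j with rfl | hj
  · rw [h.zero]
    omega
  · obtain ⟨f, hf, hc, -, hd⟩ := exists_of_lt (col := col) (row := row) hj (h2.symm ▸ hjk)
    have := (h.le f (by omega)).2
    rw [hd] at this
    omega

/-- The set of thresholds. -/
def values (thr : ℕ → ℕ) (m : ℕ) : Set ℕ := {x | ∃ k ≤ m, thr k = x}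

/-- If no edge of the row of edge `a` has changed the thresholds yet, then `a` extends the chains of
depth `j`, where `thr j` is the greatest threshold that is at most `col a`. -/
theorem depth_eq (h : Thresholds col row b m thr top) {a j : ℕ} (hba : b ≤ a)
    (hab : ∀ e, b ≤ e → e ≤ a → row e = row b) (hfresh : ∀ f < b, row f < row b) (hj : j ≤ m)
    (hgr : IsGreatest {x | x ∈ values thr m ∧ x ≤ col a} (thr j)) :
    depth col row a = j + 1 ∧ (1 ≤ j → top j < a ∧ col (top j) < col a ∧ row (top j) < row a ∧
      depth col row (top j) + 1 = depth col row a) := by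
  have hra := hab a hba le_rfl
  have htop : 1 ≤ j → top j < a ∧ col (top j) < col a ∧ row (top j) < row a ∧
      depth col row (top j) = j := by
    intro hj1
    obtain ⟨h1, h2, h3⟩ := h.top j hj1 hj
    have h4 := hgr.1.2
    have := hfresh _ h1
    exact ⟨by omega, by omega, by omega, h2⟩
  have hd : depth col row a = j + 1 := by
    apply le_antisymm
    · by_contra hlt
      obtain ⟨f, hf, hc, hr, hd⟩ := exists_of_lt (col := col) (row := row) (e := a) (k := j + 1)
        (by omega) (by omega)
      have hfb : f < b := by
        by_contra hbf
        have := hab f (by omega) (by omega)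
        omega
      have h1 := h.le f hfb
      rw [hd] at h1
      have h2 := hgr.2 ⟨⟨j + 1, h1.1, rfl⟩, by omega⟩
      have h3 := h.lt (show j < j + 1 by omega) h1.1
      omega
    · rcases Nat.eq_zero_or_pos j with rfl | hj1
      · exact depth_pos a
      · obtain ⟨h1, h2, h3, h4⟩ := htop hj1
        have := depth_lt h1 h2 h3
        omega
  refine ⟨hd, fun hj1 => ?_⟩
  obtain ⟨h1, h2, h3, h4⟩ := htop hj1
  exact ⟨h1, h2, h3, by omega⟩

/-- The next edge has at most the first new depth, since chains of each smaller depth end before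
it. -/
theorem depth_le_succ (h : Thresholds col row b m thr top) : depth col row b ≤ m + 1 := by
  by_contra hlt
  obtain ⟨f, hf, -, -, hd⟩ := exists_of_lt (col := col) (row := row) (e := b) (k := m + 1)
    (by omega) (by omega)
  have := (h.le f hf).1
  omega

theorem lt_of_lt_depth (h : Thresholds col row b m thr top) {j : ℕ}
    (hj : j < depth col row b) : thr j < col b + 1 := by
  rcases Nat.eq_zero_or_pos j with rfl | hj1
  · rw [h.zero]
    omega
  · obtain ⟨f, hf, hc, -, hd⟩ := exists_of_lt (col := col) (row := row) hj1 hj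
    have := (h.le f hf).2
    rw [hd] at this
    omega

/-- The next edge does not change the thresholds. -/
theorem keep (h : Thresholds col row b m thr top) (hm : depth col row b ≤ m)
    (hc : thr (depth col row b) ≤ col b + 1) : Thresholds col row (b + 1) m thr top := by
  refine ⟨h.zero, fun e he => ?_, fun k hk hkm => ?_⟩
  · rcases Nat.lt_succ_iff_lt_or_eq.1 he with he | rfl
    · exact h.le e he
    · exact ⟨hm, hc⟩
  · obtain ⟨h1, h2, h3⟩ := h.top k hk hkm
    exact ⟨by omega, h2, h3⟩

/-- The next edge improves a threshold or adds a new one. -/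
theorem update (h : Thresholds col row b m thr top)
    (hc : depth col row b ≤ m → col b + 1 < thr (depth col row b)) :
    Thresholds col row (b + 1) (max m (depth col row b))
      (Function.update thr (depth col row b) (col b + 1))
      (Function.update top (depth col row b) b) := by
  have hpos := depth_pos (col := col) (row := row) b
  have hsucc := h.depth_le_succ
  refine ⟨?_, fun e he => ?_, fun k hk hkm => ?_⟩
  · rw [Function.update_of_ne (by omega)]
    exact h.zero
  · rcases Nat.lt_succ_iff_lt_or_eq.1 he with he | rfl
    · obtain ⟨h1, h2⟩ := h.le e he
      refine ⟨by omega, ?_⟩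
      by_cases hd : depth col row e = depth col row b
      · rw [hd, Function.update_self]
        have := hc (by omega)
        rw [hd] at h2
        omega
      · rwa [Function.update_of_ne hd]
    · exact ⟨le_max_right _ _, by rw [Function.update_self]⟩
  · by_cases hd : k = depth col row b
    · rw [hd, Function.update_self, Function.update_self]
      exact ⟨by omega, rfl, rfl⟩
    · rw [Function.update_of_ne hd, Function.update_of_ne hd]
      obtain ⟨h1, h2, h3⟩ := h.top k hk (by omega)
      exact ⟨by omega, h2, h3⟩

/-- A threshold that the next edge improves or adds is new. -/
theorem notMem_values (h : Thresholds col row b m thr top)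
    (hc : depth col row b ≤ m → col b + 1 < thr (depth col row b)) :
    col b + 1 ∉ values thr m := by
  rintro ⟨k, hk, e⟩
  rcases lt_trichotomy k (depth col row b) with hlt | rfl | hlt
  · have := h.lt_of_lt_depth hlt
    omega
  · have := hc hk
    omega
  · have := h.lt hlt hk
    have := hc (by omega)
    omega

theorem values_update_new (h : Thresholds col row b m thr top) (hm : m < depth col row b) :
    values (Function.update thr (depth col row b) (col b + 1)) (max m (depth col row b)) =
      insert (col b + 1) (values thr m) := by
  have hsucc := h.depth_le_succ
  ext x
  constructor
  · rintro ⟨k, hk, rfl⟩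
    by_cases hd : k = depth col row b
    · rw [hd, Function.update_self]
      exact Or.inl rfl
    · rw [Function.update_of_ne hd]
      exact Or.inr ⟨k, by omega, rfl⟩
  · rintro (rfl | ⟨k, hk, rfl⟩)
    · exact ⟨_, le_max_right _ _, by rw [Function.update_self]⟩
    · exact ⟨k, by omega, by rw [Function.update_of_ne (by omega)]⟩

theorem values_update_old (h : Thresholds col row b m thr top) (hm : depth col row b ≤ m) :
    values (Function.update thr (depth col row b) (col b + 1)) (max m (depth col row b)) =
      insert (col b + 1) (values thr m \ {thr (depth col row b)}) := by
  ext x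
  constructor
  · rintro ⟨k, hk, rfl⟩
    by_cases hd : k = depth col row b
    · rw [hd, Function.update_self]
      exact Or.inl rfl
    · rw [Function.update_of_ne hd]
      refine Or.inr ⟨⟨k, by omega, rfl⟩, fun e => hd ?_⟩
      have e : thr k = thr (depth col row b) := e
      rcases lt_trichotomy k (depth col row b) with hlt | he | hlt
      · have := h.lt hlt hm
        omega
      · exact he
      · have := h.lt hlt (by omega)
        omega
  · rintro (rfl | ⟨⟨k, hk, rfl⟩, hne⟩)
    · exact ⟨_, le_max_right _ _, by rw [Function.update_self]⟩
    · refine ⟨k, by omega, ?_⟩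
      rw [Function.update_of_ne]
      rintro rfl
      exact hne rfl

end Thresholds

end Chain

/-! ### Depths and thresholds of a list of edges -/

namespace Matching

open VEB Chain Chain.Thresholds

/-- The state of the computation after the depths of the edges below `a` have been determined and
the thresholds have been updated by the edges below `b`. Registers: `0` address of the list of
edges, `1` its length `r`, `7` level `K` of the tree, `8` and `9` the numbers `b` and `a`, `10` the
greatest depth, `20` address of the arrays. Arrays: `0` the tree, `1` the depths, `2` the
predecessors in longest chains, `3` the thresholds, `4` edges that attain them, `5` the depth
that belongs to a threshold, `6` the sizes of the universes, `7` the records of a search. By `same`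
and `fresh`, the edges from `b` to `a - 1` have equal second components, and if the edge number `a`
has it, too, then no edge with this second component has changed the thresholds yet. -/
structure Inv (W Z K r P : ℕ) (col row : ℕ → ℕ) (b a : ℕ) (s : Config) : Prop where
  env : Env W Z K s
  r0 : s.reg 0 = P
  r1 : s.reg 1 = r
  r7 : s.reg 7 = K
  r8 : s.reg 8 = b
  r9 : s.reg 9 = a
  r20 : s.reg 20 = P + 2 * r
  mem : ∀ e < r, s.mem (P + 2 * e) = col e ∧ s.mem (P + 2 * e + 1) = row e
  ba : b ≤ a
  ar : a ≤ r
  same : ∀ e, b ≤ e → e < a → row e = row b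
  fresh : a < r → row a = row b → ∀ f < b, row f < row b
  len : ∀ e < a, s.arr 1 e = depth col row e
  link : ∀ e < a, 2 ≤ depth col row e → s.arr 2 e < e ∧ col (s.arr 2 e) < col e ∧
    row (s.arr 2 e) < row e ∧ depth col row (s.arr 2 e) + 1 = depth col row e
  thr : Thresholds col row b (s.reg 10) (s.arr 3) (s.arr 4)
  rank : ∀ k ≤ s.reg 10, s.arr 5 (s.arr 3 k) = k
  rep : Rep K 0 (values (s.arr 3) (s.reg 10)) (s.arr 0)

/-- The bounds for the input. -/
structure Bounds (Z K r : ℕ) (col row : ℕ → ℕ) : Prop where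
  tree : U K * U K ≤ Z
  level : 2 * K ≤ Z
  edges : r + 2 ≤ Z
  col : ∀ e < r, col e + 1 < U K
  row : ∀ e f, e ≤ f → f < r → row e ≤ row f

/-- Prepare an operation on the tree with the value of `e`. -/
def enter (e : Expr) : Blk := .set 32 e ;; .set 30 (.var 7) ;; .set 31 0 ;; .set 33 1

/-- The configuration in which an operation on the tree with `x` starts. -/
def entered (s : Config) (x : ℕ) : Config :=
  (((s.setReg 32 x).setReg 30 (s.reg 7)).setReg 31 0).setReg 33 1

theorem keeps_entered (s : Config) (x j : ℕ) : Keeps j s (entered s x) :=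
  ((((Keeps.refl j s).setReg (by norm_num) _).setReg (by norm_num) _).setReg (by norm_num)
    _).setReg (by norm_num) _

@[simp] theorem entered_arr (s : Config) (x j : ℕ) : (entered s x).arr j = s.arr j := by
  simp [entered]

/-- Determine the depth of the edge number `a`. -/
def search : Cmd :=
  .seq (enter (.get (.var 0 + 2 * .var 9))).cmd (.seq locate
    (.set 11 (ld 5 (.var 39)) ;; .set 12 (ld 4 (.var 11)) ;; st 1 (.var 9) (.var 11 + 1) ;;
      st 2 (.var 9) (.var 12) ;; .set 9 (.var 9 + 1) : Blk).cmd)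

/-- The threshold for the depth in register `12` receives the value of register `13`, and the
edge number `b` attains it. -/
def record : Cmd :=
  .seq (enter (.var 13)).cmd (.seq insLoop
    (st 3 (.var 12) (.var 13) ;; st 5 (.var 13) (.var 12) ;; st 4 (.var 12) (.var 8) : Blk).cmd)

/-- Update the thresholds by the edge number `b`. -/
def update : Cmd :=
  .seq (.set 12 (ld 1 (.var 8)) ;; .set 13 (.get (.var 0 + 2 * .var 8) + 1) : Blk).cmd
    (.seq
      (.test (.lt (.var 10) (.var 12)) (.seq (Blk.set 10 (.var 12)).cmd record)
        (.test (.lt (.var 13) (ld 3 (.var 12)))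
          (.seq (enter (ld 3 (.var 12))).cmd (.seq delLoop record)) Blk.skip.cmd))
      (Blk.set 8 (.var 8 + 1)).cmd)

/-- The time bound for `search`. -/
def searchTime (K : ℕ) : ℕ := 100 + locateTime K

/-- The time bound for `record`. -/
def recordTime (K : ℕ) : ℕ := 100 + ((K + 1) * (insBody.cost + 3) + 3)

/-- The time bound for `update`. -/
def updateTime (K : ℕ) : ℕ := 200 + recordTime K + ((K + 1) * (delBody.cost + 3) + 3)

variable {W Z K r P b a : ℕ} {D : Oracle} {col row : ℕ → ℕ} {s : Config}

theorem Inv.values_lt (h : Inv W Z K r P col row b a s) (hB : Bounds Z K r col row) :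
    ∀ x ∈ values (s.arr 3) (s.reg 10), x < U K := by
  rintro x ⟨k, hk, rfl⟩
  rcases Nat.eq_zero_or_pos k with rfl | hk0
  · rw [h.thr.zero]
    have := two_le_U K
    omega
  · obtain ⟨h1, h2, h3⟩ := h.thr.top k hk0 hk
    have := hB.col (s.arr 4 k) (by have := h.ba; have := h.ar; omega)
    omega

theorem enter_wp {e : Expr} {x : ℕ} {Q : Config → Prop} (hW : W ≠ 0) (he : e.ok W s)
    (hx : e.val s = x) (hQ : Q (entered s x)) : (enter e).wp W s Q := by
  refine ⟨he, ?_⟩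
  rw [hx]
  simp [Blk.wp, hW]
  exact hQ

theorem search_spec (h : Inv W Z K r P col row b a s) (hB : Bounds Z K r col row)
    (har : a < r) (hrow : row a = row b) :
    Runs W D search (searchTime K) s (Inv W Z K r P col row b (a + 1)) := by
  have hW := h.env.ne_zero
  have h1 := h.env.fits
  have h2 := h.r20
  have h3 := h.ba
  have h4 := hB.edges
  have hm := (h.mem a har).1
  have hc := hB.col a har
  refine Runs.mono (Runs.seq (Blk.runs _ (enter_wp (x := col a) hW ?_ ?_ (Runs.seq
    (Runs.mono (locate_spec D (h.env.keeps (keeps_entered s _ 7) (by norm_num)) hB.tree hB.level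
      ?_ ?_ ?_ ?_ (h.values_lt hB) ?_ ?_ ?_) le_rfl
      fun s₁ h₁ => Blk.runs _ ?_))))) ?_ fun _ h => h
  · simp [h.r0, h.r9]
    omega
  · simp [h.r0, h.r9, hm]
  · simp [entered, h.r7]
  · simp [entered, h.r7]
  · simp [entered]
  · simp [entered]
  · simp [entered]
    omega
  · exact ⟨0, ⟨0, by omega, h.thr.zero⟩, by omega⟩
  · simpa using h.rep
  · obtain ⟨k, hgr⟩ := h₁
    replace k := (keeps_entered s (col a) 7).trans k
    obtain ⟨j, hj, hjy⟩ := hgr.1.1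
    have e32 : (entered s (col a)).reg 32 = col a := by simp [entered]
    rw [e32, ← hjy] at hgr
    obtain ⟨hd, hl⟩ := h.thr.depth_eq h.ba (fun e h1 h2 => by
      rcases h2.lt_or_eq with h2 | rfl
      · exact h.same e h1 h2
      · exact hrow) (h.fresh har hrow) hj hgr
    have hrk := h.rank j hj
    have e4 : s₁.arr 4 = s.arr 4 := k.2.1 4 (by norm_num) (by norm_num)
    have e5 : s₁.arr 5 = s.arr 5 := k.2.1 5 (by norm_num) (by norm_num)
    have e9 : s₁.reg 9 = a := (k.1 9 (by norm_num)).trans h.r9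
    have e20 : s₁.reg 20 = s.reg 20 := k.1 20 (by norm_num)
    have hjd := depth_le (col := col) (row := row) a
    have hcj := hgr.1.2
    have hUZ := (Nat.le_mul_self (U K)).trans hB.tree
    simp [Blk.wp, e4, e5, e9, ← hjy, hrk, hW, e20]
    and_intros <;> try omega
    have harr : ∀ i < 8, i ≠ 7 → s₁.arr i = s.arr i := k.2.1
    constructor
    case env => exact ⟨by simpa [e20] using h1, by simpa [harr] using h.env.table, h.env.level⟩
    case r0 => simpa [k.1 0] using h.r0
    case r1 => simpa [k.1 1] using h.r1
    case r7 => simpa [k.1 7] using h.r7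
    case r8 => simpa [k.1 8] using h.r8
    case r9 => simp
    case r20 => simpa [k.1 20] using h.r20
    case mem =>
      intro e he
      have l1 : P + 2 * e < P + 2 * r := by omega
      have l2 : P + 2 * e + 1 < P + 2 * r := by omega
      have m1 := k.2.2 (P + 2 * e) (by omega)
      have m2 := k.2.2 (P + 2 * e + 1) (by omega)
      simpa [e20, h2, l1, l2, m1, m2] using h.mem e he
    case ba => omega
    case ar => omega
    case same =>
      intro e h1 h2
      rcases Nat.lt_succ_iff_lt_or_eq.1 h2 with h2 | rfl
      · exact h.same e h1 h2
      · exact hrow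
    case fresh => exact fun _ _ => h.fresh har hrow
    case len =>
      intro e he
      rcases Nat.lt_succ_iff_lt_or_eq.1 he with he | rfl
      · simpa [harr, show e ≠ a by omega] using h.len e he
      · simp [hd]
    case link =>
      intro e he
      rcases Nat.lt_succ_iff_lt_or_eq.1 he with he | rfl
      · simpa [harr, show e ≠ a by omega] using h.link e he
      · simpa [hd] using hl
    case thr => simpa [k.1 10, harr] using h.thr
    case rank => simpa [k.1 10, harr] using h.rank
    case rep => simpa [k.1 10, harr] using h.rep
  · simp [searchTime, enter, Blk.cost, Expr.cost, ld, st, cell]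
    omega

/-- `s'` arises from `s` by recording the edge number `s.reg 8`, with the value `s.reg 13`, for the
depth `s.reg 12`, where the tree contains `A` in `s`. -/
structure Recorded (W Z K : ℕ) (A : Set ℕ) (s s' : Config) : Prop where
  env : Env W Z K s'
  regs : ∀ x < 30, s'.reg x = s.reg x
  rep : Rep K 0 (insert (s.reg 13) A) (s'.arr 0)
  arr1 : s'.arr 1 = s.arr 1
  arr2 : s'.arr 2 = s.arr 2
  arr3 : s'.arr 3 = Function.update (s.arr 3) (s.reg 12) (s.reg 13)
  arr4 : s'.arr 4 = Function.update (s.arr 4) (s.reg 12) (s.reg 8)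
  arr5 : s'.arr 5 = Function.update (s.arr 5) (s.reg 13) (s.reg 12)
  mem : ∀ a < s.reg 20, s'.mem a = s.mem a

theorem record_spec {A : Set ℕ} (hE : Env W Z K s) (hZ : U K * U K ≤ Z) (h7 : s.reg 7 = K)
    (h12 : s.reg 12 ≤ Z) (h13 : s.reg 13 < U K) (hA : ∀ a ∈ A, a < U K) (hp : s.reg 13 ∉ A)
    (hR : Rep K 0 A (s.arr 0)) :
    Runs W D record (recordTime K) s (Recorded W Z K A s) := by
  have hW := hE.ne_zero
  have h1 := hE.fits
  have hUZ := (Nat.le_mul_self (U K)).trans hZ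
  have hk₀ := keeps_entered s (s.reg 13) 0
  refine Runs.mono (Runs.seq (Blk.runs _ (enter_wp (x := s.reg 13) hW ?_ rfl (Runs.seq
    (Runs.mono (ins_spec W D Z K K (entered s (s.reg 13)) A (hE.keeps hk₀ (by norm_num)) le_rfl
      ?_ ?_ ?_ hA ?_ ?_ ?_) le_rfl
      fun s₁ h₁ => Blk.runs _ ?_))))) ?_ fun _ h => h
  · simp
  · simp [entered, h7]
  · simp [entered]
  · simpa [entered] using hZ
  · simpa [entered] using h13
  · simpa [entered] using hp
  · simpa [entered] using hR
  · obtain ⟨k, hr, -⟩ := h₁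
    simp only [entered, Config.setReg_reg] at hr
    replace k := hk₀.trans k
    have e20 : s₁.reg 20 = s.reg 20 := k.1 20 (by norm_num)
    have harr : ∀ i < 8, i ≠ 0 → s₁.arr i = s.arr i := k.2.1
    simp [Blk.wp, k.1 12, k.1 13, k.1 8, e20]
    and_intros <;> try omega
    constructor
    case env => exact ⟨by simpa [e20] using h1, by simpa [harr] using hE.table, hE.level⟩
    case regs => simpa using k.1
    case rep => simpa using hr
    case mem =>
      intro a ha
      simp [e20, ha, k.2.2 a ha]
    all_goals simp [harr]
  · simp [recordTime, enter, Blk.cost, Expr.cost, st, cell]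
    omega

/-- The thresholds in `s'` are those for one more edge than in `s`. -/
structure Updated (W Z K : ℕ) (col row : ℕ → ℕ) (b : ℕ) (s s' : Config) : Prop where
  env : Env W Z K s'
  regs : ∀ x < 30, x ≠ 10 → x ≠ 12 → x ≠ 13 → s'.reg x = s.reg x
  mem : ∀ a < s.reg 20, s'.mem a = s.mem a
  arr1 : s'.arr 1 = s.arr 1
  arr2 : s'.arr 2 = s.arr 2
  thr : Thresholds col row (b + 1) (s'.reg 10) (s'.arr 3) (s'.arr 4)
  rank : ∀ k ≤ s'.reg 10, s'.arr 5 (s'.arr 3 k) = k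
  rep : Rep K 0 (values (s'.arr 3) (s'.reg 10)) (s'.arr 0)

theorem Inv.succ (h : Inv W Z K r P col row b a s) (hB : Bounds Z K r col row) (hba : b < a)
    (hend : a < r → row a ≠ row b) {s' : Config} (hs : Updated W Z K col row b s s') :
    Inv W Z K r P col row (b + 1) a (s'.setReg 8 (b + 1)) := by
  have hr20 := h.r20
  have har := h.ar
  have hregs := hs.regs
  constructor
  case env => exact ⟨by simpa using hs.env.fits, by simpa using hs.env.table, hs.env.level⟩
  case r0 => simpa [hregs 0] using h.r0
  case r1 => simpa [hregs 1] using h.r1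
  case r7 => simpa [hregs 7] using h.r7
  case r8 => simp
  case r9 => simpa [hregs 9] using h.r9
  case r20 => simpa [hregs 20] using h.r20
  case mem =>
    intro e he
    rw [Config.setReg_mem, hs.mem _ (by omega), hs.mem _ (by omega)]
    exact h.mem e he
  case ba => omega
  case ar => exact har
  case same =>
    intro e he hea
    rw [h.same e (by omega) hea, h.same (b + 1) (by omega) (by omega)]
  case fresh =>
    intro har' hrow f hf
    have := hend har'
    have := hB.row b a h.ba har'
    have := hB.row f b (by omega) (by omega)
    omega
  case len => simpa [hs.arr1] using h.len
  case link => simpa [hs.arr2] using h.link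
  case thr => simpa using hs.thr
  case rank => simpa using hs.rank
  case rep => simpa using hs.rep

/-- The edge number `b` is recorded for its depth `d`; `s₁` is the configuration before, in which
the tree contains `A`. -/
theorem Inv.updated (h : Inv W Z K r P col row b a s) {s₁ s' : Config} {A : Set ℕ}
    (hc : depth col row b ≤ s.reg 10 → col b + 1 < s.arr 3 (depth col row b))
    (h12 : s₁.reg 12 = depth col row b) (h13 : s₁.reg 13 = col b + 1)
    (h10 : s₁.reg 10 = max (s.reg 10) (depth col row b))
    (hregs : ∀ x < 30, x ≠ 10 → x ≠ 12 → x ≠ 13 → s₁.reg x = s.reg x)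
    (hmem : ∀ a < s.reg 20, s₁.mem a = s.mem a)
    (harr : ∀ i < 8, i ≠ 0 → s₁.arr i = s.arr i)
    (hA : values (Function.update (s.arr 3) (depth col row b) (col b + 1))
      (max (s.reg 10) (depth col row b)) = insert (col b + 1) A)
    (hs : Recorded W Z K A s₁ s') : Updated W Z K col row b s s' := by
  have h8 := h.r8
  have e3 : s'.arr 3 = Function.update (s.arr 3) (depth col row b) (col b + 1) := by
    rw [hs.arr3, h12, h13, harr 3 (by norm_num) (by norm_num)]
  have e4 : s'.arr 4 = Function.update (s.arr 4) (depth col row b) b := by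
    rw [hs.arr4, h12, harr 4 (by norm_num) (by norm_num),
      hregs 8 (by norm_num) (by norm_num) (by norm_num) (by norm_num), h8]
  have e10 : s'.reg 10 = max (s.reg 10) (depth col row b) := by
    rw [hs.regs 10 (by norm_num), h10]
  constructor
  case env => exact hs.env
  case regs => exact fun x hx h10 h12 h13 => (hs.regs x hx).trans (hregs x hx h10 h12 h13)
  case mem =>
    intro x hx
    rw [hs.mem x (by rwa [hregs 20 (by norm_num) (by norm_num) (by norm_num) (by norm_num)]),
      hmem x hx]
  case arr1 => rw [hs.arr1, harr 1 (by norm_num) (by norm_num)]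
  case arr2 => rw [hs.arr2, harr 2 (by norm_num) (by norm_num)]
  case thr =>
    rw [e3, e4, e10]
    exact h.thr.update hc
  case rank =>
    rw [e3, e10, hs.arr5, h12, h13, harr 5 (by norm_num) (by norm_num)]
    intro k hk
    have hsucc := h.thr.depth_le_succ
    by_cases hd : k = depth col row b
    · rw [hd, Function.update_self, Function.update_self]
    · rw [Function.update_of_ne hd, Function.update_of_ne, h.rank k (by omega)]
      intro e
      exact h.thr.notMem_values hc ⟨k, by omega, e⟩
  case rep =>
    rw [e3, e10, hA, ← h13]
    exact hs.rep

theorem update_spec (h : Inv W Z K r P col row b a s) (hB : Bounds Z K r col row) (hba : b < a)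
    (hend : a < r → row a ≠ row b) :
    Runs W D update (updateTime K) s (Inv W Z K r P col row (b + 1) a) := by
  have hW := h.env.ne_zero
  have h1 := h.env.fits
  have h2 := h.r20
  have h3 := h.ar
  have h4 := hB.edges
  have hm := (h.mem b (by omega)).1
  have hcol := hB.col b (by omega)
  have hlen := h.len b hba
  have hd := depth_le (col := col) (row := row) b
  have hd1 := depth_pos (col := col) (row := row) b
  have hds := h.thr.depth_le_succ
  have hUZ := (Nat.le_mul_self (U K)).trans hB.tree
  set s₀ := (s.setReg 12 (depth col row b)).setReg 13 (col b + 1) with hs₀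
  have harr : ∀ i, s₀.arr i = s.arr i := by simp [hs₀]
  have hregs : ∀ x < 30, x ≠ 10 → x ≠ 12 → x ≠ 13 → s₀.reg x = s.reg x := by
    intro x _ _ h12 h13
    simp [hs₀, h12, h13]
  have hmem : s₀.mem = s.mem := rfl
  have hE₀ : Env W Z K s₀ :=
    ⟨by simpa [hs₀] using h1, by simpa [hs₀] using h.env.table, h.env.level⟩
  have r12 : s₀.reg 12 = depth col row b := by simp [hs₀]
  have r13 : s₀.reg 13 = col b + 1 := by simp [hs₀]
  have r10 : s₀.reg 10 = s.reg 10 := by simp [hs₀]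
  have r7 : s₀.reg 7 = K := by simp [hs₀, h.r7]
  have r20 : s₀.reg 20 = s.reg 20 := by simp [hs₀]
  have r8 : s₀.reg 8 = b := by simp [hs₀, h.r8]
  have htest : Runs W D (.test (.lt (.var 10) (.var 12)) (.seq (Blk.set 10 (.var 12)).cmd record)
        (.test (.lt (.var 13) (ld 3 (.var 12)))
          (.seq (enter (ld 3 (.var 12))).cmd (.seq delLoop record)) Blk.skip.cmd))
      (100 + (recordTime K + ((K + 1) * (delBody.cost + 3) + 3))) s₀
      (Updated W Z K col row b s) := by
    clear_value s₀
    refine Runs.mono (Runs.test (by simp) (t := 60 + (recordTime K +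
      ((K + 1) * (delBody.cost + 3) + 3))) (fun hlt => ?_) fun hge => ?_) ?_ fun _ h => h
    · simp [r10, r12] at hlt
      have hc : depth col row b ≤ s.reg 10 → col b + 1 < s.arr 3 (depth col row b) := by omega
      have hnot := h.thr.notMem_values hc
      have hE₁ : Env W Z K (s₀.setReg 10 (depth col row b)) :=
        ⟨by simpa using hE₀.fits, by simpa using hE₀.table, hE₀.level⟩
      refine Runs.mono (Runs.seq (t₂ := recordTime K) (Blk.runs (.set 10 (.var 12))
        ⟨by simp, ?_⟩)) ?_ fun _ h => h
      · simp only [Expr.val_var, r12]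
        refine Runs.mono (record_spec hE₁ hB.tree (by simpa using r7) (by simp [r12]; omega)
          (by simpa [r13] using hcol) (h.values_lt hB) (by simpa [r13] using hnot)
          (by simpa [harr] using h.rep)) le_rfl fun s' hs' =>
          h.updated hc (by simpa using r12) (by simpa using r13) (by simp; omega)
            ?_ (by simp [hmem]) (by simp [harr]) (h.thr.values_update_new hlt) hs'
        intro x hx h10 h12 h13
        simp [h10, hregs x hx h10 h12 h13]
      · simp [Blk.cost, Expr.cost]
        omega
    · simp [r10, r12] at hge
      have hE1 := hE₀.fits
      refine Runs.mono (Runs.test (t := 30 + (recordTime K +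
        ((K + 1) * (delBody.cost + 3) + 3))) ?_ (fun hlt => ?_) fun hle => ?_) ?_ fun _ h => h
      · simp [r12]
        omega
      · simp [r13, r12, harr] at hlt
        have hin : s.arr 3 (depth col row b) ∈ values (s.arr 3) (s.reg 10) := ⟨_, hge, rfl⟩
        have hnot := h.thr.notMem_values fun _ => hlt
        have hltU := h.values_lt hB _ hin
        have hk₀ := keeps_entered s₀ (s.arr 3 (depth col row b)) 0
        refine Runs.mono (Runs.seq (Blk.runs _ (enter_wp (x := s.arr 3 (depth col row b)) hW ?_ ?_
          (Runs.seq (Runs.mono (del_spec W D Z K K (entered s₀ (s.arr 3 (depth col row b)))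
            (values (s.arr 3) (s.reg 10)) (hE₀.keeps hk₀ (by norm_num)) le_rfl
            ?_ ?_ ?_ (h.values_lt hB) ?_ ?_ ?_) le_rfl
          fun s₁ h₁ => Runs.mono (t₁ := recordTime K) ?_ le_rfl fun _ h => h))))) ?_ fun _ h => h
        · simp [r12]
          omega
        · simp [r12, harr]
        · simp [entered, r7]
        · simp [entered]
        · simpa [entered] using hB.tree
        · simpa [entered] using hltU
        · simpa [entered] using hin
        · simpa [entered, harr] using h.rep
        · obtain ⟨k, hr, -⟩ := h₁
          simp only [entered, Config.setReg_reg] at hr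
          replace k := hk₀.trans k
          refine Runs.mono (record_spec
            (A := values (s.arr 3) (s.reg 10) \ {s.arr 3 (depth col row b)})
            (hE₀.keeps k (by norm_num)) hB.tree
            ((k.1 7 (by norm_num)).trans r7) (by rw [k.1 12 (by norm_num)]; omega)
            (by rw [k.1 13 (by norm_num)]; omega) (fun x hx => h.values_lt hB x hx.1)
            (by rw [k.1 13 (by norm_num), r13]; exact fun hx => hnot hx.1)
            (by simpa using hr)) le_rfl fun s' hs' =>
            h.updated (fun _ => hlt) ((k.1 12 (by norm_num)).trans r12)
              ((k.1 13 (by norm_num)).trans r13) (by rw [k.1 10 (by norm_num)]; omega)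
              (fun x hx h10 h12 h13 => (k.1 x hx).trans (hregs x hx h10 h12 h13))
              (fun x hx => by rw [k.2.2 x (by omega), hmem])
              (fun i hi h0 => by rw [k.2.1 i hi h0, harr]) (h.thr.values_update_old hge)
              (by simpa using hs')
        · simp [enter, Blk.cost, Expr.cost, ld, cell]
          omega
      · simp [r13, r12, harr] at hle
        refine Runs.mono (Blk.runs .skip ?_) ?_ fun _ h => h
        · constructor
          case env => exact hE₀
          case regs => exact hregs
          case mem => simp [hmem]
          case arr1 => exact harr 1
          case arr2 => exact harr 2
          case thr => simpa [r10, harr] using h.thr.keep hge hle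
          case rank => simpa [r10, harr] using h.rank
          case rep => simpa [r10, harr] using h.rep
        · simp [Blk.cost]
          omega
      · simp [Expr.cost, Expr.lt, ld, cell]
        omega
    · simp [Expr.cost, Expr.lt]
      omega
  refine Runs.mono (Runs.seq (Runs.mono (Blk.runs _ ?_) le_rfl
    fun s₁ (h₁ : s₁ = s₀) => h₁ ▸ Runs.seq (htest.mono le_rfl fun s₂ h₂ =>
      Runs.mono (Blk.runs _ ?_) le_rfl fun _ h => h))) ?_ fun _ h => h
  · simp [Blk.wp, h.r0, h.r8, hm, hlen, hW]
    and_intros <;> omega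
  · simp [updateTime, Blk.cost, Expr.cost, ld, cell]
    omega
  · have e8 := h₂.regs 8 (by norm_num) (by norm_num) (by norm_num) (by norm_num)
    simp [Blk.wp, hW, e8, h.r8]
    exact ⟨by omega, h.succ hB hba hend h₂⟩

end Matching

/-! ### Computing a largest non-crossing matching -/

namespace Matching

open VEB Chain Chain.Thresholds

/-- Process the edges: an edge is either searched for, or used for an update of the thresholds,
and all edges with the same second component are searched for before the first of them is
used. -/
def sweep : Cmd :=
  .while (.lt (.var 8) (.var 1))
    (.test (.lt (.var 9) (.var 1) *
        .eq (.get (.var 0 + 2 * .var 9 + 1)) (.get (.var 0 + 2 * .var 8 + 1)))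
      search update)

/-- The time bound for `sweep`. -/
def sweepTime (K r : ℕ) : ℕ := 2 * r * (searchTime K + updateTime K + 50) + 50

/-- Write the members of a longest chain, from the last to the first, to the memory from address
`0` on. -/
def output : Cmd :=
  .seq (.set 11 (.var 10) ;; .set 12 (ld 4 (.var 10)) : Blk).cmd
    (.seq (.while (.var 11)
        (.set 11 (.var 11 - 1) ;; .put (2 * .var 11) (.get (.var 0 + 2 * .var 12)) ;;
          .put (2 * .var 11 + 1) (.get (.var 0 + 2 * .var 12 + 1)) ;;
          .set 12 (ld 2 (.var 12)) : Blk).cmd)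
      (.set 0 0 ;; .set 1 (.var 10) : Blk).cmd)

/-- Set the tree up for the elements up to the value of register `4`, insert `0`, and clear the
counters. The memory behind the list of edges is assumed to be zero. -/
def init : Cmd :=
  .seq (.set 20 (.var 0 + 2 * .var 1) ;; .set 7 0 ;; .set 11 2 ;; st 6 0 2 : Blk).cmd
    (.seq (.while (.lt (.var 11) (.var 4 + 1))
        (.set 11 (.var 11 * .var 11) ;; .set 7 (.var 7 + 1) ;; st 6 (.var 7) (.var 11) : Blk).cmd)
      (st 0 0 1 ;; st 0 1 1 ;; .set 8 0 ;; .set 9 0 ;; .set 10 0 : Blk).cmd)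

/-- A program for a largest non-crossing matching in a list of edges, which is sorted by the second
components. -/
def program : Cmd := .seq init (.seq sweep output)

variable {W Z K r P : ℕ} {D : Oracle} {col row : ℕ → ℕ} {s : Config}

theorem sweep_spec (h : Inv W Z K r P col row 0 0 s) (hB : Bounds Z K r col row) :
    Runs W D sweep (sweepTime K r) s (Inv W Z K r P col row r r) := by
  refine Runs.mono (Runs.while_count (t := searchTime K + updateTime K + 30) (2 * r)
    (fun i s => ∃ b a, a + b = i ∧ Inv W Z K r P col row b a s) ⟨0, 0, rfl, h⟩ ?_ ?_) ?_ ?_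
  · rintro i s hi ⟨b, a, hab, h⟩
    have hba := h.ba
    have har := h.ar
    have hbr : b < r := by omega
    have hW := h.env.ne_zero
    have h1 := h.env.fits
    have h2 := h.r20
    have h4 := hB.edges
    have hmb := (h.mem b hbr).2
    have hsearch : a < r → row a = row b →
        Runs W D search (searchTime K + updateTime K) s
          fun s' => ∃ b' a', a' + b' = i + 1 ∧ Inv W Z K r P col row b' a' s' := fun h1 h2 =>
      (search_spec h hB h1 h2).mono (by omega) fun s' hs' => ⟨b, a + 1, by omega, hs'⟩
    have hupdate : b < a → (a < r → row a ≠ row b) →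
        Runs W D update (searchTime K + updateTime K) s
          fun s' => ∃ b' a', a' + b' = i + 1 ∧ Inv W Z K r P col row b' a' s' := fun h1 h2 =>
      (update_spec h hB h1 h2).mono (by omega) fun s' hs' => ⟨b + 1, a, by omega, hs'⟩
    refine ⟨by simp, by simp [h.r8, h.r1, hbr], (Runs.test (t := searchTime K + updateTime K) ?_
      (fun hv => ?_) fun hv => ?_).mono ?_ fun _ h => h⟩
    · simp [h.r0, h.r8, h.r9, h.r1, hW, hmb]
      and_intros <;> try omega
      split <;> first | omega | (split <;> omega)
    · by_cases har' : a < r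
      · have hma := (h.mem a har').2
        simp [h.r0, h.r8, h.r9, h.r1, hmb, hma, har'] at hv
        exact hsearch har' hv
      · simp [h.r9, h.r1, har'] at hv
    · by_cases har' : a < r
      · have hma := (h.mem a har').2
        simp [h.r0, h.r8, h.r9, h.r1, hmb, hma, har'] at hv
        refine hupdate (lt_of_le_of_ne hba ?_) fun _ => hv
        rintro rfl
        exact hv rfl
      · exact hupdate (by omega) fun h => absurd h har'
    · simp [Expr.cost, Expr.lt, Expr.eq]
      omega
  · rintro s ⟨b, a, hab, h⟩
    have := h.ba
    have := h.ar
    simp [h.r8, h.r1]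
    omega
  · have : (Expr.lt (.var 8) (.var 1)).cost = 5 := rfl
    rw [sweepTime, this]
    exact Nat.add_le_add (Nat.mul_le_mul_left _ (by omega)) (by omega)
  · rintro s ⟨b, a, hab, h⟩
    have := h.ba
    have := h.ar
    obtain rfl : b = r := by omega
    obtain rfl : a = b := by omega
    exact h

/-- The members of a longest chain, from the last to the first. -/
def trace (s : Config) (i : ℕ) : ℕ := (s.arr 2)^[i] (s.arr 4 (s.reg 10))

theorem Inv.trace_spec (h : Inv W Z K r P col row r r s) {i : ℕ} (hi : i < s.reg 10) :
    trace s i < r ∧ depth col row (trace s i) = s.reg 10 - i := by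
  induction i with
  | zero =>
    obtain ⟨h1, h2, h3⟩ := h.thr.top (s.reg 10) (by omega) le_rfl
    exact ⟨h1, h2⟩
  | succ i ih =>
    obtain ⟨h1, h2⟩ := ih (by omega)
    obtain ⟨h3, h4, h5, h6⟩ := h.link _ h1 (by omega)
    rw [trace, Function.iterate_succ_apply', ← trace]
    omega

theorem Inv.trace_lt (h : Inv W Z K r P col row r r s) {i j : ℕ} (hij : i < j)
    (hj : j < s.reg 10) :
    col (trace s j) < col (trace s i) ∧ row (trace s j) < row (trace s i) := by
  induction j, hij using Nat.le_induction with
  | base =>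
    obtain ⟨h1, h2⟩ := h.trace_spec (show i < s.reg 10 by omega)
    obtain ⟨h3, h4, h5, h6⟩ := h.link _ h1 (by omega)
    rw [trace, Function.iterate_succ_apply', ← trace]
    exact ⟨h4, h5⟩
  | succ j hij ih =>
    obtain ⟨h1, h2⟩ := h.trace_spec (show j < s.reg 10 by omega)
    obtain ⟨h3, h4, h5, h6⟩ := h.link _ h1 (by omega)
    have := ih (by omega)
    rw [trace, Function.iterate_succ_apply', ← trace]
    omega

/-- The list of the first `i` members of the chain has been written. -/
structure Written (P : ℕ) (col row : ℕ → ℕ) (s : Config) (i : ℕ) (s' : Config) : Prop where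
  r0 : s'.reg 0 = P
  r10 : s'.reg 10 = s.reg 10
  r11 : s'.reg 11 = s.reg 10 - i
  r12 : s'.reg 12 = trace s i
  r20 : s'.reg 20 = s.reg 20
  keep : ∀ a, 2 * s.reg 10 ≤ a → s'.mem a = s.mem a
  done : ∀ k, s.reg 10 - i ≤ k → k < s.reg 10 →
    s'.mem (2 * k) = col (trace s (s.reg 10 - 1 - k)) ∧
      s'.mem (2 * k + 1) = row (trace s (s.reg 10 - 1 - k))

/-- The time bound for `output`. -/
def outputTime (m : ℕ) : ℕ := m * 80 + 80

theorem output_spec (h : Inv W Z K r P col row r r s) (hB : Bounds Z K r col row)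
    (hP : 2 * s.reg 10 ≤ P) :
    Runs W D output (outputTime (s.reg 10)) s fun s' =>
      IsLargestNonCrossingMatching {x | ∃ e < r, x = (col e, row e)} s'.pairs := by
  have hW := h.env.ne_zero
  have h1 := h.env.fits
  have h2 := h.r20
  have h4 := hB.edges
  have hmr : s.reg 10 ≤ r := by
    rcases Nat.eq_zero_or_pos (s.reg 10) with h0 | h0
    · omega
    · obtain ⟨h5, h6⟩ := h.trace_spec h0
      have := depth_le (col := col) (row := row) (trace s 0)
      omega
  refine Runs.mono (Runs.seq (Runs.mono (Blk.runs _ (?_ : Blk.wp _ _ _ (Written P col row s 0)))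
    le_rfl fun s₁ h₁ => Runs.seq (Runs.mono (Runs.while_count (t := 60) (s.reg 10)
      (Written P col row s) h₁ (fun i s' hi h' => ?_) fun s' h' => ?_) le_rfl fun s₂ h₂ =>
      Blk.runs _ ?_))) ?_ fun _ h => h
  · simp [Blk.wp]
    and_intros <;> try omega
    constructor
    case r0 => simpa using h.r0
    case done => intros; omega
    all_goals simp [trace]
  · have hn : s.reg 10 - i ≠ 0 := by omega
    obtain ⟨h5, h6⟩ := h.trace_spec hi
    have hm := h.mem _ h5
    have hk := h'.keep
    have m1 := hk (P + 2 * trace s i) (by omega)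
    have m2 := hk (P + 2 * trace s i + 1) (by omega)
    rw [hm.1] at m1
    rw [hm.2] at m2
    have m3 : s'.mem (s'.reg 20 + 8 * trace s i + 2) = trace s (i + 1) := by
      rw [h'.r20, hk _ (by omega), trace, trace, Function.iterate_succ_apply']
      rfl
    have e20 := h'.r20
    refine ⟨by simp, by simpa [h'.r11] using hn, (Blk.runs _ ?_).mono
      (by decide) fun _ h => h⟩
    simp [Blk.wp, h'.r0, h'.r11, h'.r12, hW]
    and_intros <;> try omega
    have c1 : P + 2 * trace s i ≠ 2 * (s.reg 10 - i - 1) := by omega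
    have c2 : P + 2 * trace s i + 1 ≠ 2 * (s.reg 10 - i - 1) := by omega
    have c3 : s'.reg 20 + 8 * trace s i + 2 ≠ 2 * (s.reg 10 - i - 1) := by omega
    have c4 : s'.reg 20 + 8 * trace s i + 2 ≠ 2 * (s.reg 10 - i - 1) + 1 := by omega
    constructor
    case r0 => simpa using h'.r0
    case r10 => simpa using h'.r10
    case r11 => simp; omega
    case r12 => simp [Config.arr, Config.setMem_mem, c3, c4, m3]
    case r20 => simpa using e20
    case keep =>
      intro a ha
      simp [Config.setMem_mem]
      rw [if_neg (by omega), if_neg (by omega), hk a ha]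
    case done =>
      intro k hk1 hk2
      by_cases hk3 : k = s.reg 10 - i - 1
      · have e : s.reg 10 - 1 - k = i := by omega
        rw [e, hk3]
        simp [Config.setMem_mem, c2, m1, m2]
      · have := h'.done k (by omega) hk2
        simp [Config.setMem_mem]
        rwa [if_neg (by omega), if_neg (by omega), if_neg (by omega), if_neg (by omega)]
  · simp [h'.r11]
  · simp [Blk.wp, h₂.r10]
    have e : ((s₂.setReg 0 0).setReg 1 (s.reg 10)).pairs = (List.range (s.reg 10)).map fun k =>
        (col (trace s (s.reg 10 - 1 - k)), row (trace s (s.reg 10 - 1 - k))) := by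
      simp only [Config.pairs, Config.setReg_reg, Config.setReg_mem]
      simp
      intro k hk
      exact h₂.done k (by omega) hk
    rw [e]
    refine ⟨⟨?_, ?_⟩, fun l hl => ?_⟩
    · rw [List.pairwise_map]
      refine List.pairwise_lt_range.imp_of_mem fun {a b} ha hb hab => ?_
      rw [List.mem_range] at ha hb
      exact h.trace_lt (by omega) (by omega)
    · intro x hx
      obtain ⟨k, hk, rfl⟩ := List.mem_map.1 hx
      rw [List.mem_range] at hk
      exact ⟨_, (h.trace_spec (by omega)).1, rfl⟩
    · simpa using Chain.length_le hB.row (fun e he => (h.thr.le e he).1) l hl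
  · simp [outputTime, Blk.cost, Expr.cost, ld, cell]
    omega

/-- The time bound for `init`. -/
def initTime (K : ℕ) : ℕ := K * 60 + 200

theorem init_spec (hW : W ≠ 0) (hB : Bounds Z K r col row) (h0 : s.reg 0 = P)
    (h1 : s.reg 1 = r) (hfit : P + 2 * r + 8 * Z + 100 ≤ 2 ^ W)
    (hmem : ∀ e < r, s.mem (P + 2 * e) = col e ∧ s.mem (P + 2 * e + 1) = row e)
    (hzero : ∀ a, P + 2 * r ≤ a → s.mem a = 0) (hK : s.reg 4 < U K)
    (hK' : ∀ i < K, U i ≤ s.reg 4) :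
    Runs W D init (initTime K) s (Inv W Z K r P col row 0 0) := by
  have hUZ := (Nat.le_mul_self (U K)).trans hB.tree
  have hlv := hB.level
  have hed := hB.edges
  refine Runs.mono (Runs.seq (Runs.mono (Blk.runs _ (?_ : Blk.wp _ _ _ fun s' =>
      s'.reg 0 = P ∧ s'.reg 1 = r ∧ s'.reg 4 = s.reg 4 ∧ s'.reg 7 = 0 ∧ s'.reg 11 = U 0 ∧
      s'.reg 20 = P + 2 * r ∧ (∀ a < P + 2 * r, s'.mem a = s.mem a) ∧
      (∀ j < 8, j ≠ 6 → s'.arr j = 0) ∧ ∀ j ≤ 0, s'.arr 6 j = U j))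
    le_rfl fun s₁ h₁ => Runs.seq (Runs.mono (Runs.while_count (t := 41) K
      (fun i s' => s'.reg 0 = P ∧ s'.reg 1 = r ∧ s'.reg 4 = s.reg 4 ∧ s'.reg 7 = i ∧
        s'.reg 11 = U i ∧ s'.reg 20 = P + 2 * r ∧ (∀ a < P + 2 * r, s'.mem a = s.mem a) ∧
        (∀ j < 8, j ≠ 6 → s'.arr j = 0) ∧ ∀ j ≤ i, s'.arr 6 j = U j) h₁ ?_ ?_) le_rfl
      fun s₂ h₂ => Blk.runs _ ?_))) ?_ fun _ h => h
  · simp [Blk.wp, h0, h1]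
    and_intros <;> try omega
    · simp [U]
    · simp +contextual
    · intro j hj hj6
      simp [hj, hj6]
      funext e
      simpa [Config.arr] using hzero _ (by omega)
    · simp [U]
  · rintro i s' hi ⟨e0, e1, e4, e7, e11, e20, em, ea, et⟩
    have hUi := hK' i hi
    have hs := U_succ i
    have h2 := two_le_U i
    have hmono : U (i + 1) ≤ U K := by
      rw [U, U]
      gcongr <;> omega
    refine ⟨by simp; omega, by simp [e4, e11]; omega, (Blk.runs _ ?_).mono
      (by simp [Blk.cost, Expr.cost, st, cell]) fun _ h => h⟩
    simp [Blk.wp, e7, e11, hW, e0, e1, e4, e20]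
    and_intros <;> try omega
    · intro a ha
      simp [e20, ha, em a ha]
    · intro j hj hj6
      simp [hj, hj6, ea]
    · intro j hj
      rcases Nat.le_succ_iff.1 hj with hj | rfl
      · simp [show j ≠ i + 1 by omega, et j hj]
      · simp [hs]
  · rintro s' ⟨e0, e1, e4, e7, e11, e20, em, ea, et⟩
    simp [e4, e11]
    omega
  · obtain ⟨e0, e1, e4, e7, e11, e20, em, ea, et⟩ := h₂
    simp [Blk.wp, hW, e20]
    and_intros <;> try omega
    constructor
    case env =>
      exact ⟨by simp [e20]; omega, by simpa using et, by omega⟩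
    case r0 => simpa using e0
    case r1 => simpa using e1
    case r7 => simpa using e7
    case r20 => simpa using e20
    case mem =>
      intro e he
      have l1 : P + 2 * e < P + 2 * r := by omega
      have l2 : P + 2 * e + 1 < P + 2 * r := by omega
      simpa [e20, l1, l2, em _ l1, em _ l2] using hmem e he
    case thr =>
      constructor
      · simp [ea]
      · omega
      · simp
        omega
    case rank => simp [ea]
    case rep =>
      have e : values (0 : ℕ → ℕ) 0 = {0} := by
        ext x
        simp [values, eq_comm]
      simp [ea, e]
      exact (rep_empty (i := K) (o := 0) (v := 0) fun _ _ => rfl).of_inner_eq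
        (by rw [inner_singleton, inner_empty])
        (by simpa using ends_singleton 0) fun a ha => by
          simp [show a ≠ 0 by omega, show a ≠ 1 by omega]
    all_goals simp
  · simp [initTime, Blk.cost, Expr.cost, Expr.lt, st, cell]
    omega

theorem lt_U (n : ℕ) : n < U n :=
  Nat.lt_two_pow_self.trans (Nat.pow_lt_pow_right (by norm_num) Nat.lt_two_pow_self)

/-- The time bound for `program`. -/
def time (K r : ℕ) : ℕ := initTime K + (sweepTime K r + outputTime r)

theorem program_spec {n : ℕ} (hW : W ≠ 0) (hn : 2 ≤ n) (h0 : s.reg 0 = P) (h1 : s.reg 1 = r)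
    (h4 : s.reg 4 ≤ n) (hfit : P + 2 * r + 8 * (n ^ 4 + r + 2) + 100 ≤ 2 ^ W)
    (hP : 2 * s.reg 4 ≤ P)
    (hmem : ∀ e < r, s.mem (P + 2 * e) = col e ∧ s.mem (P + 2 * e + 1) = row e)
    (hzero : ∀ a, P + 2 * r ≤ a → s.mem a = 0) (hcol : ∀ e < r, col e < s.reg 4)
    (hrow : ∀ e f, e ≤ f → f < r → row e ≤ row f) :
    ∃ K, (K = 0 ∨ U (K - 1) ≤ n) ∧ Runs W D program (time K r) s fun s' =>
      IsLargestNonCrossingMatching {x | ∃ e < r, x = (col e, row e)} s'.pairs := by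
  classical
  have hex : ∃ k, s.reg 4 < U k := ⟨_, lt_U _⟩
  obtain ⟨K, hK, hK'⟩ : ∃ K, s.reg 4 < U K ∧ ∀ i < K, U i ≤ s.reg 4 :=
    ⟨Nat.find hex, Nat.find_spec hex, fun i hi => not_lt.1 (Nat.find_min hex hi)⟩
  have hKn : K = 0 ∨ U (K - 1) ≤ n := by
    rcases Nat.eq_zero_or_pos K with h | h
    · exact Or.inl h
    · exact Or.inr ((hK' _ (by omega)).trans h4)
  have hUK : U K * U K ≤ n ^ 4 := by
    have : U K ≤ n ^ 2 := by
      rcases K with _ | K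
      · have : U 0 = 2 := rfl
        nlinarith
      · rw [U_succ]
        have : U K ≤ n := by simpa using hKn
        nlinarith
    nlinarith
  have hB : Bounds (n ^ 4 + r + 2) K r col row := by
    refine ⟨by omega, ?_, by omega, fun e he => ?_, hrow⟩
    · have := lt_U K
      have := two_le_U K
      nlinarith
    · have := hcol e he
      omega
  refine ⟨K, hKn, Runs.seq (Runs.mono (init_spec hW hB h0 h1 hfit hmem hzero hK hK') le_rfl
    fun s₁ h₁ => Runs.seq (Runs.mono (sweep_spec h₁ hB) le_rfl fun s₂ h₂ => ?_))⟩
  have hm : s₂.reg 10 ≤ r ∧ s₂.reg 10 ≤ s.reg 4 := by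
    rcases Nat.eq_zero_or_pos (s₂.reg 10) with h | h
    · omega
    · obtain ⟨h5, h6⟩ := h₂.trace_spec h
      have := depth_le (col := col) (row := row) (trace s₂ 0)
      have := depth_le_col (col := col) (row := row) (trace s₂ 0)
      have := hcol _ h5
      omega
  refine (output_spec h₂ hB (by omega)).mono ?_ fun _ h => h
  simp only [outputTime]
  omega

/-- The running time is proportional to the number of levels for each edge. -/
theorem exists_time_le : ∃ C, ∀ K r, time K r ≤ C * ((r + 1) * (K + 1)) := by
  refine ⟨2 * (locBody.cost + upBody.cost + 2 * insBody.cost + delBody.cost + 1000), fun K r => ?_⟩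
  simp only [time, initTime, sweepTime, outputTime, searchTime, updateTime, recordTime, locateTime]
  generalize locBody.cost = a
  generalize upBody.cost = b
  generalize insBody.cost = c
  generalize delBody.cost = d
  have h1 : 100 + ((K + 1) * (a + 3) + 3 + (K * (b + 5 + 1) + (5 + 1))) +
      (200 + (100 + ((K + 1) * (c + 3) + 3)) + ((K + 1) * (d + 3) + 3)) + 50 ≤
      (K + 1) * (a + b + 2 * c + d + 500) := by
    ring_nf
    omega
  have h2 := Nat.mul_le_mul_left (2 * r) h1
  have h3 : K * 60 + 200 + (50 + (r * 80 + 80)) ≤ 1000 * ((r + 1) * (K + 1)) := by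
    ring_nf
    omega
  have h4 : 2 * r * ((K + 1) * (a + b + 2 * c + d + 500)) + 1000 * ((r + 1) * (K + 1)) ≤
      2 * (a + b + 2 * c + d + 1000) * ((r + 1) * (K + 1)) := by
    ring_nf
    omega
  omega

end Matching

/-! ### Listing the edges of the graph -/

@[simp] theorem Expr.cost_sub (a b : Expr) : (a - b).cost = a.cost + (b.cost + 1) := rfl

namespace Listing

/-- The numbers and the words that determine the graph: block length `N`, distance `w` of blocks,
number `M` of blocks of the first string, lengths `m` and `m'` of the strings, and the memory `v`
that holds the two strings. -/
structure Input where
  (N w M m m' : ℕ)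
  v : ℕ → ℕ

namespace Input

variable (x : Input)

/-- The address behind the input; the last answer of the oracle is stored there. -/
def buf : ℕ := 2 * (x.m + x.m')

/-- The oracle is asked for the `i`-th block of the second string. -/
def query (i : ℕ) : List ℕ :=
  (List.range' (i * x.N) (min x.N (x.m' - i * x.N))).map fun p => x.v (2 * (x.m + p) + 1)

/-- The first position of the blocks at distance at most `w` from block `j`. -/
def lo (j : ℕ) : ℕ := (j - x.w) * x.N

/-- The position after the last of the blocks at distance at most `w` from block `j`. -/
def hi (j : ℕ) : ℕ := min x.M (j + x.w + 1) * x.N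

/-- The positions `p` and `p'` carry the same symbol. -/
def Same (p p' : ℕ) : Prop :=
  x.v (2 * p) = x.v (2 * (x.m + p')) ∧ x.v (2 * p + 1) = x.v (2 * (x.m + p') + 1)

instance (p p' : ℕ) : Decidable (x.Same p p') := instDecidableAnd

/-- The edges between `p'` and the first `k` positions for the block number `j`. -/
def part (p' j k : ℕ) : List (ℕ × ℕ) :=
  ((List.range' (x.lo j) k).filter fun p => x.Same p p').map fun p => (p, p')

/-- The edges at `p'`, where an edge occurs once for each member of the answer that is near. -/
def rowEdges (D : Oracle) (p' : ℕ) : List (ℕ × ℕ) :=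
  (D.answer (x.query (p' / x.N))).flatMap fun j => x.part p' j (x.hi j - x.lo j)

/-- All edges, sorted by the second components. -/
def edges (D : Oracle) : List (ℕ × ℕ) := (List.range x.m').flatMap (x.rowEdges D)

end Input

/-- The assumptions on the input: `c` bounds the lengths of the answers of the oracle, `T` its
running time, and `h` the number of positions that belong to a member of an answer. -/
structure Good (W : ℕ) (D : Oracle) (x : Input) (c h T : ℕ) : Prop where
  posN : 0 < x.N
  len : x.m = x.N * x.M
  wM : x.w ≤ x.M
  count : ∀ i, i * x.N < x.m' → (D.answer (x.query i)).length ≤ c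
  cM : c ≤ x.M
  index : ∀ i, i * x.N < x.m' → ∀ j ∈ D.answer (x.query i), j < x.M
  range : ∀ j < x.M, x.hi j - x.lo j ≤ h
  time : ∀ i, i * x.N < x.m' → D.time (x.query i) ≤ T
  fits : x.buf + x.M + 2 * (x.m' * (c * h)) + x.N + 100 + 4 * x.m * x.m ≤ 2 ^ W

/-- The state with the list `l` of edges, of length at most `B`. Registers: `0` address of the
list, `1` its length, `2` to `7` the numbers `N`, `w`, `m`, `m'`, `M` and the address of the
answer. -/
structure Holds (x : Input) (l : List (ℕ × ℕ)) (B : ℕ) (s : Config) : Prop where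
  r0 : s.reg 0 = x.buf + x.M
  r2 : s.reg 2 = x.N
  r3 : s.reg 3 = x.w
  r4 : s.reg 4 = x.m
  r5 : s.reg 5 = x.m'
  r6 : s.reg 6 = x.M
  r7 : s.reg 7 = x.buf
  low : ∀ a < x.buf, s.mem a = x.v a
  pairs : s.pairs = l
  bound : l.length ≤ B
  zero : ∀ a, x.buf + x.M + 2 * l.length ≤ a → s.mem a = 0
  query : s.query = []

theorem Holds.r1 {x : Input} {l : List (ℕ × ℕ)} {B : ℕ} {s : Config} (h : Holds x l B s) :
    s.reg 1 = l.length := by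
  rw [← h.pairs]
  simp [Config.pairs]

/-- Within the block from position `a` to position `e`, for which the oracle has answered `as`. -/
structure Within (x : Input) (as : List ℕ) (a e : ℕ) (l : List (ℕ × ℕ)) (B : ℕ) (s : Config) :
    Prop extends Holds x l B s where
  r10 : s.reg 10 = a
  r11 : s.reg 11 = e
  r12 : s.reg 12 = as.length
  answer : ∀ t (ht : t < as.length), s.mem (x.buf + t) = as[t]

/-- A change of a register that holds a loop variable. -/
theorem Within.setReg {x : Input} {as : List ℕ} {a e B : ℕ} {l : List (ℕ × ℕ)} {s : Config}
    (h : Within x as a e l B s) {d : ℕ} (hd : 13 ≤ d) (y : ℕ) :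
    Within x as a e l B (s.setReg d y) := by
  constructor
  case toHolds =>
    constructor
    case pairs =>
      simpa [Config.pairs, show (0 : ℕ) ≠ d by omega, show (1 : ℕ) ≠ d by omega] using h.pairs
    case low => exact h.low
    case bound => exact h.bound
    case zero => exact h.zero
    case query => exact h.query
    all_goals rw [Config.setReg_reg, if_neg (by omega)]
    exacts [h.r0, h.r2, h.r3, h.r4, h.r5, h.r6, h.r7]
  case answer => exact h.answer
  all_goals rw [Config.setReg_reg, if_neg (by omega)]
  exacts [h.r10, h.r11, h.r12]

theorem Within.mono {x : Input} {as : List ℕ} {a e B B' : ℕ} {l : List (ℕ × ℕ)} {s : Config}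
    (h : Within x as a e l B s) (hB : B ≤ B') : Within x as a e l B' s :=
  { h with bound := h.bound.trans hB }

/-- Append the pair of the words in registers `16` and `14` to the list. -/
def push : Blk :=
  .put (.var 0 + 2 * .var 1) (.var 16) ;; .put (.var 0 + 2 * .var 1 + 1) (.var 14) ;;
    .set 1 (.var 1 + 1)

/-- Append the edge between the positions in registers `16` and `14`, if there is one, and pass to
the next position. -/
def emit : Blk :=
  .ite (.eq (.get (2 * .var 16)) (.get (2 * (.var 4 + .var 14))) *
      .eq (.get (2 * .var 16 + 1)) (.get (2 * (.var 4 + .var 14) + 1))) push .skip ;;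
    .set 16 (.var 16 + 1)

/-- The edges between the position in register `14` and the blocks around the block whose number
is entry number `v15` of the answer. -/
def emitBlocks : Cmd :=
  .seq (.set 16 (.get (.var 7 + .var 15)) ;; .set 17 (.var 16 + .var 3 + 1) ;;
      .ite (.lt (.var 6) (.var 17)) (.set 17 (.var 6)) .skip ;;
      .set 17 (.var 17 * .var 2) ;; .set 16 ((.var 16 - .var 3) * .var 2) : Blk).cmd
    (.seq (.while (.lt (.var 16) (.var 17)) emit.cmd) (Blk.set 15 (.var 15 + 1)).cmd)

/-- The edges at the position in register `14`. -/
def emitRow : Cmd :=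
  .seq (Blk.set 15 0).cmd
    (.seq (.while (.lt (.var 15) (.var 12)) emitBlocks) (Blk.set 14 (.var 14 + 1)).cmd)

/-- Submit the block of the positions from `v10` to `v11` and store the answer. -/
def decode : Cmd :=
  .seq (Blk.set 13 (.var 10)).cmd
    (.seq (.while (.lt (.var 13) (.var 11))
        (.ask (.get (2 * (.var 4 + .var 13) + 1)) ;; .set 13 (.var 13 + 1) : Blk).cmd)
      (.seq (.call 12) (.seq (Blk.set 13 0).cmd
        (.while (.lt (.var 13) (.var 12))
          (.read 14 ;; .put (.var 7 + .var 13) (.var 14) ;; .set 13 (.var 13 + 1) : Blk).cmd))))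

/-- The edges at the positions of a block. -/
def emitAll : Cmd :=
  .seq (.set 11 (.var 10 + .var 2) ;; .ite (.lt (.var 5) (.var 11)) (.set 11 (.var 5)) .skip :
      Blk).cmd
    (.seq decode (.seq (Blk.set 14 (.var 10)).cmd
      (.seq (.while (.lt (.var 14) (.var 11)) emitRow) (Blk.set 10 (.var 11)).cmd)))

/-- Store the numbers that the loops use. The distance `w` is replaced by `min w M`, which makes no
difference for block numbers below `M` and rules out overflow. -/
def setup : Blk :=
  .set 4 (.var 0) ;; .set 5 (.var 1) ;; .set 6 (.var 4 / .var 2) ;;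
  .ite (.lt (.var 6) (.var 3)) (.set 3 (.var 6)) .skip ;; .set 7 (2 * (.var 4 + .var 5)) ;;
  .set 0 (.var 7 + .var 6) ;; .set 1 0 ;; .set 10 0

/-- A program that lists the edges of the graph, sorted by the second components. -/
def program : Cmd := .seq setup.cmd (.while (.lt (.var 10) (.var 5)) emitAll)

variable {W c h T : ℕ} {D : Oracle} {x : Input} {l : List (ℕ × ℕ)} {B a e : ℕ} {as : List ℕ}
  {s : Config}

theorem Within.push (hs : Within x as a e l B s) (has : as.length ≤ x.M) (p p' : ℕ) :
    Within x as a e (l ++ [(p, p')]) (B + 1)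
      (((s.setMem (x.buf + x.M + 2 * l.length) p).setMem (x.buf + x.M + 2 * l.length + 1)
        p').setReg 1 (l.length + 1)) := by
  have hb := hs.bound
  constructor
  case toHolds =>
    constructor
    case low =>
      intro b hb
      simp only [Config.setReg_mem, Config.setMem_mem]
      rw [if_neg (by omega), if_neg (by omega), hs.low b hb]
    case pairs =>
      have h1 := hs.pairs
      rw [Config.pairs, hs.r0, hs.r1] at h1
      simp only [Config.pairs, Config.setReg_reg, Config.setMem_reg, Config.setReg_mem,
        Config.setMem_mem, if_true, hs.r0, show (0 : ℕ) ≠ 1 by omega, if_false]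
      rw [List.range_succ, List.map_append]
      congr 1
      · refine Eq.trans ?_ h1
        refine List.map_congr_left fun k hk => ?_
        rw [List.mem_range] at hk
        rw [if_neg (by omega), if_neg (by omega), if_neg (by omega), if_neg (by omega)]
      · simp
    case bound => simp; omega
    case zero =>
      intro b hb
      simp at hb
      simp only [Config.setReg_mem, Config.setMem_mem]
      rw [if_neg (by omega), if_neg (by omega), hs.zero b (by omega)]
    case query => exact hs.query
    all_goals simp
    exacts [hs.r0, hs.r2, hs.r3, hs.r4, hs.r5, hs.r6, hs.r7]
  case answer =>
    intro t ht
    simp only [Config.setReg_mem, Config.setMem_mem]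
    rw [if_neg (by omega), if_neg (by omega), hs.answer t ht]
  all_goals simp
  exacts [hs.r10, hs.r11, hs.r12]

theorem emit_wp (hG : Good W D x c h T) (hW : W ≠ 0) (hs : Within x as a e l B s)
    (has : as.length ≤ x.M) (hB : B < x.m' * (c * h)) {p p' t u : ℕ} (h14 : s.reg 14 = p')
    (h15 : s.reg 15 = t) (h16 : s.reg 16 = p) (h17 : s.reg 17 = u) (hp : p < x.m)
    (hp' : p' < x.m') :
    emit.wp W s fun s' => Within x as a e (l ++ if x.Same p p' then [(p, p')] else []) (B + 1) s' ∧
      s'.reg 14 = p' ∧ s'.reg 15 = t ∧ s'.reg 16 = p + 1 ∧ s'.reg 17 = u := by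
  have hf := hG.fits
  have hb := hs.bound
  have hbuf : x.buf = 2 * (x.m + x.m') := rfl
  have l1 := hs.low (2 * p) (by omega)
  have l2 := hs.low (2 * p + 1) (by omega)
  have l3 := hs.low (2 * (x.m + p')) (by omega)
  have l4 := hs.low (2 * (x.m + p') + 1) (by omega)
  simp [emit, push, Blk.wp, hW, h14, h15, h16, hs.r0, hs.r1, hs.r4, l1, l2, l3, l4]
  and_intros <;> try omega
  · split <;> first | omega | (split <;> omega)
  · intro h1 h2
    and_intros <;> try omega
    · rw [if_pos ⟨h2, h1⟩]
      exact (hs.push has p p').setReg (by norm_num) _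
  · intro h1
    and_intros <;> try omega
    · rw [if_neg fun h => h1 h.2 h.1, List.append_nil]
      exact (hs.mono (by omega)).setReg (by norm_num) _

theorem lo_le_hi {j : ℕ} (hj : j < x.M) : x.lo j ≤ x.hi j :=
  Nat.mul_le_mul_right _ (by omega)

theorem hi_le (hG : Good W D x c h T) (j : ℕ) : x.hi j ≤ x.m := by
  rw [hG.len, mul_comm]
  exact Nat.mul_le_mul_right _ (min_le_left _ _)

theorem part_succ (p' j k : ℕ) : x.part p' j (k + 1) =
    x.part p' j k ++ if x.Same (x.lo j + k) p' then [(x.lo j + k, p')] else [] := by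
  rw [Input.part, List.range'_1_concat, List.filter_append, List.map_append, ← Input.part]
  by_cases hs : x.Same (x.lo j + k) p' <;> simp [hs]

theorem M_le (hG : Good W D x c h T) : x.M ≤ x.m :=
  hG.len ▸ Nat.le_mul_of_pos_left _ hG.posN

theorem emitBlocks_spec (hG : Good W D x c h T) (hW : W ≠ 0) (hs : Within x as a e l B s)
    (has : as.length ≤ x.M) (hB : B + h ≤ x.m' * (c * h)) {p' t : ℕ} (h14 : s.reg 14 = p')
    (h15 : s.reg 15 = t) (ht : t < as.length) (hj : as[t] < x.M) (hp' : p' < x.m') :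
    Runs W D emitBlocks (h * 100 + 100) s fun s' =>
      Within x as a e (l ++ x.part p' as[t] (x.hi as[t] - x.lo as[t])) (B + h) s' ∧
        s'.reg 14 = p' ∧ s'.reg 15 = t + 1 := by
  have hf := hG.fits
  have hr := hG.range _ hj
  have hMm := M_le hG
  have hwM := hG.wM
  have hbuf : x.buf = 2 * (x.m + x.m') := rfl
  have hlh := lo_le_hi hj
  have hhi := hi_le hG as[t]
  have hans := hs.answer t ht
  generalize as[t] = j at *
  have hlo : (j - x.w) * x.N = x.lo j := rfl
  have hbM : t < x.M := by omega
  refine Runs.mono (Runs.seq (Runs.mono (Blk.runs _ (?_ : Blk.wp _ _ _ fun s' =>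
      Within x as a e (l ++ x.part p' j 0) (B + 0) s' ∧ s'.reg 14 = p' ∧ s'.reg 15 = t ∧
        s'.reg 16 = x.lo j + 0 ∧ s'.reg 17 = x.hi j)) le_rfl
    fun s₁ h₁ => Runs.seq (Runs.mono (Runs.while_count (t := 90) (x.hi j - x.lo j)
      (fun k s' => Within x as a e (l ++ x.part p' j k) (B + k) s' ∧ s'.reg 14 = p' ∧
        s'.reg 15 = t ∧ s'.reg 16 = x.lo j + k ∧ s'.reg 17 = x.hi j)
      h₁ (fun k s' hk h' => ?_) fun s' h' => ?_) le_rfl fun s₂ h₂ => Blk.runs _ ?_)))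
      ?_ fun _ h => h
  · simp [Blk.wp, hW, h15, hs.r7, hs.r6, hs.r3, hs.r2, hans, hlo]
    and_intros <;> try omega
    · intro hlt
      have e : x.M * x.N = x.hi j := by rw [Input.hi, min_eq_left (by omega)]
      rw [e]
      and_intros <;> try omega
      · simpa [Input.part] using ((((hs.setReg (show 13 ≤ 16 by norm_num) _).setReg
          (show 13 ≤ 17 by norm_num) _).setReg (show 13 ≤ 17 by norm_num) _).setReg
          (show 13 ≤ 17 by norm_num) _).setReg (show 13 ≤ 16 by norm_num) _
    · intro hlt
      have e : (j + x.w + 1) * x.N = x.hi j := by rw [Input.hi, min_eq_right (by omega)]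
      rw [e]
      and_intros <;> try omega
      · simpa [Input.part] using (((hs.setReg (show 13 ≤ 16 by norm_num) _).setReg
          (show 13 ≤ 17 by norm_num) _).setReg (show 13 ≤ 17 by norm_num) _).setReg
          (show 13 ≤ 16 by norm_num) _
  · obtain ⟨hw, e14, e15, e16, e17⟩ := h'
    refine ⟨by simp, by simp [e16, e17]; omega, (Blk.runs _ (Blk.wp.mono (emit_wp hG hW hw has
      (by omega) e14 e15 e16 e17 (by omega) hp') ?_)).mono (by decide) fun _ h => h⟩
    rintro s'' ⟨hw, h⟩
    refine ⟨?_, h⟩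
    rw [part_succ, ← List.append_assoc]
    exact hw
  · obtain ⟨hw, e14, e15, e16, e17⟩ := h'
    simp [e16, e17]
    omega
  · obtain ⟨hw, e14, e15, e16, e17⟩ := h₂
    simp [Blk.wp, hW, e15, e14]
    exact ⟨by omega, (hw.mono (by omega)).setReg (by norm_num) _⟩
  · have e : (Expr.lt (.var 16) (.var 17)).cost = 5 := rfl
    have := Nat.mul_le_mul_right (90 + 5 + 1) hr
    simp [Blk.cost, Expr.cost, Expr.lt] at this ⊢
    omega

theorem emitRow_spec (hG : Good W D x c h T) (hW : W ≠ 0) (hs : Within x as a e l B s)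
    (has : as.length ≤ c) (hB : B + c * h ≤ x.m' * (c * h)) {p' : ℕ} (h14 : s.reg 14 = p')
    (hj : ∀ j ∈ as, j < x.M) (hp' : p' < x.m') :
    Runs W D emitRow (c * (h * 100 + 110) + 30) s fun s' =>
      Within x as a e (l ++ as.flatMap fun j => x.part p' j (x.hi j - x.lo j)) (B + c * h) s' ∧
        s'.reg 14 = p' + 1 := by
  have hf := hG.fits
  have hcM := hG.cM
  have hMm := M_le hG
  have hbuf : x.buf = 2 * (x.m + x.m') := rfl
  refine Runs.mono (Runs.seq (Runs.mono (Blk.runs _ (?_ : Blk.wp _ _ _ fun s' =>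
      Within x as a e (l ++ (as.take 0).flatMap fun j => x.part p' j (x.hi j - x.lo j))
        (B + 0 * h) s' ∧ s'.reg 14 = p' ∧ s'.reg 15 = 0)) le_rfl
    fun s₁ h₁ => Runs.seq (Runs.mono (Runs.while_count (t := h * 100 + 100) as.length
      (fun t s' => Within x as a e (l ++ (as.take t).flatMap fun j =>
        x.part p' j (x.hi j - x.lo j)) (B + t * h) s' ∧ s'.reg 14 = p' ∧ s'.reg 15 = t)
      h₁ (fun t s' ht h' => ?_) fun s' h' => ?_) le_rfl fun s₂ h₂ => Blk.runs _ ?_)))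
      ?_ fun _ h => h
  · simp [Blk.wp]
    exact ⟨hs.setReg (by norm_num) _, h14⟩
  · obtain ⟨hw, e14, e15⟩ := h'
    have hth : (t + 1) * h ≤ c * h := Nat.mul_le_mul_right _ (by omega)
    rw [Nat.succ_mul] at hth
    refine ⟨by simp, by simp [e15, hw.r12, ht], (emitBlocks_spec hG hW hw (by omega) (by omega)
      e14 e15 ht (hj _ (List.getElem_mem ht)) hp').mono le_rfl ?_⟩
    rintro s'' ⟨hw, h14, h15⟩
    refine ⟨?_, h14, h15⟩
    rw [List.take_add_one, List.flatMap_append, ← List.append_assoc, List.getElem?_eq_getElem ht,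
      Nat.succ_mul, ← add_assoc]
    simpa using hw
  · obtain ⟨hw, e14, e15⟩ := h'
    simp [e15, hw.r12]
  · obtain ⟨hw, e14, e15⟩ := h₂
    have hth : as.length * h ≤ c * h := Nat.mul_le_mul_right _ has
    rw [List.take_length] at hw
    simp [Blk.wp, hW, e14]
    exact ⟨by omega, (hw.mono (by omega)).setReg (by norm_num) _⟩
  · have := Nat.mul_le_mul_right (h * 100 + 110) has
    simp [Blk.cost, Expr.cost, Expr.lt]
    have e : h * 100 + 100 + 5 + 1 ≤ h * 100 + 110 := by omega
    have := Nat.mul_le_mul_left as.length e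
    omega

theorem Holds.congr (hs : Holds x l B s) {s' : Config} (hr : ∀ r < 8, s'.reg r = s.reg r)
    (hm : ∀ b, b < x.buf ∨ x.buf + x.M ≤ b → s'.mem b = s.mem b) (hq : s'.query = []) :
    Holds x l B s' := by
  constructor
  case low => exact fun b hb => (hm b (Or.inl hb)).trans (hs.low b hb)
  case pairs =>
    rw [← hs.pairs, Config.pairs, Config.pairs, hr 0 (by norm_num), hr 1 (by norm_num), hs.r0]
    refine List.map_congr_left fun k _ => ?_
    rw [hm _ (by omega), hm _ (by omega)]
  case bound => exact hs.bound
  case zero => exact fun b hb => (hm b (by omega)).trans (hs.zero b hb)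
  case query => exact hq
  all_goals rw [hr _ (by norm_num)]
  exacts [hs.r0, hs.r2, hs.r3, hs.r4, hs.r5, hs.r6, hs.r7]

theorem _root_.Runs.call {d t : ℕ} {Q : Config → Prop} (ht : D.time s.query ≤ t)
    (hl : (D.answer s.query).length < 2 ^ W)
    (hQ : Q (({ s with query := [], reply := D.answer s.query } : Config).setReg d
      (D.answer s.query).length)) : Runs W D (.call d) (1 + t) s Q := by
  intro s₀ h₀ w₀
  refine ⟨_, _, .call _ _, ?_, _, ?_, hQ⟩
  · rw [h₀.2.2.1]
    omega
  · rw [h₀.2.2.1, Nat.mod_eq_of_lt hl]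
    exact Config.Eqv.setReg (s := { s₀ with query := [], reply := D.answer s.query })
      (s' := { s with query := [], reply := D.answer s.query }) ⟨h₀.1, h₀.2.1, rfl, rfl⟩ _ _

theorem decode_spec (hG : Good W D x c h T) (hW : W ≠ 0) (hs : Holds x l B s) {i : ℕ}
    (hi : i * x.N < x.m') (h10 : s.reg 10 = i * x.N)
    (h11 : s.reg 11 = i * x.N + min x.N (x.m' - i * x.N)) :
    Runs W D decode (T + (x.N + c) * 30 + 50) s
      (Within x (D.answer (x.query i)) (i * x.N) (i * x.N + min x.N (x.m' - i * x.N)) l B) := by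
  have hf := hG.fits
  have hMm := M_le hG
  have hcM := hG.cM
  have hc := hG.count i hi
  have hbuf : x.buf = 2 * (x.m + x.m') := rfl
  refine Runs.mono (Runs.seq (Runs.mono (Blk.runs _ (?_ : Blk.wp _ _ _ fun s' =>
    ∃ u : Config, Holds x l B u ∧ u.reg 10 = i * x.N ∧
      u.reg 11 = i * x.N + min x.N (x.m' - i * x.N) ∧ u.reg 13 = i * x.N + 0 ∧
      s' = { u with query :=
        (List.range' (i * x.N) 0).map fun p => x.v (2 * (x.m + p) + 1) })) le_rfl
    fun s₁ h₁ => Runs.seq (Runs.mono (Runs.while_count (t := 20) (min x.N (x.m' - i * x.N))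
      (fun t s' => ∃ u : Config, Holds x l B u ∧ u.reg 10 = i * x.N ∧
        u.reg 11 = i * x.N + min x.N (x.m' - i * x.N) ∧ u.reg 13 = i * x.N + t ∧
        s' = { u with query :=
          (List.range' (i * x.N) t).map fun p => x.v (2 * (x.m + p) + 1) })
      h₁ (fun t s' ht h' => ?_) fun s' h' => ?_) le_rfl fun s₂ h₂ =>
    Runs.seq (Runs.mono (t₁ := 1 + T) ?_ le_rfl fun s₃ h₃ => h₃))))
      (t₁ := 4 + (min x.N (x.m' - i * x.N) * 26 + 6 + (1 + T + (3 + (c * 26 + 6))))) ?_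
      fun _ h => h
  · simp [Blk.wp]
    refine ⟨s.setReg 13 (i * x.N), hs.congr ?_ ?_ hs.query, ?_⟩
    · intro r hr
      simp [show r ≠ 13 by omega]
    · simp
    · simp [h10, h11]
      rw [← hs.query]
      rfl
  · obtain ⟨u, hu, u10, u11, u13, rfl⟩ := h'
    have hl := hu.low (2 * (x.m + (i * x.N + t)) + 1) (by omega)
    refine ⟨by simp, by simp [u11, u13]; omega, (Blk.runs _ ?_).mono (by decide) fun _ h => h⟩
    simp [Blk.wp, hW, u13, hu.r4, hl]
    and_intros <;> try omega
    refine ⟨u.setReg 13 (i * x.N + t + 1), hu.congr ?_ ?_ hu.query, by simpa using u10,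
      by simpa using u11, by simp [add_assoc], ?_⟩
    · intro r hr
      simp [show r ≠ 13 by omega]
    · simp
    · rw [List.range'_1_concat, List.map_append]
      rfl
  · obtain ⟨u, hu, u10, u11, u13, rfl⟩ := h'
    simp [u11, u13]
  · obtain ⟨u, hu, u10, u11, u13, rfl⟩ := h₂
    change Runs W D (.call 12) (1 + T) { u with query := x.query i } _
    refine Runs.call (hG.time i hi) (show (D.answer (x.query i)).length < _ by omega) ?_
    change Runs W D _ _ (({ u with query := [], reply := D.answer (x.query i) } : Config).setReg 12
      (D.answer (x.query i)).length) _
    generalize hans : D.answer (x.query i) = as at *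
    have hj := hG.index i hi
    rw [hans] at hj
    refine Runs.seq (Runs.mono (Blk.runs _ (?_ : Blk.wp _ _ _ fun s' => Holds x l B s' ∧
        s'.reg 10 = i * x.N ∧ s'.reg 11 = i * x.N + min x.N (x.m' - i * x.N) ∧
        s'.reg 12 = as.length ∧ s'.reg 13 = 0 ∧ s'.reply = as.drop 0 ∧
        ∀ k (hk : k < as.length), k < 0 → s'.mem (x.buf + k) = as[k])) le_rfl
      fun s₁ h₁ => Runs.mono (Runs.while_count (t := 20) as.length (fun t s' => Holds x l B s' ∧
        s'.reg 10 = i * x.N ∧ s'.reg 11 = i * x.N + min x.N (x.m' - i * x.N) ∧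
        s'.reg 12 = as.length ∧ s'.reg 13 = t ∧ s'.reply = as.drop t ∧
        ∀ k (hk : k < as.length), k < t → s'.mem (x.buf + k) = as[k])
      h₁ (fun t s' ht h' => ?_) fun s' h' => ?_) ?_ ?_)
    · simp [Blk.wp]
      refine ⟨hu.congr ?_ ?_ rfl, u10, u11⟩
      · intro r hr
        simp [show r ≠ 13 by omega, show r ≠ 12 by omega]
      · simp
    · obtain ⟨hu, u10, u11, u12, u13, ur, um⟩ := h'
      have ha := hj _ (List.getElem_mem ht)
      have hhd : s'.reply.headD 0 % 2 ^ W = as[t] := by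
        rw [ur, List.drop_eq_getElem_cons ht]
        exact Nat.mod_eq_of_lt (show as[t] < _ by omega)
      refine ⟨by simp, by simp [u12, u13, ht], (Blk.runs _ ?_).mono (by decide) fun _ h => h⟩
      simp only [Blk.wp, hhd]
      simp [hW, u13, hu.r7]
      and_intros <;> try omega
      · refine hu.congr ?_ ?_ hu.query
        · intro r hr
          simp [show r ≠ 13 by omega, show r ≠ 14 by omega]
        · intro b hb
          simp only [Config.setReg_mem, Config.setMem_mem]
          rw [if_neg (by omega)]
      · simp [ur]
      · intro k hk hkt
        simp only [Config.setReg_mem, Config.setMem_mem]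
        rcases Nat.le_iff_lt_or_eq.1 hkt with hkt | rfl
        · rw [if_neg (by omega), um k hk hkt]
        · simp
    · obtain ⟨hu, u10, u11, u12, u13, ur, um⟩ := h'
      simp [u12, u13]
    · have := Nat.mul_le_mul_right (20 + 5 + 1) hc
      simp [Expr.cost, Expr.lt]
      omega
    · rintro s' ⟨hu, u10, u11, u12, u13, ur, um⟩
      exact { hu with r10 := u10, r11 := u11, r12 := u12, answer := fun t ht => um t ht ht }
  · have := Nat.mul_le_mul_right 26 (min_le_left x.N (x.m' - i * x.N))
    omega

/-- The greatest position of the `i`-th block plus one. -/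
theorem add_min_sub {i : ℕ} (hi : i * x.N < x.m') :
    i * x.N + min x.N (x.m' - i * x.N) = min ((i + 1) * x.N) x.m' := by
  rw [Nat.succ_mul]
  omega

theorem div_eq (hG : Good W D x c h T) {i p : ℕ} (h1 : i * x.N ≤ p) (h2 : p < (i + 1) * x.N) :
    p / x.N = i := by
  have := hG.posN
  exact Nat.div_eq_of_lt_le h1 h2

/-- The time bound for a block. -/
def blockTime (N c h T : ℕ) : ℕ := T + N * (c * (h * 100 + 110) + 100) + c * 30 + 100

theorem emitAll_spec (hG : Good W D x c h T) (hW : W ≠ 0) {i : ℕ} (hi : i * x.N < x.m')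
    (hs : Holds x ((List.range (i * x.N)).flatMap (x.rowEdges D)) (i * x.N * (c * h)) s)
    (h10 : s.reg 10 = i * x.N) :
    Runs W D emitAll (blockTime x.N c h T) s fun s' =>
      Holds x ((List.range (min ((i + 1) * x.N) x.m')).flatMap (x.rowEdges D))
        (min ((i + 1) * x.N) x.m' * (c * h)) s' ∧ s'.reg 10 = min ((i + 1) * x.N) x.m' := by
  have hf := hG.fits
  have hMm := M_le hG
  have hcM := hG.cM
  have hc := hG.count i hi
  have hbuf : x.buf = 2 * (x.m + x.m') := rfl
  have hsum := add_min_sub hi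
  refine Runs.mono (Runs.seq (Runs.mono (Blk.runs _ (?_ : Blk.wp _ _ _ fun s' =>
      Holds x ((List.range (i * x.N)).flatMap (x.rowEdges D)) (i * x.N * (c * h)) s' ∧
        s'.reg 10 = i * x.N ∧ s'.reg 11 = i * x.N + min x.N (x.m' - i * x.N))) le_rfl
    fun s₁ h₁ => Runs.seq (Runs.mono (decode_spec hG hW h₁.1 hi h₁.2.1 h₁.2.2) le_rfl
    fun s₂ h₂ => Runs.seq (Runs.mono (Blk.runs _ (?_ : Blk.wp _ _ _ fun s' =>
      Within x (D.answer (x.query i)) (i * x.N) (i * x.N + min x.N (x.m' - i * x.N))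
        ((List.range (i * x.N + 0)).flatMap (x.rowEdges D)) ((i * x.N + 0) * (c * h)) s' ∧
        s'.reg 14 = i * x.N + 0)) le_rfl
    fun s₃ h₃ => Runs.seq (Runs.mono (Runs.while_count (t := c * (h * 100 + 110) + 30)
      (min x.N (x.m' - i * x.N)) (fun k s' =>
        Within x (D.answer (x.query i)) (i * x.N) (i * x.N + min x.N (x.m' - i * x.N))
        ((List.range (i * x.N + k)).flatMap (x.rowEdges D)) ((i * x.N + k) * (c * h)) s' ∧
        s'.reg 14 = i * x.N + k) h₃ (fun k s' hk h' => ?_) fun s' h' => ?_) le_rfl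
    fun s₄ h₄ => Blk.runs _ ?_))))) ?_ fun _ h => h
  · simp [Blk.wp, h10, hs.r2, hs.r5]
    have key : ∀ s' : Config, (∀ r < 8, s'.reg r = s.reg r) → s'.mem = s.mem →
        s'.query = s.query →
        Holds x ((List.range (i * x.N)).flatMap (x.rowEdges D)) (i * x.N * (c * h)) s' :=
      fun s' h1 h2 h3 => hs.congr h1 (by simp [h2]) (h3.trans hs.query)
    and_intros <;> try omega
    · intro hlt
      refine ⟨key _ (fun r hr => ?_) rfl rfl, by omega⟩
      simp [show r ≠ 11 by omega]
    · intro hlt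
      refine ⟨key _ (fun r hr => ?_) rfl rfl, by omega⟩
      simp [show r ≠ 11 by omega]
  · simp [Blk.wp, h₂.r10]
    exact h₂.setReg (by norm_num) _
  · obtain ⟨hw, e14⟩ := h'
    have hp : i * x.N + k < x.m' := by omega
    have hB := Nat.mul_le_mul_right (c * h) (Nat.succ_le_of_lt hp)
    rw [Nat.succ_mul] at hB
    have hdiv := div_eq hG (show i * x.N ≤ i * x.N + k by omega)
      (show i * x.N + k < (i + 1) * x.N by rw [Nat.succ_mul]; omega)
    refine ⟨by simp, by simp [e14, hw.r11]; omega, (emitRow_spec hG hW hw hc hB e14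
      (hG.index i hi) hp).mono le_rfl ?_⟩
    rintro s'' ⟨hw, e14⟩
    refine ⟨?_, e14⟩
    rw [← add_assoc, List.range_succ, List.flatMap_append, Nat.succ_mul]
    simpa [Input.rowEdges, hdiv] using hw
  · obtain ⟨hw, e14⟩ := h'
    simp [e14, hw.r11]
  · obtain ⟨hw, e14⟩ := h₄
    rw [hsum] at hw
    simp [Blk.wp, hw.r11]
    refine hw.toHolds.congr (fun r hr => ?_) (fun _ _ => rfl) hw.query
    simp [show r ≠ 10 by omega]
  · have e1 : (Expr.lt (.var 14) (.var 11)).cost = 5 := rfl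
    have := Nat.mul_le_mul_right (c * (h * 100 + 110) + 30 + 5 + 1)
      (min_le_left x.N (x.m' - i * x.N))
    simp [blockTime, Blk.cost, Expr.cost, Expr.lt]
    have h2 : x.N * (c * (h * 100 + 110) + 100) =
      x.N * (c * (h * 100 + 110) + 30 + 5 + 1) + x.N * 64 := by ring
    omega

/-- The time bound for `program` if the second string has `b` blocks. -/
def time (b N c h T : ℕ) : ℕ := b * (blockTime N c h T + 10) + 100

theorem setup_wp (hG : Good W D x c h T) (h0 : s.reg 0 = x.m) (h1 : s.reg 1 = x.m')
    (h2 : s.reg 2 = x.N) (h3 : min (s.reg 3) x.M = x.w) (hm : s.mem = x.v)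
    (hz : ∀ b, x.buf ≤ b → x.v b = 0) (hq : s.query = []) :
    setup.wp W s fun s' => Holds x [] 0 s' ∧ s'.reg 10 = 0 := by
  have hf := hG.fits
  have hMm := M_le hG
  have hbuf : x.buf = 2 * (x.m + x.m') := rfl
  have hdiv : x.m / x.N = x.M := by
    rw [hG.len]
    exact Nat.mul_div_cancel_left _ hG.posN
  simp [setup, Blk.wp, h0, h1, h2, hdiv, ← hbuf]
  and_intros <;> try omega
  · intro hlt
    and_intros <;> try omega
    constructor <;> simp [h2, hm, hq, Config.pairs]
    · omega
    · exact fun b hb => hz b (by omega)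
  · intro hlt
    and_intros <;> try omega
    constructor <;> simp [h2, hm, hq, Config.pairs]
    · omega
    · exact fun b hb => hz b (by omega)

theorem program_spec (hG : Good W D x c h T) (hW : W ≠ 0) (h0 : s.reg 0 = x.m)
    (h1 : s.reg 1 = x.m') (h2 : s.reg 2 = x.N) (h3 : min (s.reg 3) x.M = x.w) (hm : s.mem = x.v)
    (hz : ∀ b, x.buf ≤ b → x.v b = 0) (hq : s.query = []) :
    Runs W D program (time ((x.m' + x.N - 1) / x.N) x.N c h T) s
      (Holds x (x.edges D) (x.m' * (c * h))) := by
  have hN := hG.posN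
  generalize hb : (x.m' + x.N - 1) / x.N = b
  have hlt : ∀ i < b, i * x.N < x.m' := by
    intro i hi
    have := Nat.mul_le_of_le_div _ _ _ (hb.symm ▸ Nat.succ_le_of_lt hi)
    rw [Nat.succ_mul] at this
    omega
  have hge : x.m' ≤ b * x.N := by
    have := (Nat.div_lt_iff_lt_mul hN).1 (show (x.m' + x.N - 1) / x.N < b + 1 by omega)
    rw [Nat.succ_mul] at this
    omega
  refine Runs.mono (Runs.seq (Runs.mono (Blk.runs _ (setup_wp hG h0 h1 h2 h3 hm hz hq)) le_rfl
    fun s₁ h₁ => Runs.while_count (t := blockTime x.N c h T) b (fun i s' =>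
      Holds x ((List.range (min (i * x.N) x.m')).flatMap (x.rowEdges D))
        (min (i * x.N) x.m' * (c * h)) s' ∧ s'.reg 10 = min (i * x.N) x.m')
      (by simpa using h₁) (fun i s' hi h' => ?_) fun s' h' => ?_)) ?_ ?_
  · obtain ⟨h, h10⟩ := h'
    have := hlt i hi
    rw [min_eq_left this.le] at h h10
    exact ⟨by simp, by simp [h10, h.r5, this], emitAll_spec hG hW this h h10⟩
  · obtain ⟨h, h10⟩ := h'
    simp [h10, h.r5, hge]
  · rw [time]
    have e1 : (Expr.lt (.var 10) (.var 5)).cost = 5 := rfl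
    have e2 : setup.cost ≤ 60 := by decide
    have := Nat.mul_le_mul_left b
      (show blockTime x.N c h T + 5 + 1 ≤ blockTime x.N c h T + 10 by omega)
    rw [e1]
    omega
  · rintro s' ⟨h, -⟩
    rwa [min_eq_right hge] at h

end Listing

/-! ### The list of edges and the graph -/

namespace Listing

open Input

theorem getD_flatMap_pair {α : Type*} (f g : α → ℕ) (l : List α) (p : ℕ) :
    (l.flatMap fun y => [f y, g y]).getD (2 * p) 0 = (l[p]?.map f).getD 0 ∧
      (l.flatMap fun y => [f y, g y]).getD (2 * p + 1) 0 = (l[p]?.map g).getD 0 := by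
  induction l generalizing p with
  | nil => simp
  | cons y l ih =>
    cases p with
    | zero => simp
    | succ p => simpa [Nat.mul_succ] using ih p

section graph

variable {σ q : ℕ} (N w M : ℕ) (S S' : List (Fin σ × Fin q))

/-- The input for two strings. -/
def ofStrings : Input where
  N := N
  w := w
  M := M
  m := S.length
  m' := S'.length
  v := fun a => (inputWords S S').getD a 0

variable {N w M S S'}

theorem v_left {p : ℕ} (hp : p < S.length) : (ofStrings N w M S S').v (2 * p) = S[p].1 ∧
    (ofStrings N w M S S').v (2 * p + 1) = S[p].2 := by
  have := getD_flatMap_pair (fun y : Fin σ × Fin q => y.1.val) (fun y => y.2.val) (S ++ S') p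
  rw [List.getElem?_append_left hp, List.getElem?_eq_getElem hp] at this
  exact this

theorem v_right {p : ℕ} (hp : p < S'.length) :
    (ofStrings N w M S S').v (2 * (S.length + p)) = S'[p].1 ∧
      (ofStrings N w M S S').v (2 * (S.length + p) + 1) = S'[p].2 := by
  have := getD_flatMap_pair (fun y : Fin σ × Fin q => y.1.val) (fun y => y.2.val) (S ++ S')
    (S.length + p)
  rw [List.getElem?_append_right (by omega), Nat.add_sub_cancel_left,
    List.getElem?_eq_getElem hp] at this
  exact this

theorem v_eq_zero {a : ℕ} (ha : (ofStrings N w M S S').buf ≤ a) :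
    (ofStrings N w M S S').v a = 0 := by
  refine List.getD_eq_default _ _ ?_
  simp only [buf, ofStrings] at ha
  simp [inputWords, List.length_flatMap]
  omega

theorem v_lt {W : ℕ} (hσ : σ ≤ 2 ^ W) (hq : q ≤ 2 ^ W) (a : ℕ) :
    (inputWords S S').getD a 0 < 2 ^ W := by
  rcases lt_or_ge a (inputWords S S').length with h | h
  · rw [List.getD_eq_getElem _ _ h]
    obtain ⟨y, -, hy⟩ := List.mem_flatMap.1 (List.getElem_mem h)
    have h1 := y.1.2
    have h2 := y.2.2
    simp only [List.mem_cons, List.not_mem_nil, or_false] at hy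
    omega
  · rw [List.getD_eq_default _ _ h]
    exact Nat.two_pow_pos W

theorem same_iff {p p' : ℕ} (hp : p < S.length) (hp' : p' < S'.length) :
    (ofStrings N w M S S').Same p p' ↔ S[p] = S'[p'] := by
  rw [Same, (v_left hp).1, (v_left hp).2]
  change _ = (ofStrings N w M S S').v (2 * (S.length + p')) ∧
    _ = (ofStrings N w M S S').v (2 * (S.length + p') + 1) ↔ _
  rw [(v_right hp').1, (v_right hp').2, Prod.ext_iff, Fin.ext_iff, Fin.ext_iff]

theorem query_eq (i : ℕ) :
    (ofStrings N w M S S').query i = toWords (indexBlock N S' i) := by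
  refine List.ext_getElem ?_ fun k h1 h2 => ?_
  · simp [Input.query, ofStrings, toWords, indexBlock]
  · have h3 : i * N + k < S'.length := by
      simp [Input.query, ofStrings] at h1
      omega
    simp only [Input.query, toWords, indexBlock, List.getElem_map, List.getElem_range',
      List.getElem_take, List.getElem_drop, one_mul]
    exact (v_right (N := N) (w := w) (M := M) h3).2

/-- A natural number is at most `1 / ε` away from another one iff it is at most `⌊1 / ε⌋` away. -/
theorem abs_sub_le_iff {k j : ℕ} {y : ℝ} (hy : 0 ≤ y) :
    |(k : ℝ) - j| ≤ y ↔ k ≤ j + ⌊y⌋₊ ∧ j ≤ k + ⌊y⌋₊ := by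
  rcases le_total j k with h | h
  · rw [abs_of_nonneg (by simpa using h), ← Nat.cast_sub h, ← Nat.le_floor_iff hy]
    omega
  · rw [abs_of_nonpos (by simpa using h), neg_sub, ← Nat.cast_sub h, ← Nat.le_floor_iff hy]
    omega

theorem mem_part {x : Input} {p' j k : ℕ} {e : ℕ × ℕ} : e ∈ x.part p' j k ↔
    e.2 = p' ∧ x.lo j ≤ e.1 ∧ e.1 < x.lo j + k ∧ x.Same e.1 p' := by
  obtain ⟨p, p''⟩ := e
  simp only [part, List.mem_map, List.mem_filter, List.mem_range'_1, decide_eq_true_eq,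
    Prod.mk.injEq]
  constructor
  · rintro ⟨a, ⟨⟨h1, h2⟩, h3⟩, rfl, rfl⟩
    exact ⟨rfl, h1, h2, h3⟩
  · rintro ⟨rfl, h1, h2, h3⟩
    exact ⟨p, ⟨⟨h1, h2⟩, h3⟩, rfl, rfl⟩

theorem mem_edges_iff {ε : ℝ} {D : Oracle} (hε : 0 < ε) (hN : 0 < N)
    (hS : S.length = N * M) (hw : w = min ⌊1 / ε⌋₊ M)
    (hD : ∀ i, ∀ j ∈ D.answer (toWords (indexBlock N S' i)), j < M) (e : ℕ × ℕ) :
    e ∈ (ofStrings N w M S S').edges D ↔ e ∈ graphEdges N ε D S S' := by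
  obtain ⟨p, p'⟩ := e
  set x := ofStrings N w M S S' with hx
  have hxm : x.m' = S'.length := rfl
  have hblock : ∀ j < M, (x.lo j ≤ p ∧ p < x.lo j + (x.hi j - x.lo j) ↔
      p < S.length ∧ |((p / N : ℕ) : ℝ) - j| ≤ 1 / ε) := by
    intro j hj
    have h1 : x.lo j ≤ x.hi j := lo_le_hi (x := x) hj
    have h2 : x.lo j ≤ p ↔ j - w ≤ p / N := (Nat.le_div_iff_mul_le hN).symm
    have h3 : p < x.hi j ↔ p / N < min M (j + w + 1) := (Nat.div_lt_iff_lt_mul hN).symm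
    have h4 : p < S.length ↔ p / N < M := by
      rw [hS, mul_comm]
      exact (Nat.div_lt_iff_lt_mul hN).symm
    rw [abs_sub_le_iff (by positivity), h2, h4, Nat.add_sub_cancel' h1, h3]
    generalize p / N = g
    omega
  simp only [edges, rowEdges, List.mem_flatMap, List.mem_range, mem_part, hxm]
  constructor
  · rintro ⟨_, hp', j, hj, rfl, h1, h2, h3⟩
    rw [query_eq] at hj
    obtain ⟨h4, h5⟩ := (hblock j (hD _ j hj)).1 ⟨h1, h2⟩
    exact ⟨h4, hp', (same_iff h4 hp').1 h3, j, hj, h5⟩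
  · rintro ⟨hp, hp', h1, j, hj, h2⟩
    obtain ⟨h4, h5⟩ := (hblock j (hD _ j hj)).2 ⟨hp, h2⟩
    exact ⟨p', hp', j, by rwa [query_eq], rfl, h4, h5, (same_iff hp hp').2 h1⟩

end graph

theorem pairwise_edges (x : Input) (D : Oracle) :
    (x.edges D).Pairwise fun e f => e.2 ≤ f.2 := by
  have key : ∀ p', ∀ e ∈ x.rowEdges D p', e.2 = p' := by
    intro p' e he
    obtain ⟨j, -, he⟩ := List.mem_flatMap.1 he
    exact (mem_part.1 he).1
  rw [edges, List.pairwise_flatMap]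
  refine ⟨fun p' _ => List.pairwise_of_forall_mem_list fun e he f hf => ?_,
    List.pairwise_lt_range.imp fun {p' q'} hpq e he f hf => ?_⟩
  · rw [key p' e he, key p' f hf]
  · rw [key p' e he, key q' f hf]
    exact hpq.le

/-! ### List decoders -/

variable {q N M L : ℕ} {C : InsdelCode q N M} {ε T : ℝ} {D : Oracle}

theorem answer_lt (hD : IsListDecoder C ε T D) {y : List (Fin q)} (hy : y.length ≤ N) :
    ∀ j ∈ D.answer (toWords y), j < M := by
  intro j hj
  obtain ⟨i, -, rfl⟩ := ((hD y hy).2.1 j).1 hj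
  exact i.2

theorem length_answer_le (hC : C.ListDecodable ε L) (hD : IsListDecoder C ε T D)
    {y : List (Fin q)} (hy : y.length ≤ N) : (D.answer (toWords y)).length ≤ min L M := by
  classical
  obtain ⟨h1, h2, -⟩ := hD y hy
  rw [← List.toFinset_card_of_nodup h1]
  refine le_min ?_ ?_
  · have : ((D.answer (toWords y)).toFinset : Set ℕ) = Fin.val '' C.candidates ε y := by
      ext k
      simp [h2]
    rw [← Set.ncard_coe_finset, this]
    exact (Set.ncard_image_le (Set.toFinite _)).trans (hC y)
  · have : (D.answer (toWords y)).toFinset ⊆ Finset.range M := by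
      intro k hk
      rw [List.mem_toFinset] at hk
      exact Finset.mem_range.2 (answer_lt hD hy k hk)
    simpa using Finset.card_le_card this

/-- The list size is positive, since each codeword can be turned into itself. -/
theorem list_size_pos (hC : C.ListDecodable ε L) (hε : ε < 1) (hM : 0 < M) : 0 < L := by
  have h0 : (0 : ℝ) ≤ N * (1 - ε) := mul_nonneg (Nat.cast_nonneg _) (by linarith)
  have : (⟨0, hM⟩ : Fin M) ∈ C.candidates ε (C.word ⟨0, hM⟩) :=
    ⟨_, List.Sublist.refl _, List.Sublist.refl _, by simpa using h0, by simpa using h0⟩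
  have h1 : 0 < (C.candidates ε (C.word ⟨0, hM⟩)).ncard :=
    (Set.ncard_pos (Set.toFinite _)).2 ⟨_, this⟩
  exact h1.trans_le (hC _)

end Listing

/-! ### Estimates and conclusion -/

open Listing Matching in
/-- The two programs, with explicit time bounds in terms of the number `b` of blocks, the bound `c`
for the list size, and the bound `h` for the number of positions that belong to a member of a
list. -/
theorem exists_exec {σ q N M L W n : ℕ} {ε : ℝ} {T : ℝ} {C : InsdelCode q N M} {D : Oracle}
    {m : List (Fin σ)} {S S' : List (Fin σ × Fin q)} (hN : 0 < N) (hM : 0 < M) (hε : 0 < ε)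
    (hC : C.ListDecodable ε L) (hD : IsListDecoder C ε T D)
    (hm : m.length = N * M) (hS : S = m.zip C.indexString)
    (hn : n = max S.length S'.length) (hn3 : 3 ≤ n) (hW : n ^ 10 ≤ 2 ^ W) (hσ : σ ≤ 2 ^ W)
    (hq : q ≤ 2 ^ W) (hw : ⌊1 / ε⌋₊ < 2 ^ W) :
    ∃ (h r K b : ℕ) (s₁ s₂ : Config) (t₁ t₂ : ℕ),
      0 < h ∧ h ≤ (2 * ⌊1 / ε⌋₊ + 1) * N ∧ r ≤ n * (L * h) ∧ (K = 0 ∨ VEB.U (K - 1) ≤ n) ∧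
      b * N ≤ 2 * n ∧ (graphEdges N ε D S S').ncard ≤ r ∧
      Exec W D Listing.program (startConfig S S' N ⌊1 / ε⌋₊) s₁ t₁ ∧
      (∀ e, e ∈ s₁.pairs ↔ e ∈ graphEdges N ε D S S') ∧
      Exec W D Matching.program s₁ s₂ t₂ ∧
      IsLargestNonCrossingMatching (graphEdges N ε D S S') s₂.pairs ∧
      t₁ ≤ Listing.time b N (min L M) h ⌊T⌋₊ ∧ t₂ ≤ Matching.time K r := by
  classical
  have hSlen : S.length = N * M := by
    have : C.indexString.length = N * M := by
      simp [InsdelCode.indexString, List.length_flatten, C.length_word, Function.comp_def,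
        mul_comm]
    rw [hS, List.length_zip, hm, this, min_self]
  have hSn : S.length ≤ n := hn ▸ le_max_left _ _
  have hSn' : S'.length ≤ n := hn ▸ le_max_right _ _
  have hMS : M ≤ S.length := hSlen ▸ Nat.le_mul_of_pos_left _ hN
  have hNS : N ≤ S.length := hSlen ▸ Nat.le_mul_of_pos_right _ hM
  set w := min ⌊1 / ε⌋₊ M with hwdef
  set x := ofStrings N w M S S' with hx
  set c := min L M with hc
  set h := min ((2 * ⌊1 / ε⌋₊ + 1) * N) S.length with hh
  have hhpos : 0 < h := lt_min (Nat.mul_pos (by omega) hN) (by omega)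
  have hblk : ∀ i, (indexBlock N S' i).length ≤ N := fun i => by
    simp [indexBlock]
  have hbuf : x.buf = 2 * (S.length + S'.length) := rfl
  have hch : c * h ≤ n * n :=
    Nat.mul_le_mul ((min_le_right _ _).trans (hMS.trans hSn)) ((min_le_right _ _).trans hSn)
  have hcnt : S'.length * (c * h) ≤ n * (n * n) := Nat.mul_le_mul hSn' hch
  -- the tree has about `n ^ 4` cells, and the list of edges at most `n ^ 3` entries
  have hpow : 8 * n ^ 4 + 50 * n ^ 3 + 1000 ≤ n ^ 10 := by
    have h3 : 3 ^ 3 ≤ n ^ 3 := Nat.pow_le_pow_left hn3 3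
    have h6 : 3 ^ 6 ≤ n ^ 6 := Nat.pow_le_pow_left hn3 6
    have h4 : n ^ 4 = n ^ 3 * n := by ring
    have h10 : n ^ 10 = n ^ 4 * n ^ 6 := by ring
    have h7 : n ^ 4 * 3 ^ 6 ≤ n ^ 4 * n ^ 6 := Nat.mul_le_mul_left _ h6
    have h8 : n ^ 3 * 3 ≤ n ^ 3 * n := Nat.mul_le_mul_left _ hn3
    omega
  have hn33 : n * (n * n) = n ^ 3 := by ring
  have hnn : n * 9 ≤ n ^ 3 := by nlinarith
  have hSS : 4 * S.length * S.length ≤ 4 * n ^ 3 := by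
    have : S.length * S.length ≤ n * n := Nat.mul_le_mul hSn hSn
    nlinarith
  have hW1 : 1 < 2 ^ W := by omega
  have hW0 : W ≠ 0 := by
    rintro rfl
    omega
  have hG : Good W D x c h ⌊T⌋₊ := by
    constructor
    case posN => exact hN
    case len => exact hSlen
    case wM => exact min_le_right _ _
    case count =>
      intro i _
      rw [query_eq]
      exact length_answer_le hC hD (hblk i)
    case cM => exact min_le_right _ _
    case index =>
      intro i _
      rw [query_eq]
      exact answer_lt hD (hblk i)
    case range =>
      intro j hj
      have h1 : x.hi j ≤ S.length := by
        rw [hSlen, mul_comm]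
        exact Nat.mul_le_mul_right _ (min_le_left _ _)
      refine le_min ?_ ((Nat.sub_le _ _).trans h1)
      rw [Input.hi, Input.lo, ← Nat.sub_mul]
      refine Nat.mul_le_mul_right _ ?_
      have : x.w = min ⌊1 / ε⌋₊ M := rfl
      omega
    case time =>
      intro i _
      rw [query_eq]
      exact Nat.le_floor (hD _ (hblk i)).2.2
    case fits =>
      change x.buf + M + 2 * (S'.length * (c * h)) + N + 100 + 4 * S.length * S.length ≤ _
      omega
  have hwf : (startConfig S S' N ⌊1 / ε⌋₊).WF W := by
    refine ⟨hW1, fun r => ?_, v_lt hσ hq⟩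
    rcases r with _ | _ | _ | _ | r
    · change S.length < _
      omega
    · change S'.length < _
      omega
    · change N < _
      omega
    · exact hw
    · change 0 < _
      omega
  obtain ⟨s₁, t₁, e₁, ht₁, u₁, hu₁, hold⟩ := Listing.program_spec (s := startConfig S S' N ⌊1 / ε⌋₊)
    hG hW0 rfl rfl rfl rfl rfl (fun b hb => v_eq_zero hb) rfl _ (Config.Eqv.refl _) hwf
  set l := x.edges D with hl
  have hmeml : ∀ e, e ∈ l ↔ e ∈ graphEdges N ε D S S' :=
    mem_edges_iff hε hN hSlen hwdef fun i => answer_lt hD (hblk i)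
  have hpairs : s₁.pairs = l := by
    rw [← hold.pairs, Config.pairs, Config.pairs, hu₁.1 0 (by norm_num), hu₁.1 1 (by norm_num),
      hu₁.2.1]
  have hrow : ∀ e f, e ≤ f → f < l.length → (l.getD e (0, 0)).2 ≤ (l.getD f (0, 0)).2 := by
    intro e f hef hf
    rcases hef.lt_or_eq with hef | rfl
    · rw [List.getD_eq_getElem _ _ hf, List.getD_eq_getElem _ _ (hef.trans hf)]
      exact List.pairwise_iff_getElem.1 (pairwise_edges x D) _ _ _ _ hef
    · exact le_rfl
  have hset : {y | ∃ e < l.length, y = ((l.getD e (0, 0)).1, (l.getD e (0, 0)).2)} =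
      graphEdges N ε D S S' := by
    ext y
    rw [← hmeml, List.mem_iff_getElem]
    constructor
    · rintro ⟨e, he, rfl⟩
      exact ⟨e, he, by rw [List.getD_eq_getElem _ _ he]⟩
    · rintro ⟨e, he, rfl⟩
      exact ⟨e, he, by rw [List.getD_eq_getElem _ _ he]⟩
  have hr4 := hold.r4
  have hlen := hold.bound
  change l.length ≤ S'.length * (c * h) at hlen
  change u₁.reg 4 = S.length at hr4
  have hPM : x.M = M := rfl
  have hent : ∀ e < l.length, u₁.mem (x.buf + x.M + 2 * e) = (l.getD e (0, 0)).1 ∧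
      u₁.mem (x.buf + x.M + 2 * e + 1) = (l.getD e (0, 0)).2 := by
    intro e he
    have h1 : u₁.pairs.getD e (0, 0) = l.getD e (0, 0) := by rw [hold.pairs]
    rw [← h1]
    simp [Config.pairs, hold.r1, hold.r0, he]
  obtain ⟨K, hK, hruns⟩ := Matching.program_spec (W := W) (D := D) (s := u₁) (n := n)
    (r := l.length) (P := x.buf + x.M)
    (col := fun e => (l.getD e (0, 0)).1) (row := fun e => (l.getD e (0, 0)).2) hW0 (by omega)
    hold.r0 hold.r1 (by omega) (by omega) (by omega) hent hold.zero
    (fun e he => by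
      have := (hmeml (l.getD e (0, 0))).1 (by
        rw [List.getD_eq_getElem _ _ he]
        exact List.getElem_mem he)
      obtain ⟨hp, -⟩ := this
      omega) hrow
  obtain ⟨s₂, t₂, e₂, ht₂, u₂, hu₂, hlarge⟩ := hruns s₁ hu₁ (e₁.wf hwf)
  have hpairs₂ : s₂.pairs = u₂.pairs := by
    rw [Config.pairs, Config.pairs, hu₂.1 0 (by norm_num), hu₂.1 1 (by norm_num), hu₂.2.1]
  refine ⟨h, l.length, K, (S'.length + N - 1) / N, s₁, s₂, t₁, t₂, hhpos, min_le_left _ _,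
    hlen.trans (Nat.mul_le_mul hSn' (Nat.mul_le_mul_right _ (min_le_left _ _))), hK,
    (Nat.div_mul_le_self _ _).trans (by omega), ?_, e₁, fun e => by rw [hpairs, hmeml], e₂, ?_,
    ht₁, ht₂⟩
  · have : graphEdges N ε D S S' = (l.toFinset : Set (ℕ × ℕ)) := by
      ext e
      rw [← hmeml]
      simp
    rw [this, Set.ncard_coe_finset]
    exact List.toFinset_card_le l
  · rw [hpairs₂, ← hset]
    exact hlarge

/-- The number of levels of the tree is of order `log (log n)`. -/
theorem exists_level_le : ∃ A : ℝ, 0 ≤ A ∧ ∀ n K : ℕ, 3 ≤ n → (K = 0 ∨ VEB.U (K - 1) ≤ n) →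
    (K : ℝ) + 1 ≤ A * Real.log (Real.log n) := by
  have h3 : 1 < Real.log 3 := by
    rw [Real.lt_log_iff_exp_lt (by norm_num)]
    linarith [Real.exp_one_lt_d9]
  have hc : 0 < Real.log (Real.log 3) := Real.log_pos h3
  have h2 : 0 < Real.log 2 := Real.log_pos (by norm_num)
  have h22 : Real.log (Real.log 2) < 0 :=
    Real.log_neg h2 (by linarith [Real.log_two_lt_d9])
  have h7 : 0 ≤ 2 - Real.log (Real.log 2) / Real.log 2 := by
    have := div_neg_of_neg_of_pos h22 h2
    linarith
  refine ⟨1 / Real.log 2 + (2 - Real.log (Real.log 2) / Real.log 2) / Real.log (Real.log 3),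
    by positivity, fun n K hn hK => ?_⟩
  have hn' : (3 : ℝ) ≤ n := by exact_mod_cast hn
  have hlog : Real.log 3 ≤ Real.log n := Real.log_le_log (by norm_num) hn'
  have hll : Real.log (Real.log 3) ≤ Real.log (Real.log n) :=
    Real.log_le_log (by linarith) hlog
  -- take logarithms twice in `2 ^ 2 ^ (K - 1) ≤ n`
  have key : ((K : ℝ) - 1) * Real.log 2 + Real.log (Real.log 2) ≤ Real.log (Real.log n) := by
    rcases K with _ | K
    · push_cast
      nlinarith
    · have hU : VEB.U K ≤ n := by simpa using hK
      have h4 : ((2 : ℝ) ^ 2 ^ K) ≤ n := by exact_mod_cast hU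
      have h5 := Real.log_le_log (by positivity) h4
      rw [Real.log_pow] at h5
      have h6 := Real.log_le_log (by positivity) h5
      rw [Real.log_mul (by positivity) h2.ne'] at h6
      push_cast at h6 ⊢
      rw [Real.log_pow] at h6
      linarith
  have h8 : 2 - Real.log (Real.log 2) / Real.log 2 ≤
      (2 - Real.log (Real.log 2) / Real.log 2) / Real.log (Real.log 3) *
        Real.log (Real.log n) := by
    rw [div_mul_eq_mul_div, le_div_iff₀ hc]
    exact mul_le_mul_of_nonneg_left hll h7
  have h9 : (K : ℝ) - 1 + Real.log (Real.log 2) / Real.log 2 ≤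
      1 / Real.log 2 * Real.log (Real.log n) := by
    rw [div_mul_eq_mul_div, one_mul, le_div_iff₀ h2, add_mul, div_mul_cancel₀ _ h2.ne']
    exact key
  rw [add_mul]
  linarith

/-- The running time of the first program is proportional to the number of symbols in the second
string times the greatest number of edges at a symbol, plus the time for the decoder. -/
theorem Listing.time_le {b N c h T n L : ℕ} (hN : 0 < N) (hn : 0 < n) (hh : 0 < h)
    (hL : 0 < L) (hc : c ≤ L) (hb : b * N ≤ 2 * n) :
    Listing.time b N c h T ≤ b * T + 2000 * (n * (L * h)) := by
  have hLh : L ≤ L * h := Nat.le_mul_of_pos_right _ hh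
  have hL1 : 1 ≤ L * h := Nat.mul_pos hL hh
  have h1 : blockTime N c h T + 10 ≤ T + N * (450 * (L * h)) := by
    have h2 : c * (h * 100 + 110) + 100 + c * 30 + 110 ≤ 450 * (L * h) := by
      have h3 : c * h ≤ L * h := Nat.mul_le_mul_right _ hc
      have h4 : c * (h * 100 + 110) = 100 * (c * h) + 110 * c := by ring
      omega
    have h5 : N * (c * (h * 100 + 110) + 100) + c * 30 + 110 ≤
        N * (c * (h * 100 + 110) + 100 + c * 30 + 110) := by
      nlinarith [Nat.zero_le (c * 30)]
    have h6 := Nat.mul_le_mul_left N h2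
    rw [blockTime]
    omega
  have h7 : b * (T + N * (450 * (L * h))) = b * T + b * N * (450 * (L * h)) := by ring
  have h8 := Nat.mul_le_mul_left b h1
  have h9 := Nat.mul_le_mul_right (450 * (L * h)) hb
  have h10 : 2 * n * (450 * (L * h)) = 900 * (n * (L * h)) := by ring
  have h11 : 1 ≤ n * (L * h) := Nat.mul_pos hn hL1
  rw [Listing.time]
  omega

theorem mainTheorem10 :
    ∃ (buildGraph findMatching : Cmd) (c : ℕ) (K : ℝ),
      ∀ (σ q N M L W : ℕ) (ε : ℝ) (TDec : ℕ → ℝ) (C : InsdelCode q N M) (D : Oracle)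
        (m : List (Fin σ)) (S S' : List (Fin σ × Fin q)) (n : ℕ),
        0 < N → 0 < M → 0 < ε → ε < 1 →
        C.ListDecodable ε L → IsListDecoder C ε (TDec N) D →
        m.length = N * M → S = m.zip C.indexString →
        n = max S.length S'.length → 3 ≤ n →
        -- the word length is at least `c * log₂ n`, and each part of the input fits into a word
        n ^ c ≤ 2 ^ W → σ ≤ 2 ^ W → q ≤ 2 ^ W → ⌊1 / ε⌋₊ < 2 ^ W →
        ((graphEdges N ε D S S').ncard : ℝ) ≤ K * (n * N * L / ε) ∧
        ∃ (s₁ s₂ : Config) (t₁ t₂ : ℕ),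
          Exec W D buildGraph (startConfig S S' N ⌊1 / ε⌋₊) s₁ t₁ ∧
          (∀ e, e ∈ s₁.pairs ↔ e ∈ graphEdges N ε D S S') ∧
          Exec W D findMatching s₁ s₂ t₂ ∧
          IsLargestNonCrossingMatching (graphEdges N ε D S S') s₂.pairs ∧
          ((t₁ + t₂ : ℕ) : ℝ) ≤
            K * (n / N * TDec N + N * L / ε * (n * Real.log (Real.log n))) := by
  obtain ⟨A, hA, hlevel⟩ := exists_level_le
  obtain ⟨B, hB⟩ := Matching.exists_time_le
  refine ⟨Listing.program, Matching.program, 10, 3 + 6000 * A + 4 * B * A, ?_⟩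
  intro σ q N M L W ε TDec C D m S S' n hN hM hε hε1 hC hD hm hS hn hn3 hW hσ hq hw
  obtain ⟨h, r, K, b, s₁, s₂, t₁, t₂, hh, hhw, hr, hK, hb, hcard, e₁, hmem, e₂, hlarge, ht₁, ht₂⟩ :=
    exists_exec hN hM hε hC hD hm hS hn hn3 hW hσ hq hw
  have hL := Listing.list_size_pos hC hε1 hM
  have hT : 0 ≤ TDec N := (Nat.cast_nonneg _).trans (hD [] (Nat.zero_le _)).2.2
  have hN' : (1 : ℝ) ≤ N := by exact_mod_cast hN
  have hL' : (1 : ℝ) ≤ L := by exact_mod_cast hL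
  have hn' : (3 : ℝ) ≤ n := by exact_mod_cast hn3
  have hε' : 1 ≤ 1 / ε := by rw [le_div_iff₀ hε]; linarith
  have hfl : (⌊1 / ε⌋₊ : ℝ) ≤ 1 / ε := Nat.floor_le (by positivity)
  have hh' : (h : ℝ) ≤ 3 * (1 / ε) * N := by
    have h1 : (h : ℝ) ≤ (2 * ⌊1 / ε⌋₊ + 1) * N := by exact_mod_cast hhw
    have h2 : (2 * ⌊1 / ε⌋₊ + 1 : ℝ) ≤ 3 * (1 / ε) := by linarith
    exact h1.trans (by gcongr)
  set X : ℝ := n * N * L / ε with hX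
  set ll := Real.log (Real.log n) with hll
  have hXh : ((n * (L * h) : ℕ) : ℝ) ≤ 3 * X := by
    push_cast
    have e : 3 * X = n * (L * (3 * (1 / ε) * N)) := by
      rw [hX]
      ring
    rw [e]
    gcongr
  have hX1 : 1 ≤ X := by
    have e : X = n * (N * (L * (1 / ε))) := by
      rw [hX]
      ring
    rw [e]
    exact one_le_mul_of_one_le_of_one_le (by linarith) (one_le_mul_of_one_le_of_one_le hN'
      (one_le_mul_of_one_le_of_one_le hL' hε'))
  have hrX : (r : ℝ) ≤ 3 * X := (Nat.cast_le.2 hr).trans hXh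
  have hlev : (K : ℝ) + 1 ≤ A * ll := hlevel n K hn3 hK
  -- this absorbs the terms without the factor `log (log n)`
  have hll1 : 1 ≤ A * ll := by
    have := Nat.cast_nonneg (α := ℝ) K
    linarith
  have hAB : 0 ≤ 4 * (B : ℝ) * A := by positivity
  refine ⟨?_, s₁, s₂, t₁, t₂, e₁, hmem, e₂, hlarge, ?_⟩
  · have h1 : ((graphEdges N ε D S S').ncard : ℝ) ≤ 3 * X := (Nat.cast_le.2 hcard).trans hrX
    refine h1.trans ?_
    gcongr
    linarith
  · have hll0 : 0 ≤ ll := by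
      by_contra hneg
      nlinarith
    have h1 : (t₁ : ℝ) ≤ 2 * (n / N * TDec N) + 6000 * X := by
      have h2 : t₁ ≤ b * ⌊TDec N⌋₊ + 2000 * (n * (L * h)) :=
        ht₁.trans (Listing.time_le hN (by omega) hh hL (min_le_left _ _) hb)
      have h3 : (t₁ : ℝ) ≤ b * ⌊TDec N⌋₊ + 2000 * ((n * (L * h) : ℕ) : ℝ) := by
        exact_mod_cast h2
      have h4 : (b : ℝ) ≤ 2 * n / N := by
        rw [le_div_iff₀ (by linarith)]
        exact_mod_cast hb
      have h5 : (b : ℝ) * ⌊TDec N⌋₊ ≤ 2 * n / N * TDec N :=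
        mul_le_mul h4 (Nat.floor_le hT) (Nat.cast_nonneg _) (by positivity)
      have e : 2 * n / N * TDec N = 2 * (n / N * TDec N) := by ring
      linarith
    have h2 : (t₂ : ℝ) ≤ 4 * B * (X * (A * ll)) := by
      have h3 : (t₂ : ℝ) ≤ B * ((r + 1) * (K + 1)) := by
        exact_mod_cast ht₂.trans (hB K r)
      have h4 : ((r : ℝ) + 1) * (K + 1) ≤ 4 * X * (A * ll) :=
        mul_le_mul (by linarith) hlev (by positivity) (by linarith)
      have h5 := mul_le_mul_of_nonneg_left h4 (Nat.cast_nonneg (α := ℝ) B)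
      linarith
    have h3 : X ≤ X * (A * ll) := le_mul_of_one_le_right (by linarith) hll1
    have h4 : 0 ≤ (1 + 6000 * A + 4 * B * A) * (n / N * TDec N) := by positivity
    have h5 : 0 ≤ 3 * (X * ll) := by positivity
    have e : N * L / ε * (n * ll) = X * ll := by
      rw [hX]
      ring
    rw [e]
    push_cast
    linarith
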